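/- Work over $\mathbb{C}$, with $S=\mathbb{C}[x,y,z]$. For a homogeneous $f\in S$ of degree $m$ let $J_f=\langle f_x,f_y,f_z\rangle$ be the Jacobian ideal, $I_f$ its saturation with respect to $\langle x,y,z\rangle$, and $N(f)=I_f/J_f$. A reduced curve $f=0$ in $\mathbb{P}^2_{\mathbb{C}}$ is *nearly free* if $N(f)\neq 0$ and $\dim_{\mathbb C} N(f)_k\leq 1$ for every $k$. Let $\mathrm{mdr}(f)$ be the least $r$ such that there are $a,b,c\in S$, homogeneous of degree $r$ and not all zero, with $af_x+bf_y+cf_z=0$. Let $\tau(f)=\sum_p\tau_p$ be the total Tjurina number, the sum over the singular points $p$ of $f=0$ of $\tau_p=\dim_{\mathbb{C}}\mathbb{C}[[u,v]]/\langle g,g_u,g_v\rangle$, where $g$ is a local equation at $p$. A *node* is a point at which the curve consists of two smooth branches with different tangents; a *tacnode* is a point at which it consists of two smooth branches with a common tangent and intersection multiplicity $2$; an *ordinary triple point* is a point at which it consists of three smooth branches with pairwise different tangents. A *conic-line arrangement* is a union of $d\geq 1$ pairwise distinct lines and $k\geq 1$ pairwise distinct smooth conics in $\mathbb{P}^2_{\mathbb{C}}$;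 its degree is $m=2k+d$. If its only singular points are $n_2$ nodes, $t$ tacnodes and $n_3$ ordinary triple points, then $(d,k;n_2,t,n_3)$ is its weak combinatorics. (1) The following are defining equations of conic-line arrangements whose only singularities are nodes, tacnodes and ordinary triple points, with the following weak combinatorics, total Tjurina numbers and minimal degrees of relations. Each of them satisfies $r^2-r(m-1)+(m-1)^2=\tau+1$, where $r=\mathrm{mdr}$, and each of them is nearly free. - $m=3$: $(x^2+y^2-16z^2)(y-x+4z)$, with $(d,k;n_2,t,n_3)=(1,1;2,0,0)$, $\tau=2$, $\mathrm{mdr}=1$; - $m=4$: $(x^2+y^2-16z^2)(y-x-4z)(y+x-4z)$, with $(2,1;2,0,1)$, $\tau=6$, $\mathrm{mdr}=2$; - $m=4$: $(x^2+y^2-16z^2)(y-4z)(y-x)$, with $(2,1;3,1,0)$, $\tau=6$, $\mathrm{mdr}=2$; - $m=5$: $(x^2+y^2-16z^2)(y-x+4z)(y+x-4z)(y-x-4z)$, with $(3,1;3,0,2)$, $\tau=11$, $\mathrm{mdr}=2$; - $m=6$: $(x^2+y^2-16z^2)(y-x+4z)(y+x-4z)(y-x-4z)(y+x+4z)$, with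 $(4,1;2,0,4)$, $\tau=18$, $\mathrm{mdr}=2$; - $m=7$: $(x^2+y^2-z^2)(x^2-z^2)(y^2-z^2)(y+x)$, with $(5,1;6,4,2)$, $\tau=26$, $\mathrm{mdr}=3$. In particular, two distinct weak combinatorics are realised by nearly free arrangements in degree $4$. (2) For every $m\in\{3,4,5,6,7\}$ there is a nearly free conic-line arrangement of degree $m$ whose only singularities are nodes, tacnodes and ordinary triple points. (3) Every nearly free conic-line arrangement of degree $3$ whose only singularities are nodes, tacnodes and ordinary triple points has $d=k=1$ and $(n_2,t,n_3)=(2,0,0)$. -/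

import Mathlib

open MvPolynomial

noncomputable section

namespace ConicLine

/-- The homogeneous coordinate ring `S = ℂ[x, y, z]` of the complex projective plane. -/
abbrev S : Type := MvPolynomial (Fin 3) ℂ

/-- The complex projective plane. -/
abbrev Plane : Type := Projectivization ℂ (Fin 3 → ℂ)

/-- The ring of formal power series `ℂ[[u, v]]`, in which germs of plane curves live. -/
abbrev Germ : Type := MvPowerSeries (Fin 2) ℂ

/-! ### Conic-line arrangements -/

/-- `ℓ` is an equation of a line. -/
def IsLine (ℓ : S) : Prop := ℓ.IsHomogeneous 1 ∧ ℓ ≠ 0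

/-- `q` is an equation of a smooth conic: a quadratic form whose partial derivatives have no
common zero in the projective plane. -/
def IsSmoothConic (q : S) : Prop :=
  q.IsHomogeneous 2 ∧ ∀ v : Fin 3 → ℂ, (∀ i, eval v (pderiv i q) = 0) → v = 0

/-- `f = 0` is an arrangement of `d` pairwise distinct lines and `k` pairwise distinct smooth
conics. (Two equations define the same line or conic iff they are proportional.) -/
def IsConicLineArrangement (d k : ℕ) (f : S) : Prop :=
  ∃ (ℓ : Fin d → S) (q : Fin k → S),
    (∀ i, IsLine (ℓ i)) ∧ (∀ j, IsSmoothConic (q j)) ∧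
    (Pairwise fun i i' => ¬ Associated (ℓ i) (ℓ i')) ∧
    (Pairwise fun j j' => ¬ Associated (q j) (q j')) ∧
    f = (∏ i, ℓ i) * ∏ j, q j

/-! ### Local equations -/

/-- The index of a coordinate that does not vanish at `p` (the last one). -/
def chartIndex (p : Plane) : Fin 3 :=
  if p.rep 2 ≠ 0 then 2 else if p.rep 1 ≠ 0 then 1 else 0

theorem rep_chartIndex_ne_zero (p : Plane) : p.rep (chartIndex p) ≠ 0 := by
  unfold chartIndex
  split_ifs with h2 h1
  · exact h2
  · exact h1
  · intro h0
    apply p.rep_nonzero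
    push Not at h1 h2
    funext i
    fin_cases i
    · exact h0
    · exact h1
    · exact h2

/-- The local equation of `f = 0` at `p`: set the coordinate with index `chartIndex p` to `1` and
translate the point `p` of that affine chart to the origin of the `(u, v)`-plane. -/
def localEquation (f : S) (p : Plane) : MvPolynomial (Fin 2) ℂ :=
  aeval ((chartIndex p).insertNth (α := fun _ => MvPolynomial (Fin 2) ℂ) 1
    (fun s : Fin 2 => X s + C (p.rep ((chartIndex p).succAbove s) / p.rep (chartIndex p)))) f

/-- The local equation as an element of `ℂ[[u, v]]`. -/
def germ (f : S) (p : Plane) : Germ := (localEquation f p : MvPowerSeries (Fin 2) ℂ)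

/-- `p` is a singular point of the curve `f = 0`. -/
def IsSingularPoint (f : S) (p : Plane) : Prop :=
  eval p.rep f = 0 ∧ ∀ i, eval p.rep (pderiv i f) = 0

/-! ### Nodes, tacnodes and ordinary triple points -/

/-- The linear part of a power series in two variables: the coefficients of `u` and of `v`. -/
def linearPart (g : Germ) : Fin 2 → ℂ :=
  fun i => MvPowerSeries.coeff (Finsupp.single i 1) g

/-- `g = 0` is a smooth branch through the origin. -/
def IsSmoothBranch (g : Germ) : Prop :=
  MvPowerSeries.constantCoeff g = 0 ∧ linearPart g ≠ 0

/-- Two smooth branches are transversal: they have different tangent lines. -/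
def Transversal (a b : Germ) : Prop := LinearIndependent ℂ ![linearPart a, linearPart b]

/-- The local intersection multiplicity of two germs at the origin. -/
def intersectionMultiplicity (a b : Germ) : ℕ :=
  Module.finrank ℂ (Germ ⧸ (Ideal.span {a, b} : Ideal Germ))

/-- A node (`A₁`): two smooth branches meeting transversally. -/
def IsNodeGerm (g : Germ) : Prop :=
  ∃ a b : Germ, IsSmoothBranch a ∧ IsSmoothBranch b ∧ Transversal a b ∧ g = a * b

/-- A tacnode (`A₃`): two smooth branches with a common tangent line and intersection
multiplicity `2`. -/
def IsTacnodeGerm (g : Germ) : Prop :=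
  ∃ a b : Germ, IsSmoothBranch a ∧ IsSmoothBranch b ∧ ¬ Transversal a b ∧
    intersectionMultiplicity a b = 2 ∧ g = a * b

/-- An ordinary triple point (`D₄`): three smooth branches with pairwise different tangents. -/
def IsOrdinaryTripleGerm (g : Germ) : Prop :=
  ∃ a : Fin 3 → Germ, (∀ i, IsSmoothBranch (a i)) ∧
    (Pairwise fun i j => Transversal (a i) (a j)) ∧ g = ∏ i, a i

def IsNode (f : S) (p : Plane) : Prop := IsNodeGerm (germ f p)

def IsTacnode (f : S) (p : Plane) : Prop := IsTacnodeGerm (germ f p)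

def IsOrdinaryTriplePoint (f : S) (p : Plane) : Prop := IsOrdinaryTripleGerm (germ f p)

/-- `f = 0` is an arrangement of `d` lines and `k` smooth conics whose singular points are exactly
`n₂` nodes, `t` tacnodes and `n₃` ordinary triple points. -/
structure HasWeakCombinatorics (f : S) (d k n₂ t n₃ : ℕ) : Prop where
  arrangement : IsConicLineArrangement d k f
  singular : ∀ p, IsSingularPoint f p → IsNode f p ∨ IsTacnode f p ∨ IsOrdinaryTriplePoint f p
  nodes : {p | IsNode f p}.encard = n₂
  tacnodes : {p | IsTacnode f p}.encard = t
  triples : {p | IsOrdinaryTriplePoint f p}.encard = n₃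

/-- The local Tjurina number `dim ℂ[[u, v]] / ⟨g, ∂g/∂u, ∂g/∂v⟩` of `f = 0` at `p`, where `g` is
the local equation. -/
def tjurinaNumber (f : S) (p : Plane) : ℕ :=
  Module.finrank ℂ (Germ ⧸ (Ideal.span
    {(localEquation f p : MvPowerSeries (Fin 2) ℂ),
     (pderiv 0 (localEquation f p) : MvPowerSeries (Fin 2) ℂ),
     (pderiv 1 (localEquation f p) : MvPowerSeries (Fin 2) ℂ)} : Ideal Germ))

/-- The total Tjurina number: the sum of the local ones over all singular points. -/
def totalTjurina (f : S) : ℕ :=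
  ∑ᶠ (p : Plane) (_ : IsSingularPoint f p), tjurinaNumber f p

/-! ### Syzygies and nearly free curves -/

/-- The minimal degree `r` of a non-trivial relation `a f_x + b f_y + c f_z = 0` with `a, b, c`
homogeneous of degree `r`. -/
def mdr (f : S) : ℕ :=
  sInf {r | ∃ a : Fin 3 → S, (∀ i, (a i).IsHomogeneous r) ∧ a ≠ 0 ∧ ∑ i, a i * pderiv i f = 0}

/-- The Jacobian ideal `J_f`. -/
def jacobianIdeal (f : S) : Ideal S := Ideal.span (Set.range fun i => pderiv i f)

/-- The irrelevant ideal `𝔪 = ⟨x, y, z⟩`. -/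
def irrelevantIdeal : Ideal S := Ideal.span (Set.range X)

/-- The saturation `I_f = ⋃ₙ (J_f : 𝔪ⁿ)` of the Jacobian ideal. -/
def saturatedJacobianIdeal (f : S) : Ideal S :=
  ⨆ n : ℕ, (jacobianIdeal f).colon ((irrelevantIdeal ^ n : Ideal S) : Set S)

/-- The graded `S`-module `N(f) = I_f / J_f`. -/
abbrev jacobianModule (f : S) : Type :=
  saturatedJacobianIdeal f ⧸ (jacobianIdeal f).submoduleOf (saturatedJacobianIdeal f)

/-- The graded piece `N(f)_k`: the classes of the forms of degree `k` in `I_f`. -/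
def jacobianModulePiece (f : S) (k : ℕ) : Submodule ℂ (jacobianModule f) :=
  ((homogeneousSubmodule (Fin 3) ℂ k).comap
    ((saturatedJacobianIdeal f).subtype.restrictScalars ℂ)).map
    (((jacobianIdeal f).submoduleOf (saturatedJacobianIdeal f)).mkQ.restrictScalars ℂ)

/-- `f = 0` is a nearly free curve: a reduced plane curve with `N(f) ≠ 0` and
`dim N(f)_k ≤ 1` for all `k`. -/
structure IsNearlyFree (f : S) : Prop where
  homogeneous : ∃ m, f.IsHomogeneous m
  reduced : Squarefree f
  nontrivial : Nontrivial (jacobianModule f)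
  piece_le_one : ∀ k, Module.rank ℂ (jacobianModulePiece f k) ≤ 1

/-- The equality `r² - r (m - 1) + (m - 1)² = τ + 1` for a curve `f = 0` of degree `m`, where
`r` is the minimal degree of a relation and `τ` the total Tjurina number. -/
def SatisfiesDimcaEquation (f : S) : Prop :=
  (mdr f : ℤ) ^ 2 - mdr f * ((f.totalDegree : ℤ) - 1) + ((f.totalDegree : ℤ) - 1) ^ 2
    = totalTjurina f + 1

/-! ### The explicit arrangements -/

/-- The conic `x² + y² - 16 z²`. -/
def conic16 : S := X 0 ^ 2 + X 1 ^ 2 - 16 * X 2 ^ 2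

def curve3 : S := conic16 * (X 1 - X 0 + 4 * X 2)

def curve4 : S := conic16 * (X 1 - X 0 - 4 * X 2) * (X 1 + X 0 - 4 * X 2)

def curve4' : S := conic16 * (X 1 - 4 * X 2) * (X 1 - X 0)

def curve5 : S :=
  conic16 * (X 1 - X 0 + 4 * X 2) * (X 1 + X 0 - 4 * X 2) * (X 1 - X 0 - 4 * X 2)

def curve6 : S :=
  conic16 * (X 1 - X 0 + 4 * X 2) * (X 1 + X 0 - 4 * X 2) * (X 1 - X 0 - 4 * X 2) *
    (X 1 + X 0 + 4 * X 2)

def curve7 : S :=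
  (X 0 ^ 2 + X 1 ^ 2 - X 2 ^ 2) * (X 0 ^ 2 - X 2 ^ 2) * (X 1 ^ 2 - X 2 ^ 2) * (X 1 + X 0)

end ConicLine

end

/-!
The curves are handled through the Hilbert–Burch theorem. Suppose that the signed maximal minors
of a `4 × 3` matrix are, up to a common constant, the partial derivatives of a reduced form `f`
and a further form `w`, and that the last row is `-(l₀, l₁, l₂ ^ (σ + 1))` for linearly
independent linear forms `l₀, l₁, l₂`. By Euler's identity the partial derivatives of `f` have no
common factor, so that every relation between the minors is a combination of the columns
(`exists_mulVec_eq_of_relation`), and the ideal of the minors is saturated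
(`mem_span_signedMinor_of_mul_mem`). The columns multiply `w` by `l₀`, `l₁` and `l₂ ^ (σ + 1)`
into the Jacobian ideal. Therefore the saturation of `J_f` is `J_f + ⟨w⟩`, and `N(f)` is spanned
by the nonzero class of `w` and its multiples by powers of `l₂`, which have different degrees: `f`
is nearly free (`JacobianPresentation.isNearlyFree`). The relations between the partial
derivatives are the combinations of columns in which `w` cancels, which yields the minimal degree
of a relation (`JacobianPresentation.mdr_eq`). For each of the six curves such a matrix is written
down.

A singular point of a product of smooth curves is a common point of two of them
(`exists_ne_of_isSingularPoint`). At such a point the type of the singularity follows from the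
branches, and the Tjurina number is `1`, `3` or `4` for a node, a tacnode or an ordinary triple
point. For nodes and ordinary triple points, Nakayama's lemma reduces this to computations with
jets of order at most three (`IsNodeGerm.finrank_tjurina`,
`IsOrdinaryTripleGerm.finrank_tjurina`); tacnodes are needed only for a circle and a tangent that
is parallel to a coordinate axis, where the Tjurina ideal is explicit
(`finrank_tjurina_line_mul_conic`). The weak combinatorics of a curve is then certified by the list
of its singular points (`CombinatoricsCertificate.hasWeakCombinatorics`).

In degree three the curve is a smooth conic with a line. If the line is a secant, there are two
nodes (`hasWeakCombinatorics_of_transversal`). If it is a tangent, then the Jacobian ideal is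
generated by the maximal minors of a `3 × 2` matrix, hence is saturated, so that `N(f) = 0` and
the curve is not nearly free (`saturatedJacobianIdeal_tangent_le`, `not_isNearlyFree_of_tangent`).
-/

noncomputable section

namespace ConicLine

/-! ### Maximal minors and the Hilbert–Burch lemma -/

section HilbertBurch

variable {R : Type*} [CommRing R] {n : ℕ}

/-- The signed maximal minors of an `(n + 1) × n` matrix. -/
def signedMinor (M : Matrix (Fin (n + 1)) (Fin n) R) (i : Fin (n + 1)) : R :=
  (-1) ^ (i : ℕ) * (M.submatrix i.succAbove id).det

/-- The square matrix with first column `v`, followed by the columns of `M`. -/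
def consColumn (v : Fin (n + 1) → R) (M : Matrix (Fin (n + 1)) (Fin n) R) :
    Matrix (Fin (n + 1)) (Fin (n + 1)) R :=
  Matrix.of fun i => Fin.cons (v i) (M i)

theorem consColumn_det (v : Fin (n + 1) → R) (M : Matrix (Fin (n + 1)) (Fin n) R) :
    (consColumn v M).det = ∑ i, v i * signedMinor M i := by
  rw [Matrix.det_succ_column_zero]
  refine Finset.sum_congr rfl fun i _ => ?_
  have : (consColumn v M).submatrix i.succAbove Fin.succ = M.submatrix i.succAbove id := by
    ext a b; simp [consColumn]
  rw [this]
  simp [consColumn, signedMinor]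
  ring

theorem consColumn_mulVec (v : Fin (n + 1) → R) (M : Matrix (Fin (n + 1)) (Fin n) R)
    (x : Fin (n + 1) → R) :
    (consColumn v M).mulVec x = x 0 • v + M.mulVec (Fin.tail x) := by
  ext i
  simp [Matrix.mulVec, dotProduct, Fin.sum_univ_succ, consColumn, Fin.tail, mul_comm]

theorem sum_mulVec_mul_signedMinor (M : Matrix (Fin (n + 1)) (Fin n) R) (c : Fin n → R) :
    ∑ i, M.mulVec c i * signedMinor M i = 0 := by
  have key : ∀ j, ∑ i, M i j * signedMinor M i = 0 := by
    intro j
    rw [← consColumn_det]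
    exact Matrix.det_zero_of_column_eq (i := 0) (j := j.succ) (Fin.succ_ne_zero j).symm
      (fun i => by simp [consColumn])
  calc ∑ i, M.mulVec c i * signedMinor M i
      = ∑ i, ∑ j, c j * (M i j * signedMinor M i) := by
        refine Finset.sum_congr rfl fun i _ => ?_
        simp only [Matrix.mulVec, dotProduct, Finset.sum_mul]
        exact Finset.sum_congr rfl fun j _ => by ring
    _ = ∑ j, c j * ∑ i, M i j * signedMinor M i := by
        rw [Finset.sum_comm]; simp only [Finset.mul_sum]
    _ = 0 := by simp [key]

/-- Cramer's rule: a maximal minor times the coordinates of `c` are combinations of the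
coordinates of `M c`. -/
theorem signedMinor_mul_mem {M : Matrix (Fin (n + 1)) (Fin n) R} {I : Ideal R} {c : Fin n → R}
    (h : ∀ i, M.mulVec c i ∈ I) (i : Fin (n + 1)) (j : Fin n) : signedMinor M i * c j ∈ I := by
  set N := M.submatrix i.succAbove id with hN
  have hNc : ∀ k, N.mulVec c k = M.mulVec c (i.succAbove k) := fun k => by
    simp [Matrix.mulVec, dotProduct, hN]
  have h1 : N.det * c j = (N.adjugate.mulVec (N.mulVec c)) j := by
    rw [Matrix.mulVec_mulVec, Matrix.adjugate_mul, Matrix.smul_mulVec, Matrix.one_mulVec]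
    simp
  have h2 : N.det * c j ∈ I := by
    rw [h1]
    simp only [Matrix.mulVec, dotProduct]
    refine I.sum_mem fun k _ => I.mul_mem_left _ ?_
    have := h (i.succAbove k)
    rw [← hNc] at this
    exact this
  rw [signedMinor, mul_assoc]
  exact I.mul_mem_left _ h2

/-- If the `g i` have no common prime factor, then `x` divides `y` as soon as it divides all the
`g i * y`. -/
theorem dvd_of_forall_dvd_mul {R ι : Type*} [CommRing R] [IsDomain R]
    [UniqueFactorizationMonoid R]
    {g : ι → R} (hg : ∀ p, Prime p → ∃ i, ¬ p ∣ g i) (x : R) (hx : x ≠ 0) :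
    ∀ y, (∀ i, x ∣ g i * y) → x ∣ y := by
  induction x using UniqueFactorizationMonoid.induction_on_prime with
  | h₁ => exact absurd rfl hx
  | h₂ x hu => exact fun y _ => hu.dvd
  | h₃ a p ha hp ih =>
    intro y hy
    obtain ⟨i, hi⟩ := hg p hp
    obtain ⟨y', rfl⟩ := (hp.dvd_or_dvd ((dvd_mul_right p a).trans (hy i))).resolve_left hi
    refine mul_dvd_mul_left p (ih ha y' fun i => ?_)
    have := hy i
    rw [mul_left_comm] at this
    exact (mul_dvd_mul_iff_left hp.ne_zero).1 this

/-- The Hilbert–Burch lemma: if the maximal minors of `M` have no common prime factor, then every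
relation between them is a combination of the columns of `M`. -/
theorem exists_mulVec_eq_of_relation [IsDomain R] [UniqueFactorizationMonoid R]
    {M : Matrix (Fin (n + 1)) (Fin n) R}
    (hM : ∀ p, Prime p → ∃ i, ¬ p ∣ signedMinor M i) (hM0 : ∃ i, signedMinor M i ≠ 0)
    {v : Fin (n + 1) → R} (hv : ∑ i, v i * signedMinor M i = 0) : ∃ c, M.mulVec c = v := by
  -- the relation makes the determinant of `M` with the extra column `v` vanish
  obtain ⟨x, hx0, hx⟩ := Matrix.exists_mulVec_eq_zero_iff.2 ((consColumn_det v M).trans hv)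
  rw [consColumn_mulVec] at hx
  have hxv : ∀ i, M.mulVec (Fin.tail x) i = -(x 0 * v i) := fun i => by
    have := congrFun hx i
    simp only [Pi.add_apply, Pi.smul_apply, smul_eq_mul, Pi.zero_apply] at this
    linear_combination this
  have hdvd : ∀ i j, x 0 ∣ signedMinor M i * Fin.tail x j := fun i j => by
    rw [← Ideal.mem_span_singleton]
    exact signedMinor_mul_mem (fun i => Ideal.mem_span_singleton.2
      ⟨-v i, by rw [hxv]; ring⟩) i j
  have h0 : x 0 ≠ 0 := by
    intro h0
    obtain ⟨i, hi⟩ := hM0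
    apply hx0
    funext k
    refine Fin.cases h0 (fun j => ?_) k
    have := hdvd i j
    rw [h0, zero_dvd_iff] at this
    exact (mul_eq_zero.1 this).resolve_left hi
  choose y hy using fun j => dvd_of_forall_dvd_mul hM (x 0) h0 (Fin.tail x j) fun i => hdvd i j
  refine ⟨-y, ?_⟩
  funext i
  have h1 : Fin.tail x = x 0 • y := funext fun j => by simp [hy j]
  have h2 := hxv i
  rw [h1, Matrix.mulVec_smul] at h2
  apply mul_left_cancel₀ h0
  simp only [Pi.smul_apply, smul_eq_mul] at h2
  rw [Matrix.mulVec_neg, Pi.neg_apply]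
  linear_combination -h2

/-- The ideal of the maximal minors of a Hilbert–Burch matrix is saturated with respect to a
regular sequence `a, b` that generates a prime ideal not containing all the minors. -/
theorem mem_span_signedMinor_of_mul_mem [IsDomain R] [UniqueFactorizationMonoid R]
    {M : Matrix (Fin (n + 1)) (Fin n) R} (hM : ∀ p, Prime p → ∃ i, ¬ p ∣ signedMinor M i)
    {a b : R} (ha : Prime a) (hab : ¬ a ∣ b) (hP : (Ideal.span {a, b}).IsPrime)
    (hMP : ∃ i, signedMinor M i ∉ Ideal.span {a, b}) {F : R}
    (haF : a * F ∈ Ideal.span (Set.range (signedMinor M)))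
    (hbF : b * F ∈ Ideal.span (Set.range (signedMinor M))) :
    F ∈ Ideal.span (Set.range (signedMinor M)) := by
  obtain ⟨i₀, hi₀⟩ := hMP
  obtain ⟨A, hA⟩ := Ideal.mem_span_range_iff_exists_fun.1 haF
  obtain ⟨B, hB⟩ := Ideal.mem_span_range_iff_exists_fun.1 hbF
  -- two expressions for `a b F` give a relation between the minors
  obtain ⟨c, hc⟩ := exists_mulVec_eq_of_relation (v := fun i => b * A i - a * B i) hM
    ⟨i₀, fun h => hi₀ (h ▸ Ideal.zero_mem _)⟩ (by
      simp only [sub_mul, mul_assoc, Finset.sum_sub_distrib, ← Finset.mul_sum, hA, hB]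
      ring)
  -- by Cramer's rule and primality the coefficients `c j` lie in `⟨a, b⟩`
  have hcP : ∀ j, c j ∈ Ideal.span {a, b} := fun j =>
    (hP.mem_or_mem (signedMinor_mul_mem (fun i => by
      rw [hc]
      exact Ideal.mem_span_pair.2 ⟨-B i, A i, by ring⟩) i₀ j)).resolve_left hi₀
  choose c₁ c₂ hcc using fun j => Ideal.mem_span_pair.1 (hcP j)
  have hceq : c = a • c₁ + b • c₂ := funext fun j => by
    simp [← hcc j, mul_comm]
  -- changing `A` by a combination of columns makes it divisible by `a`
  have hdvd : ∀ i, a ∣ A i - M.mulVec c₂ i := fun i => by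
    refine (ha.dvd_or_dvd (a := b) ⟨B i + M.mulVec c₁ i, ?_⟩).resolve_left hab
    have := congrFun hc i
    rw [hceq, Matrix.mulVec_add, Matrix.mulVec_smul, Matrix.mulVec_smul] at this
    simp only [Pi.add_apply, Pi.smul_apply, smul_eq_mul] at this
    linear_combination -this
  choose E hE using hdvd
  refine Ideal.mem_span_range_iff_exists_fun.2 ⟨E, mul_left_cancel₀ ha.ne_zero ?_⟩
  rw [← hA, Finset.mul_sum]
  have h3 := sum_mulVec_mul_signedMinor M c₂
  rw [← sub_zero (∑ i, A i * signedMinor M i), ← h3, ← Finset.sum_sub_distrib]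
  exact Finset.sum_congr rfl fun i _ => by linear_combination (-signedMinor M i) * hE i

end HilbertBurch

/-! ### Forms on lines through the origin -/

theorem aeval_smul_of_isHomogeneous {A : Type*} [CommRing A] [Algebra ℂ A] {F : S} {n : ℕ}
    (hF : F.IsHomogeneous n) (t : A) (g : Fin 3 → A) :
    aeval (fun i => t * g i) F = t ^ n * aeval g F := by
  rw [aeval_def, aeval_def, eval₂_eq, eval₂_eq, Finset.mul_sum]
  refine Finset.sum_congr rfl fun d hd => ?_
  have hdn : ∑ i ∈ d.support, d i = n := (hF.degree_eq_sum_deg_support hd).symm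
  rw [← hdn, ← Finset.prod_pow_eq_pow_sum]
  simp only [mul_pow, Finset.prod_mul_distrib]
  ring

theorem eval_smul_of_isHomogeneous {F : S} {n : ℕ} (hF : F.IsHomogeneous n) (t : ℂ)
    (v : Fin 3 → ℂ) : eval (t • v) F = t ^ n * eval v F := by
  have := aeval_smul_of_isHomogeneous hF t v
  rw [← aeval_eq_eval, ← aeval_eq_eval]
  exact this

/-- The restriction of polynomials to the line through the origin spanned by `v`, with coordinate
`t`. -/
def lineHom (v : Fin 3 → ℂ) : S →ₐ[ℂ] Polynomial ℂ :=
  aeval fun i => Polynomial.X * Polynomial.C (v i)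

theorem lineHom_of_isHomogeneous {F : S} {n : ℕ} (hF : F.IsHomogeneous n) (v : Fin 3 → ℂ) :
    lineHom v F = Polynomial.X ^ n * Polynomial.C (eval v F) := by
  rw [lineHom, aeval_smul_of_isHomogeneous hF]
  congr 1
  rw [← aeval_eq_eval]
  have h : (aeval (fun i => Polynomial.C (v i)) : S →ₐ[ℂ] Polynomial ℂ)
      = (Polynomial.CAlgHom (R := ℂ) (A := ℂ)).comp (aeval v) := by
    ext i; simp
  rw [h]; rfl

theorem lineHom_coeff_zero (v : Fin 3 → ℂ) (F : S) :
    (lineHom v F).coeff 0 = constantCoeff F := by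
  induction F using MvPolynomial.induction_on with
  | C a => simp [lineHom]
  | add p q hp hq => simp [hp, hq]
  | mul_X p i hp => simp [lineHom, Polynomial.mul_coeff_zero]

/-- If, modulo `I`, the coordinates are the multiples of `l` by the entries of `v`, then every `F`
is congruent modulo `I` to a polynomial in `l`, namely to its restriction to the line spanned
by `v`. -/
theorem sub_aeval_lineHom_mem {I : Ideal S} {l : S} {v : Fin 3 → ℂ}
    (h : ∀ i, X i - C (v i) * l ∈ I) (F : S) :
    F - Polynomial.aeval l (lineHom v F) ∈ I := by
  rw [← Ideal.Quotient.mk_eq_mk_iff_sub_mem]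
  have : (Ideal.Quotient.mkₐ ℂ I) = ((Ideal.Quotient.mkₐ ℂ I).comp
      ((Polynomial.aeval l).comp (lineHom v))) := by
    ext i
    simp only [Ideal.Quotient.mkₐ_eq_mk, AlgHom.coe_comp, Function.comp_apply, lineHom, aeval_X,
      map_mul, Polynomial.aeval_X, Polynomial.aeval_C]
    rw [← map_mul, Ideal.Quotient.mk_eq_mk_iff_sub_mem, mul_comm]
    exact h i
  exact DFunLike.congr_fun this F

/-- `l` is a system of three linear forms with dual basis `v`. -/
structure IsDualBasis (l : Fin 3 → S) (v : Fin 3 → Fin 3 → ℂ) : Prop where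
  homogeneous : ∀ i, (l i).IsHomogeneous 1
  eval_eq : ∀ i j, eval (v j) (l i) = if i = j then 1 else 0
  sum_eq : ∀ i, (X i : S) = ∑ j, C (v j i) * l j

theorem isDualBasis_X : IsDualBasis X fun j => Pi.single j 1 where
  homogeneous := isHomogeneous_X ℂ
  eval_eq i j := by simp [Pi.single_apply]
  sum_eq i := by
    rw [Finset.sum_eq_single i] <;> simp +contextual [eq_comm]

namespace IsDualBasis

variable {l : Fin 3 → S} {v : Fin 3 → Fin 3 → ℂ}

theorem X_sub_mem (h : IsDualBasis l v) (i : Fin 3) :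
    X i - C (v 2 i) * l 2 ∈ Ideal.span {l 0, l 1} := by
  rw [h.sum_eq i, Fin.sum_univ_three]
  exact Ideal.mem_span_pair.2 ⟨C (v 0 i), C (v 1 i), by ring⟩

theorem ne_zero (h : IsDualBasis l v) (i : Fin 3) : l i ≠ 0 := by
  intro h0
  have := h.eval_eq i i
  simp [h0] at this

theorem lineHom_eq_zero_of_mem (h : IsDualBasis l v) {F : S} (hF : F ∈ Ideal.span {l 0, l 1}) :
    lineHom (v 2) F = 0 := by
  obtain ⟨a, b, rfl⟩ := Ideal.mem_span_pair.1 hF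
  simp [lineHom_of_isHomogeneous (h.homogeneous _), h.eval_eq]

theorem mem_span_iff (h : IsDualBasis l v) {F : S} :
    F ∈ Ideal.span {l 0, l 1} ↔ lineHom (v 2) F = 0 := by
  refine ⟨h.lineHom_eq_zero_of_mem, fun hF => ?_⟩
  have := sub_aeval_lineHom_mem h.X_sub_mem F
  simpa [hF] using this

theorem isPrime_span (h : IsDualBasis l v) : (Ideal.span {l 0, l 1}).IsPrime := by
  have : Ideal.span {l 0, l 1} = RingHom.ker (lineHom (v 2)) := by
    ext F; rw [h.mem_span_iff, RingHom.mem_ker]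
  rw [this]
  exact RingHom.ker_isPrime _

end IsDualBasis

/-! ### Irreducibility and reducedness -/

theorem totalDegree_pderiv_lt {F : S} {i : Fin 3} (h : pderiv i F ≠ 0) :
    (pderiv i F).totalDegree < F.totalDegree := by
  have key : ∀ d ∈ (pderiv i F).support, (d.sum fun _ e => e) + 1 ≤ F.totalDegree := by
    intro d hd
    rw [mem_support_iff, coeff_pderiv] at hd
    have := le_totalDegree (mem_support_iff.2 (left_ne_zero_of_mul hd))
    rwa [Finsupp.sum_add_index' (fun _ => rfl) (fun _ _ _ => rfl), Finsupp.sum_single_index rfl]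
      at this
  obtain ⟨d, hd⟩ := Finset.nonempty_of_ne_empty (mt support_eq_empty.1 h)
  refine (Finset.sup_lt_iff ?_).2 fun d hd => Nat.lt_of_succ_le (key d hd)
  exact lt_of_lt_of_le (Nat.succ_pos _) (key d hd)

theorem exists_pderiv_ne_zero {F : S} (hF : ∀ c, F ≠ C c) : ∃ i, pderiv i F ≠ 0 := by
  by_contra! h
  refine hF (coeff 0 F) (MvPolynomial.ext _ _ fun d => ?_)
  rw [coeff_C]
  split_ifs with hd
  · rw [hd]
  · obtain ⟨i, hi⟩ : ∃ i, d i ≠ 0 := by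
      by_contra! h'
      exact hd (Finsupp.ext h').symm
    have h1 := congrArg (coeff (d - Finsupp.single i 1)) (h i)
    rw [coeff_pderiv, coeff_zero, tsub_add_cancel_of_le
      (Finsupp.single_le_iff.2 (Nat.one_le_iff_ne_zero.2 hi))] at h1
    exact (mul_eq_zero.1 h1).resolve_right (Nat.cast_add_one_ne_zero _)

/-- The partial derivatives of a squarefree form have no common factor: by Euler's identity such a
factor would divide the form, hence also one of its own partial derivatives. -/
theorem exists_not_dvd_pderiv {f : S} {m : ℕ} (hf : f.IsHomogeneous m) (hm : m ≠ 0)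
    (hsq : Squarefree f) {p : S} (hp : Prime p) : ∃ i, ¬ p ∣ pderiv i f := by
  by_contra! h
  have hpf : p ∣ f := by
    have h1 : p ∣ m • f := hf.sum_X_mul_pderiv ▸ Finset.dvd_sum fun i _ => (h i).mul_left _
    rw [nsmul_eq_mul] at h1
    refine (hp.dvd_or_dvd h1).resolve_left fun h2 => hp.not_isUnit (isUnit_of_dvd_unit h2 ?_)
    have : ((m : ℕ) : S) = C (m : ℂ) := by simp
    rw [this]
    exact (isUnit_iff_ne_zero.2 (Nat.cast_ne_zero.2 hm)).map C
  obtain ⟨g, rfl⟩ := hpf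
  obtain ⟨i, hi⟩ := exists_pderiv_ne_zero (F := p) (by
    rintro c rfl
    have hc : c ≠ 0 := by rintro rfl; exact hp.ne_zero (by simp)
    exact hp.not_isUnit ((isUnit_iff_ne_zero.2 hc).map C))
  have h1 : p ∣ g * pderiv i p := by
    have := h i
    rw [Derivation.leibniz, smul_eq_mul, smul_eq_mul] at this
    exact (dvd_add_right (dvd_mul_right _ _)).1 this
  rcases hp.dvd_or_dvd h1 with h2 | ⟨u, hu⟩
  · exact hp.not_isUnit (hsq p (mul_dvd_mul_left p h2))
  · have h3 := totalDegree_pderiv_lt hi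
    have hu0 : u ≠ 0 := by rintro rfl; exact hi (by simp [hu])
    rw [hu, totalDegree_mul_of_isDomain hp.ne_zero hu0] at h3
    omega

theorem irreducible_of_isLine {l : S} (hl : IsLine l) : Irreducible l := by
  refine irreducible_of_totalDegree_eq_one (hl.1.totalDegree hl.2) fun x hx => ?_
  obtain ⟨d, hd⟩ := exists_coeff_ne_zero hl.2
  refine isUnit_iff_ne_zero.2 ?_
  rintro rfl
  exact hd (zero_dvd_iff.1 (hx d))

theorem IsDualBasis.prime {l : Fin 3 → S} {v : Fin 3 → Fin 3 → ℂ} (h : IsDualBasis l v)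
    (i : Fin 3) : Prime (l i) :=
  (irreducible_of_isLine ⟨h.homogeneous i, h.ne_zero i⟩).prime

theorem IsDualBasis.not_dvd {l : Fin 3 → S} {v : Fin 3 → Fin 3 → ℂ} (h : IsDualBasis l v)
    {i j : Fin 3} (hij : i ≠ j) : ¬ l i ∣ l j := by
  rintro ⟨u, hu⟩
  have := congrArg (eval (v j)) hu
  simp [h.eval_eq, hij] at this

/-! ### The saturation of the Jacobian ideal -/

theorem mem_saturatedJacobianIdeal {f F : S} :
    F ∈ saturatedJacobianIdeal f ↔
      ∃ n : ℕ, ∀ G ∈ irrelevantIdeal ^ n, F * G ∈ jacobianIdeal f := by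
  unfold saturatedJacobianIdeal
  rw [Submodule.mem_iSup_of_directed]
  · simp only [Submodule.mem_colon, smul_eq_mul, SetLike.mem_coe]
  · refine Monotone.directed_le fun a b hab => ?_
    exact Submodule.colon_mono le_rfl (SetLike.coe_subset_coe.2 (Ideal.pow_le_pow_right hab))

theorem mem_irrelevantIdeal_of_isHomogeneous_one {l : S} (hl : l.IsHomogeneous 1) :
    l ∈ irrelevantIdeal := by
  have h := hl.sum_X_mul_pderiv
  rw [one_smul] at h
  rw [← h]
  exact Ideal.sum_mem _ fun i _ => Ideal.mul_mem_right _ _ (Ideal.subset_span ⟨i, rfl⟩)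

theorem saturatedJacobianIdeal_le {f : S} {K : Ideal S} (hJK : jacobianIdeal f ≤ K)
    (hK : ∀ F, (∀ G ∈ irrelevantIdeal, G * F ∈ K) → F ∈ K) : saturatedJacobianIdeal f ≤ K := by
  have key : ∀ (n : ℕ) (F : S), (∀ G ∈ irrelevantIdeal ^ n, F * G ∈ K) → F ∈ K := by
    intro n
    induction n with
    | zero => exact fun F h => by simpa using h 1 (by simp)
    | succ n ih =>
      refine fun F h => hK F fun G hG => ih _ fun H hH => ?_
      have := h (H * G) (by rw [pow_succ]; exact Ideal.mul_mem_mul hH hG)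
      convert this using 1
      ring
  intro F hF
  obtain ⟨n, hn⟩ := mem_saturatedJacobianIdeal.1 hF
  exact key n F fun G hG => hJK (hn G hG)

theorem isHomogeneous_jacobianIdeal {f : S} {m : ℕ} (hf : f.IsHomogeneous m) :
    letI := MvPolynomial.gradedAlgebra (σ := Fin 3) (R := ℂ)
    (jacobianIdeal f).IsHomogeneous (homogeneousSubmodule (Fin 3) ℂ) := by
  let _ := MvPolynomial.gradedAlgebra (σ := Fin 3) (R := ℂ)
  refine Ideal.homogeneous_span _ _ ?_
  rintro _ ⟨i, rfl⟩
  exact ⟨m - 1, hf.pderiv⟩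

theorem pderiv_mem_jacobianIdeal (f : S) (i : Fin 3) : pderiv i f ∈ jacobianIdeal f :=
  Ideal.subset_span ⟨i, rfl⟩

/-- A power of the irrelevant ideal kills `w` modulo `J` as soon as two linear forms and a power of
a third independent one do. -/
theorem exists_irrelevantIdeal_pow_mul_mem {J : Ideal S} {w : S} {l : Fin 3 → S}
    {v : Fin 3 → Fin 3 → ℂ} (hl : IsDualBasis l v) (s : ℕ) (h0 : l 0 * w ∈ J) (h1 : l 1 * w ∈ J)
    (h2 : l 2 ^ s * w ∈ J) : ∀ G ∈ irrelevantIdeal ^ s, w * G ∈ J := by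
  intro G hG
  have h3 : ∀ P ∈ Ideal.span {l 0, l 1}, w * P ∈ J := by
    intro P hP
    obtain ⟨a, b, rfl⟩ := Ideal.mem_span_pair.1 hP
    have := J.add_mem (J.mul_mem_left a h0) (J.mul_mem_left b h1)
    convert this using 1
    ring
  obtain ⟨H, hH, rfl⟩ := (Ideal.mem_span_pow_iff_exists_isHomogeneous (ι := Fin 3) X G).1 hG
  set G' := eval X H with hG'
  obtain ⟨q, hq⟩ : ∃ q : Polynomial ℂ, lineHom (v 2) G' = Polynomial.X ^ s * q := by
    have h4 : ∀ i, X i ∈ (Ideal.span {Polynomial.X} : Ideal (Polynomial ℂ)).comap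
        (lineHom (v 2)) := fun i => by
      rw [Ideal.mem_comap, lineHom, aeval_X]
      exact Ideal.mul_mem_right _ _ (Ideal.mem_span_singleton_self _)
    have h5 : irrelevantIdeal ≤ (Ideal.span {Polynomial.X} : Ideal (Polynomial ℂ)).comap
        (lineHom (v 2)) := Ideal.span_le.2 (by rintro _ ⟨i, rfl⟩; exact h4 i)
    have h6 := Ideal.le_comap_pow (lineHom (v 2)) s (Ideal.pow_right_mono h5 s hG)
    rw [Ideal.mem_comap, Ideal.span_singleton_pow, Ideal.mem_span_singleton] at h6
    exact h6
  have h7 := h3 _ (sub_aeval_lineHom_mem hl.X_sub_mem G')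
  rw [hq, map_mul, map_pow, Polynomial.aeval_X] at h7
  have h8 := J.add_mem h7 (J.mul_mem_left (Polynomial.aeval (l 2) q) h2)
  convert h8 using 1
  ring

/-! ### Curves with an explicit Hilbert–Burch matrix -/

/-- The `4 × 3` matrix with upper part `A` and last row `-u`. -/
def extendedMatrix (A : Matrix (Fin 3) (Fin 3) S) (u : Fin 3 → S) : Matrix (Fin 4) (Fin 3) S :=
  Matrix.of fun i j => Fin.snoc (α := fun _ => S) (fun i => A i j) (-u j) i

theorem extendedMatrix_castSucc (A : Matrix (Fin 3) (Fin 3) S) (u : Fin 3 → S) (i j : Fin 3) :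
    extendedMatrix A u i.castSucc j = A i j := by
  simp only [extendedMatrix, Matrix.of_apply, Fin.snoc_castSucc]

theorem extendedMatrix_last (A : Matrix (Fin 3) (Fin 3) S) (u : Fin 3 → S) (j : Fin 3) :
    extendedMatrix A u (Fin.last 3) j = -u j := by
  simp only [extendedMatrix, Matrix.of_apply, Fin.snoc_last]

theorem extendedMatrix_mulVec_castSucc (A : Matrix (Fin 3) (Fin 3) S) (u c : Fin 3 → S)
    (i : Fin 3) : (extendedMatrix A u).mulVec c i.castSucc = ∑ j, A i j * c j := by
  simp only [Matrix.mulVec, dotProduct, extendedMatrix_castSucc]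

theorem extendedMatrix_mulVec_last (A : Matrix (Fin 3) (Fin 3) S) (u c : Fin 3 → S) :
    (extendedMatrix A u).mulVec c (Fin.last 3) = -∑ j, u j * c j := by
  simp only [Matrix.mulVec, dotProduct, extendedMatrix_last, neg_mul, Finset.sum_neg_distrib]

/-- A presentation of the Jacobian module of a form `f` of degree `m`: a form `w` of degree `e`,
linear forms `l` with dual basis `v`, and a matrix `A` such that the signed maximal minors of the
matrix with rows `A 0, A 1, A 2, -(l 0, l 1, (l 2) ^ (σ + 1))` are proportional to
`f_x, f_y, f_z, w`. The columns of `A` have the degrees `r`, `r` and `r + σ`; the minors also encode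
that `l 0`, `l 1` and `(l 2) ^ (σ + 1)` multiply `w` into the Jacobian ideal. The last field says
that the point `(0 : 0 : 1)` is not singular, so that the partial derivatives do not all lie in
`⟨x, y⟩` and saturation can be tested with `x` and `y` alone. -/
structure JacobianPresentation (f w : S) (m e r σ : ℕ) (l : Fin 3 → S) (v : Fin 3 → Fin 3 → ℂ)
    (A : Matrix (Fin 3) (Fin 3) S) (κ : ℂ) : Prop where
  homogeneous : f.IsHomogeneous m
  degree_ne_zero : m ≠ 0
  squarefree : Squarefree f
  homogeneous_w : w.IsHomogeneous e
  dual : IsDualBasis l v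
  homogeneous_A : ∀ i j, (A i j).IsHomogeneous (![r, r, r + σ] j)
  ne_zero : κ ≠ 0
  minor : ∀ i : Fin 3,
    signedMinor (extendedMatrix A ![l 0, l 1, l 2 ^ (σ + 1)]) i.castSucc = C κ * pderiv i f
  minor_last : signedMinor (extendedMatrix A ![l 0, l 1, l 2 ^ (σ + 1)]) (Fin.last 3) = C κ * w
  regular : ∃ i, eval ![0, 0, 1] (pderiv i f) ≠ 0

namespace JacobianPresentation

variable {f w : S} {m e r σ : ℕ} {l : Fin 3 → S} {v : Fin 3 → Fin 3 → ℂ}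
  {A : Matrix (Fin 3) (Fin 3) S} {κ : ℂ}

/-- The Hilbert–Burch matrix of the presentation. -/
abbrev matrix (_ : JacobianPresentation f w m e r σ l v A κ) : Matrix (Fin 4) (Fin 3) S :=
  extendedMatrix A ![l 0, l 1, l 2 ^ (σ + 1)]

variable (h : JacobianPresentation f w m e r σ l v A κ)
include h

theorem isUnit_C : IsUnit (C κ : S) := (isUnit_iff_ne_zero.2 h.ne_zero).map C

theorem sum_mul_minor (g : Fin 4 → S) :
    ∑ i, g i * signedMinor h.matrix i =
      C κ * (∑ i : Fin 3, g i.castSucc * pderiv i f + g (Fin.last 3) * w) := by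
  have h1 : ∑ i, g i * signedMinor h.matrix i =
      ∑ i : Fin 3, g i.castSucc * signedMinor h.matrix i.castSucc +
        g (Fin.last 3) * signedMinor h.matrix (Fin.last 3) :=
    Fin.sum_univ_castSucc fun i => g i * signedMinor h.matrix i
  have h2 : ∀ i : Fin 3, g i.castSucc * signedMinor h.matrix i.castSucc =
      C κ * (g i.castSucc * pderiv i f) := fun i => by rw [h.minor]; ring
  rw [h1, h.minor_last, mul_add, Finset.mul_sum, Finset.sum_congr rfl fun i _ => h2 i]
  ring

/-- The columns of the Hilbert–Burch matrix express `l 0 * w`, `l 1 * w` and `l 2 ^ (σ + 1) * w`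
through the partial derivatives. -/
theorem relation (j : Fin 3) :
    ∑ i, A i j * pderiv i f = ![l 0, l 1, l 2 ^ (σ + 1)] j * w := by
  have h1 := sum_mulVec_mul_signedMinor h.matrix (Pi.single j 1)
  rw [Matrix.mulVec_single_one, h.sum_mul_minor] at h1
  simp only [Matrix.col_apply, extendedMatrix_castSucc, extendedMatrix_last] at h1
  have h2 := (mul_eq_zero.1 h1).resolve_left h.isUnit_C.ne_zero
  linear_combination h2

theorem mul_mem (j : Fin 3) : ![l 0, l 1, l 2 ^ (σ + 1)] j * w ∈ jacobianIdeal f := by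
  rw [← h.relation j]
  exact Ideal.sum_mem _ fun i _ => Ideal.mul_mem_left _ _ (pderiv_mem_jacobianIdeal f i)

theorem not_dvd_minor {p : S} (hp : Prime p) : ∃ i, ¬ p ∣ signedMinor h.matrix i := by
  obtain ⟨i, hi⟩ := exists_not_dvd_pderiv h.homogeneous h.degree_ne_zero h.squarefree hp
  exact ⟨i.castSucc, fun h1 => hi (by rwa [h.minor, h.isUnit_C.dvd_mul_left] at h1)⟩

theorem minor_ne_zero : ∃ i, signedMinor h.matrix i ≠ 0 := by
  obtain ⟨i, hi⟩ := h.regular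
  refine ⟨i.castSucc, ?_⟩
  rw [h.minor]
  exact mul_ne_zero h.isUnit_C.ne_zero fun h0 => hi (by simp [h0])

/-- Relations between `f_x, f_y, f_z, w` come from the columns of the Hilbert–Burch matrix. -/
theorem exists_of_relation {a : Fin 3 → S} {b : S} (hab : ∑ i, a i * pderiv i f + b * w = 0) :
    ∃ c : Fin 3 → S, (∀ i, a i = ∑ j, A i j * c j) ∧
      b = -(l 0 * c 0 + l 1 * c 1 + l 2 ^ (σ + 1) * c 2) := by
  obtain ⟨c, hc⟩ := exists_mulVec_eq_of_relation (M := h.matrix)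
    (v := Fin.snoc (α := fun _ => S) a b) (fun p hp => h.not_dvd_minor hp) h.minor_ne_zero (by
      rw [h.sum_mul_minor]
      simp only [Fin.snoc_castSucc, Fin.snoc_last, hab, mul_zero])
  refine ⟨c, fun i => ?_, ?_⟩
  · have := congrFun hc i.castSucc
    rw [Fin.snoc_castSucc, extendedMatrix_mulVec_castSucc] at this
    exact this.symm
  · have := congrFun hc (Fin.last 3)
    rw [Fin.snoc_last, extendedMatrix_mulVec_last, Fin.sum_univ_three] at this
    exact this.symm

theorem w_mem_saturated : w ∈ saturatedJacobianIdeal f :=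
  mem_saturatedJacobianIdeal.2 ⟨σ + 1, exists_irrelevantIdeal_pow_mul_mem h.dual (σ + 1)
    (h.mul_mem 0) (h.mul_mem 1) (h.mul_mem 2)⟩

/-- A relation expressing `w` through the partial derivatives would be a combination of columns
whose last row has the entry `-1`, but the last row of the matrix consists of forms of
positive degree. -/
theorem w_not_mem : w ∉ jacobianIdeal f := by
  intro hw
  obtain ⟨a, ha⟩ := Ideal.mem_span_range_iff_exists_fun.1 hw
  obtain ⟨c, -, hc⟩ := h.exists_of_relation (a := a) (b := -1) (by rw [ha]; ring)
  have h1 := congrArg constantCoeff hc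
  have h0 : ∀ i, constantCoeff (l i) = 0 := fun i =>
    (h.dual.homogeneous i).coeff_eq_zero (by simp)
  simp [h0] at h1

/-- The saturation of the Jacobian ideal is generated by the partial derivatives and `w`. -/
theorem saturated_le :
    saturatedJacobianIdeal f ≤ Ideal.span (Set.range (signedMinor h.matrix)) := by
  have hX := isDualBasis_X
  refine saturatedJacobianIdeal_le ?_ fun F hF => ?_
  · refine Ideal.span_le.2 ?_
    rintro _ ⟨i, rfl⟩
    have h1 : signedMinor h.matrix i.castSucc ∈
        Ideal.span (Set.range (signedMinor h.matrix)) := Ideal.subset_span ⟨_, rfl⟩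
    rw [h.minor] at h1
    exact (Ideal.unit_mul_mem_iff_mem _ h.isUnit_C).1 h1
  · refine mem_span_signedMinor_of_mul_mem (fun p hp => h.not_dvd_minor hp) (hX.prime 0)
      (hX.not_dvd (by decide : (0 : Fin 3) ≠ 1)) hX.isPrime_span ?_
      (hF _ (Ideal.subset_span ⟨0, rfl⟩)) (hF _ (Ideal.subset_span ⟨1, rfl⟩))
    obtain ⟨i, hi⟩ := h.regular
    refine ⟨i.castSucc, fun h1 => hi ?_⟩
    rw [h.minor, Ideal.unit_mul_mem_iff_mem _ h.isUnit_C] at h1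
    have h2 := hX.lineHom_eq_zero_of_mem h1
    rw [lineHom_of_isHomogeneous h.homogeneous.pderiv] at h2
    have h3 : (Pi.single 2 1 : Fin 3 → ℂ) = ![0, 0, 1] := by
      ext i; fin_cases i <;> simp
    rw [h3] at h2
    simpa using h2

/-- `N(f)` is generated by `w` over `ℂ[l 2]`, because `l 0` and `l 1` kill `w` modulo the Jacobian
ideal. -/
theorem exists_sub_mul_mem {F : S} (hF : F ∈ saturatedJacobianIdeal f) :
    ∃ p : Polynomial ℂ, F - Polynomial.aeval (l 2) p * w ∈ jacobianIdeal f := by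
  obtain ⟨b, hb⟩ := Ideal.mem_span_range_iff_exists_fun.1 (h.saturated_le hF)
  rw [h.sum_mul_minor] at hb
  set B := b (Fin.last 3) * C κ with hB
  refine ⟨lineHom (v 2) B, ?_⟩
  obtain ⟨p, q, hpq⟩ := Ideal.mem_span_pair.1 (sub_aeval_lineHom_mem h.dual.X_sub_mem B)
  have h1 : F - Polynomial.aeval (l 2) (lineHom (v 2) B) * w =
      ∑ i : Fin 3, b i.castSucc * C κ * pderiv i f + (p * (l 0 * w) + q * (l 1 * w)) := by
    have : ∑ i : Fin 3, b i.castSucc * C κ * pderiv i f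
        = C κ * ∑ i : Fin 3, b i.castSucc * pderiv i f := by
      rw [Finset.mul_sum]
      exact Finset.sum_congr rfl fun i _ => by ring
    rw [← hb, this]
    linear_combination (-w) * hpq + w * hB
  rw [h1]
  exact Ideal.add_mem _ (Ideal.sum_mem _ fun i _ =>
    Ideal.mul_mem_left _ _ (pderiv_mem_jacobianIdeal f i))
    (Ideal.add_mem _ (Ideal.mul_mem_left _ _ (h.mul_mem 0)) (Ideal.mul_mem_left _ _ (h.mul_mem 1)))

/-- Modulo the Jacobian ideal, a form in its saturation is a multiple of a power of `l 2`
times `w`. -/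
theorem exists_sub_C_mul_mem {F : S} {k : ℕ} (hF : F ∈ saturatedJacobianIdeal f)
    (hk : F.IsHomogeneous k) : ∃ c : ℂ, F - C c * (l 2 ^ (k - e) * w) ∈ jacobianIdeal f := by
  obtain ⟨p, hp⟩ := h.exists_sub_mul_mem hF
  let _ := MvPolynomial.gradedAlgebra (σ := Fin 3) (R := ℂ)
  have h1 := homogeneousComponent_mem_of_mem (isHomogeneous_jacobianIdeal h.homogeneous) hp k
  have hhom : ∀ n, (l 2 ^ n * w).IsHomogeneous (n + e) := fun n => by
    simpa using ((h.dual.homogeneous 2).pow n).mul h.homogeneous_w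
  have h2 : Polynomial.aeval (l 2) p * w = ∑ n ∈ p.support, C (p.coeff n) * (l 2 ^ n * w) := by
    rw [Polynomial.aeval_eq_sum_range, ← Polynomial.aeval_eq_sum_range, Polynomial.aeval_def,
      Polynomial.eval₂_eq_sum, Polynomial.sum, Finset.sum_mul]
    exact Finset.sum_congr rfl fun n _ => by rw [mul_assoc]; rfl
  rw [map_sub, homogeneousComponent_of_mem hk, if_pos rfl, h2, map_sum] at h1
  simp only [homogeneousComponent_C_mul, homogeneousComponent_of_mem (hhom _)] at h1
  by_cases hke : e ≤ k
  · refine ⟨p.coeff (k - e), ?_⟩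
    convert h1 using 2
    rw [Finset.sum_eq_single (k - e)]
    · rw [if_pos (by omega)]
    · intro n _ hn
      rw [if_neg (by omega), mul_zero]
    · intro hn
      rw [Polynomial.notMem_support_iff.1 hn]
      simp
  · refine ⟨0, ?_⟩
    rw [Finset.sum_eq_zero fun n _ => by rw [if_neg (by omega), mul_zero]] at h1
    simpa using h1

theorem isNearlyFree : IsNearlyFree f where
  homogeneous := ⟨m, h.homogeneous⟩
  reduced := h.squarefree
  nontrivial := by
    refine Submodule.Quotient.nontrivial_iff.2 fun htop => h.w_not_mem ?_
    have : (⟨w, h.w_mem_saturated⟩ : saturatedJacobianIdeal f) ∈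
        (jacobianIdeal f).submoduleOf (saturatedJacobianIdeal f) := htop ▸ Submodule.mem_top
    exact this
  piece_le_one k := by
    set v₀ : jacobianModule f := Submodule.Quotient.mk
      ⟨l 2 ^ (k - e) * w, Ideal.mul_mem_left _ _ h.w_mem_saturated⟩ with hv₀
    have hle : jacobianModulePiece f k ≤ Submodule.span ℂ {v₀} := by
      rintro _ ⟨⟨F, hF⟩, hFk, rfl⟩
      obtain ⟨c, hc⟩ := h.exists_sub_C_mul_mem hF hFk
      refine Submodule.mem_span_singleton.2 ⟨c, ?_⟩
      symm
      refine (Submodule.Quotient.eq _).2 ?_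
      rw [C_mul'] at hc
      exact hc
    exact (Submodule.rank_mono hle).trans (rank_span_le {v₀} |>.trans (by simp))

/-- The part of degree one, restricted to the line spanned by `u`, of a relation between `l 0`, `l
1` and `l 2 ^ (σ + 1)`. -/
theorem constantCoeff_eq_zero {c : Fin 3 → S}
    (hc : l 0 * c 0 + l 1 * c 1 + l 2 ^ (σ + 1) * c 2 = 0) (u : Fin 3 → ℂ) :
    eval u (l 0) * constantCoeff (c 0) + eval u (l 1) * constantCoeff (c 1) +
      eval u (l 2) * ((if σ = 0 then 1 else 0) * constantCoeff (c 2)) = 0 := by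
  have h1 := congrArg (lineHom u) hc
  simp only [map_add, map_mul, map_pow, map_zero,
    lineHom_of_isHomogeneous (h.dual.homogeneous _)] at h1
  have h2 := congrArg (fun p => Polynomial.coeff p 1) h1
  simp only [pow_one] at h2
  have h3 : ((Polynomial.X * Polynomial.C (eval u (l 2))) ^ (σ + 1) * lineHom u (c 2)).coeff 1 =
      eval u (l 2) * ((if σ = 0 then 1 else 0) * constantCoeff (c 2)) := by
    rw [← lineHom_coeff_zero u]
    split_ifs with hσ
    · subst hσ
      rw [zero_add, pow_one, mul_assoc, Polynomial.coeff_X_mul, Polynomial.coeff_C_mul, one_mul]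
    · obtain ⟨τ, rfl⟩ := Nat.exists_eq_succ_of_ne_zero hσ
      rw [pow_succ, pow_succ, mul_assoc, mul_assoc, mul_assoc, mul_left_comm, mul_assoc,
        Polynomial.coeff_X_mul, Polynomial.mul_coeff_zero]
      simp
  rw [Polynomial.coeff_add, Polynomial.coeff_add, h3, mul_assoc, mul_assoc, Polynomial.coeff_X_mul,
    Polynomial.coeff_X_mul, Polynomial.coeff_C_mul, Polynomial.coeff_C_mul, lineHom_coeff_zero,
    lineHom_coeff_zero] at h2
  simpa using h2

/-- A relation between the partial derivatives is `∑ j, c j • A j` over the columns of `A`, where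
`c` is a relation between `l 0`, `l 1` and `l 2 ^ (σ + 1)`. Such a `c` has no constant terms,
except possibly at the last column when that column has a degree above `r`. So the relation
has degree at least `r + 1`. -/
theorem eq_zero_of_relation {a : Fin 3 → S} {k : ℕ} (ha : ∀ i, (a i).IsHomogeneous k)
    (hrel : ∑ i, a i * pderiv i f = 0) (hk : k < r + 1) : a = 0 := by
  obtain ⟨c, hac, hc⟩ := h.exists_of_relation (a := a) (b := 0) (by rw [hrel]; ring)
  have hc' := neg_eq_zero.1 hc.symm
  have h0 : constantCoeff (c 0) = 0 := by
    simpa [h.dual.eval_eq] using h.constantCoeff_eq_zero hc' (v 0)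
  have h1 : constantCoeff (c 1) = 0 := by
    simpa [h.dual.eval_eq] using h.constantCoeff_eq_zero hc' (v 1)
  have h2 : σ = 0 → constantCoeff (c 2) = 0 := by
    intro hσ
    simpa [h.dual.eval_eq, hσ] using h.constantCoeff_eq_zero hc' (v 2)
  have hX : ∀ u j, constantCoeff (c j) = 0 → Polynomial.X ∣ lineHom u (c j) := fun u j hj => by
    rw [Polynomial.X_dvd_iff, lineHom_coeff_zero, hj]
  funext i
  refine MvPolynomial.funext fun u => ?_
  have h3 : Polynomial.X ^ (r + 1) ∣ lineHom u (a i) := by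
    rw [hac i, map_sum, Fin.sum_univ_three]
    simp only [map_mul, lineHom_of_isHomogeneous (h.homogeneous_A _ _)]
    refine dvd_add (dvd_add ?_ ?_) ?_
    · rw [pow_succ]
      exact mul_dvd_mul (dvd_mul_right _ _) (hX u 0 h0)
    · rw [pow_succ]
      exact mul_dvd_mul (dvd_mul_right _ _) (hX u 1 h1)
    · by_cases hσ : σ = 0
      · rw [pow_succ]
        refine mul_dvd_mul (Dvd.dvd.mul_right (pow_dvd_pow _ ?_) _) (hX u 2 (h2 hσ))
        simp
      · refine Dvd.dvd.mul_right (Dvd.dvd.mul_right (pow_dvd_pow _ ?_) _) _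
        simp
        omega
  rw [lineHom_of_isHomogeneous (ha i), Polynomial.X_pow_dvd_iff] at h3
  have h4 := h3 k hk
  rw [mul_comm, Polynomial.coeff_C_mul, Polynomial.coeff_X_pow, if_pos rfl, mul_one] at h4
  simpa using h4

/-- The Koszul relation between `l 0` and `l 1` combines the first two columns to a relation of
degree `r + 1`. -/
theorem mdr_eq : mdr f = r + 1 := by
  have hmem : r + 1 ∈ {r | ∃ a : Fin 3 → S, (∀ i, (a i).IsHomogeneous r) ∧ a ≠ 0 ∧
      ∑ i, a i * pderiv i f = 0} := by
    refine ⟨fun i => A i 0 * l 1 - A i 1 * l 0, fun i => ?_, fun h0 => ?_, ?_⟩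
    · exact ((h.homogeneous_A i 0).mul (h.dual.homogeneous 1)).sub
        ((h.homogeneous_A i 1).mul (h.dual.homogeneous 0))
    · obtain ⟨i, hi⟩ := h.minor_ne_zero
      have h1 : ∀ i, h.matrix.mulVec ![l 1, -l 0, 0] i ∈ (⊥ : Ideal S) := by
        intro i
        rw [Ideal.mem_bot]
        refine Fin.lastCases ?_ (fun i => ?_) i
        · rw [extendedMatrix_mulVec_last]
          simp [Fin.sum_univ_three]
          ring
        · rw [extendedMatrix_mulVec_castSucc]
          have := congrFun h0 i
          simp only [Pi.zero_apply] at this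
          simp [Fin.sum_univ_three]
          linear_combination this
      have h2 := signedMinor_mul_mem h1 i 0
      rw [Ideal.mem_bot] at h2
      exact (mul_ne_zero hi (h.dual.ne_zero 1)) h2
    · have h1 := h.relation 0
      have h2 := h.relation 1
      simp only [Fin.sum_univ_three, Matrix.cons_val_zero, Matrix.cons_val_one] at h1 h2 ⊢
      linear_combination l 1 * h1 - l 0 * h2
  refine le_antisymm (Nat.sInf_le hmem) (le_csInf ⟨_, hmem⟩ ?_)
  rintro k ⟨a, ha, ha0, hrel⟩
  by_contra! hk
  exact ha0 (h.eq_zero_of_relation ha hrel hk)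

end JacobianPresentation

section LocalTheory

open MvPowerSeries (constantCoeff)

/-! ### Jets of power series in two variables -/

/-- The partial derivatives of power series in two variables. -/
abbrev der (i : Fin 2) : Derivation ℂ Germ Germ := MvPowerSeries.pderiv ℂ i

/-- The coordinates of the plane, as power series. -/
abbrev coord (i : Fin 2) : Germ := MvPowerSeries.X i

/-- The Hessian matrix of a power series at the origin. -/
def hessian (g : Germ) (i j : Fin 2) : ℂ := constantCoeff (der i (der j g))

theorem linearPart_eq (g : Germ) (i : Fin 2) : linearPart g i = constantCoeff (der i g) := by
  rw [← MvPowerSeries.coeff_zero_eq_constantCoeff_apply, MvPowerSeries.coeff_pderiv]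
  simp [linearPart]

@[simp] theorem constantCoeff_coord (i : Fin 2) : constantCoeff (coord i) = 0 :=
  MvPowerSeries.constantCoeff_X i

@[simp] theorem der_coord (i j : Fin 2) : der i (coord j) = if i = j then 1 else 0 := by
  rw [MvPowerSeries.pderiv_X, Pi.single_apply]
  simp only [eq_comm]

@[simp] theorem der_C (i : Fin 2) (c : ℂ) : der i (MvPowerSeries.C c) = 0 :=
  MvPowerSeries.pderiv_C

theorem der_mul (i : Fin 2) (a b : Germ) : der i (a * b) = a * der i b + b * der i a :=
  (der i).leibniz a b

theorem der_comm (g : Germ) (i j : Fin 2) : der i (der j g) = der j (der i g) := by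
  ext n
  simp only [MvPowerSeries.coeff_pderiv]
  rw [add_right_comm]
  by_cases h : i = j
  · subst h; rfl
  · simp [h, Ne.symm h]
    ring

theorem hessian_comm (g : Germ) (i j : Fin 2) : hessian g i j = hessian g j i := by
  rw [hessian, hessian, der_comm]

theorem linearPart_mul (a b : Germ) (i : Fin 2) : linearPart (a * b) i =
    constantCoeff a * linearPart b i + constantCoeff b * linearPart a i := by
  simp [linearPart_eq]

theorem hessian_mul (a b : Germ) (i j : Fin 2) : hessian (a * b) i j =
    constantCoeff a * hessian b i j + constantCoeff b * hessian a i j +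
      linearPart a i * linearPart b j + linearPart a j * linearPart b i := by
  simp only [hessian, linearPart_eq, der_mul, map_add, map_mul]
  ring

theorem linearPart_add (a b : Germ) (i : Fin 2) :
    linearPart (a + b) i = linearPart a i + linearPart b i := by
  simp [linearPart_eq]

theorem linearPart_sub (a b : Germ) (i : Fin 2) :
    linearPart (a - b) i = linearPart a i - linearPart b i := by
  simp [linearPart_eq]

theorem hessian_add (a b : Germ) (i j : Fin 2) :
    hessian (a + b) i j = hessian a i j + hessian b i j := by
  simp [hessian]

theorem hessian_sub (a b : Germ) (i j : Fin 2) :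
    hessian (a - b) i j = hessian a i j - hessian b i j := by
  simp [hessian]

@[simp] theorem linearPart_coord (i j : Fin 2) :
    linearPart (coord i) j = if j = i then 1 else 0 := by
  rw [linearPart_eq, der_coord]
  split_ifs <;> simp

@[simp] theorem hessian_coord (i j k : Fin 2) : hessian (coord i) j k = 0 := by
  rw [hessian, der_coord]
  split_ifs <;> simp

@[simp] theorem linearPart_C (c : ℂ) (j : Fin 2) : linearPart (MvPowerSeries.C c) j = 0 := by
  rw [linearPart_eq, der_C, map_zero]

@[simp] theorem hessian_C (c : ℂ) (j k : Fin 2) : hessian (MvPowerSeries.C c) j k = 0 := by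
  rw [hessian, der_C, map_zero, map_zero]

/-- The maximal ideal of `ℂ[[u, v]]`. -/
def germIdeal : Ideal Germ := Ideal.span {coord 0, coord 1}

theorem coord_mem (i : Fin 2) : coord i ∈ germIdeal := by
  fin_cases i
  · exact Ideal.subset_span (by simp)
  · exact Ideal.subset_span (by simp)

theorem mem_germIdeal {f : Germ} : f ∈ germIdeal ↔ constantCoeff f = 0 := by
  constructor
  · intro hf
    obtain ⟨a, b, rfl⟩ := Ideal.mem_span_pair.1 hf
    simp
  · intro hf
    classical
    -- the terms of `f` without the first coordinate
    set f₁ : Germ := fun n => if n 0 = 0 then MvPowerSeries.coeff n f else 0 with hf₁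
    have hc : ∀ n, MvPowerSeries.coeff n f₁ = if n 0 = 0 then MvPowerSeries.coeff n f else 0 :=
      fun n => rfl
    have h0 : coord 0 ∣ f - f₁ := by
      rw [MvPowerSeries.X_dvd_iff]
      intro n hn
      rw [map_sub, hc, if_pos hn, sub_self]
    have h1 : coord 1 ∣ f₁ := by
      rw [MvPowerSeries.X_dvd_iff]
      intro n hn
      rw [hc]
      split_ifs with hn0
      · have : n = 0 := by
          ext i; fin_cases i
          · exact hn0
          · exact hn
        rw [this]
        simpa using hf
      · rfl
    obtain ⟨a, ha⟩ := h0
    obtain ⟨b, hb⟩ := h1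
    exact Ideal.mem_span_pair.2 ⟨a, b, by linear_combination -ha - hb⟩

theorem exists_of_constantCoeff_eq_zero {f : Germ} (hf : constantCoeff f = 0) :
    ∃ a b : Germ, f = coord 0 * a + coord 1 * b := by
  obtain ⟨a, b, h⟩ := Ideal.mem_span_pair.1 (mem_germIdeal.2 hf)
  exact ⟨a, b, by rw [← h]; ring⟩

theorem mem_germIdeal_sq {f : Germ} (h0 : constantCoeff f = 0) (h1 : ∀ i, linearPart f i = 0) :
    f ∈ germIdeal ^ 2 := by
  obtain ⟨a, b, rfl⟩ := exists_of_constantCoeff_eq_zero h0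
  have ha := h1 0
  have hb := h1 1
  simp [linearPart_add, linearPart_mul] at ha hb
  rw [pow_two]
  exact Ideal.add_mem _ (Ideal.mul_mem_mul (coord_mem 0) (mem_germIdeal.2 ha))
    (Ideal.mul_mem_mul (coord_mem 1) (mem_germIdeal.2 hb))

theorem mem_germIdeal_cube {f : Germ} (h0 : constantCoeff f = 0) (h1 : ∀ i, linearPart f i = 0)
    (h2 : ∀ i j, hessian f i j = 0) : f ∈ germIdeal ^ 3 := by
  obtain ⟨a, b, rfl⟩ := exists_of_constantCoeff_eq_zero h0
  have ha := h1 0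
  have hb := h1 1
  simp [linearPart_add, linearPart_mul] at ha hb
  have h00 := h2 0 0
  have h01 := h2 0 1
  have h11 := h2 1 1
  simp only [hessian_add, hessian_mul, constantCoeff_coord, hessian_coord, linearPart_coord,
    zero_mul, mul_zero, add_zero, zero_add, if_true, one_mul, Fin.isValue, one_ne_zero, if_false,
    zero_ne_one] at h00 h01 h11
  set α := MvPowerSeries.C (σ := Fin 2) (linearPart a 1) with hα
  have hA : a - α * coord 1 ∈ germIdeal ^ 2 := by
    refine mem_germIdeal_sq (by simp [ha]) fun i => ?_
    fin_cases i
    · simp [linearPart_sub, linearPart_mul]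
      linear_combination h00 / 2
    · simp [linearPart_sub, linearPart_mul, hα]
  have hB : b + α * coord 0 ∈ germIdeal ^ 2 := by
    refine mem_germIdeal_sq (by simp [hb]) fun i => ?_
    fin_cases i
    · simp [linearPart_add, linearPart_mul, hα]
      linear_combination h01
    · simp [linearPart_add, linearPart_mul]
      linear_combination h11 / 2
  have : coord 0 * a + coord 1 * b =
      coord 0 * (a - α * coord 1) + coord 1 * (b + α * coord 0) := by ring
  rw [this, pow_succ']
  exact Ideal.add_mem _ (Ideal.mul_mem_mul (coord_mem 0) hA) (Ideal.mul_mem_mul (coord_mem 1) hB)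

theorem sub_linear_mem {f : Germ} (h0 : constantCoeff f = 0) :
    f - (MvPowerSeries.C (linearPart f 0) * coord 0 + MvPowerSeries.C (linearPart f 1) * coord 1) ∈
      germIdeal ^ 2 := by
  refine mem_germIdeal_sq (by simp [h0]) fun i => ?_
  fin_cases i <;> simp [linearPart_sub, linearPart_add, linearPart_mul]

theorem sub_quadratic_mem {f : Germ} (h0 : constantCoeff f = 0) (h1 : ∀ i, linearPart f i = 0) :
    f - (MvPowerSeries.C (hessian f 0 0 / 2) * coord 0 ^ 2 +
      MvPowerSeries.C (hessian f 0 1) * (coord 0 * coord 1) +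
      MvPowerSeries.C (hessian f 1 1 / 2) * coord 1 ^ 2) ∈ germIdeal ^ 3 := by
  have hc := hessian_comm f 1 0
  refine mem_germIdeal_cube (by simp [h0]) (fun i => ?_) fun i j => ?_
  · simp [linearPart_sub, linearPart_add, linearPart_mul, h1, pow_two]
  · fin_cases i <;> fin_cases j <;>
    simp [hessian_sub, hessian_add, hessian_mul, linearPart_mul, pow_two, hc] <;> ring

theorem germIdeal_pow_three_le {I : Ideal Germ} {i j : Fin 2} (hij : i ≠ j)
    (h0 : coord i ^ 3 ∈ I) (h1 : coord i ^ 2 * coord j ∈ I) (h2 : coord i * coord j ^ 2 ∈ I)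
    (h3 : coord j ^ 3 ∈ I) : germIdeal ^ 3 ≤ I := by
  have hspan : germIdeal = Ideal.span {coord i, coord j} := by
    fin_cases i <;> fin_cases j
    · exact absurd rfl hij
    · rfl
    · exact congrArg Ideal.span (Set.pair_comm _ _)
    · exact absurd rfl hij
  rw [pow_succ, pow_two, hspan, Ideal.span_pair_mul_span_pair, Ideal.span_mul_span', Ideal.span_le]
  rintro _ ⟨x, hx, y, hy, rfl⟩
  simp only [Set.mem_insert_iff, Set.mem_singleton_iff] at hx hy
  simp only [SetLike.mem_coe]
  rcases hx with rfl | rfl | rfl | rfl <;> rcases hy with rfl | rfl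
  · convert h0 using 1; ring
  · convert h1 using 1; ring
  · convert h1 using 1; ring
  · convert h2 using 1; ring
  · convert h1 using 1; ring
  · convert h2 using 1; ring
  · convert h2 using 1; ring
  · convert h3 using 1; ring

theorem germIdeal_fg : germIdeal.FG := by
  classical
  exact ⟨{coord 0, coord 1}, by simp [germIdeal]⟩

theorem germIdeal_le_jacobson : germIdeal ≤ Ideal.jacobson ⊥ := by
  rw [IsLocalRing.jacobson_eq_maximalIdeal ⊥ bot_ne_top]
  intro f hf
  rw [IsLocalRing.mem_maximalIdeal, mem_nonunits_iff, MvPowerSeries.isUnit_iff_constantCoeff,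
    mem_germIdeal.1 hf]
  simp

/-- Nakayama's lemma for the ideal `𝔪 ^ k`. -/
theorem germIdeal_pow_le {I : Ideal Germ} {k : ℕ} (h : germIdeal ^ k ≤ I ⊔ germIdeal ^ (k + 1)) :
    germIdeal ^ k ≤ I :=
  Submodule.le_of_le_smul_of_le_jacobson_bot (germIdeal_fg.pow) germIdeal_le_jacobson
    (by rwa [smul_eq_mul, ← pow_succ'])

/-- Two power series with independent linear parts generate the maximal ideal. -/
theorem germIdeal_le_of_linearPart {I : Ideal Germ} {a b : Germ} (ha : a ∈ I) (hb : b ∈ I)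
    (ha0 : constantCoeff a = 0) (hb0 : constantCoeff b = 0)
    (hab : linearPart a 0 * linearPart b 1 - linearPart a 1 * linearPart b 0 ≠ 0) :
    germIdeal ≤ I := by
  have key : germIdeal ^ 1 ≤ I ⊔ germIdeal ^ 2 := by
    have ha1 := sub_linear_mem ha0
    have hb1 := sub_linear_mem hb0
    set D := linearPart a 0 * linearPart b 1 - linearPart a 1 * linearPart b 0 with hD
    have hunit : IsUnit (MvPowerSeries.C (σ := Fin 2) D) :=
      (isUnit_iff_ne_zero.2 hab).map MvPowerSeries.C
    rw [pow_one]
    refine Ideal.span_le.2 ?_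
    rintro x (rfl | rfl)
    · rw [SetLike.mem_coe, ← Ideal.unit_mul_mem_iff_mem _ hunit]
      have h1 := Submodule.add_mem_sup
        (I.sub_mem (I.mul_mem_left (MvPowerSeries.C (linearPart b 1)) ha)
          (I.mul_mem_left (MvPowerSeries.C (linearPart a 1)) hb))
        (Ideal.sub_mem _ (Ideal.mul_mem_left _ (MvPowerSeries.C (linearPart a 1)) hb1)
          (Ideal.mul_mem_left _ (MvPowerSeries.C (linearPart b 1)) ha1))
      convert h1 using 1
      rw [hD, map_sub, map_mul, map_mul]
      ring
    · rw [SetLike.mem_coe, ← Ideal.unit_mul_mem_iff_mem _ hunit]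
      have h1 := Submodule.add_mem_sup
        (I.sub_mem (I.mul_mem_left (MvPowerSeries.C (linearPart a 0)) hb)
          (I.mul_mem_left (MvPowerSeries.C (linearPart b 0)) ha))
        (Ideal.sub_mem _ (Ideal.mul_mem_left _ (MvPowerSeries.C (linearPart b 0)) ha1)
          (Ideal.mul_mem_left _ (MvPowerSeries.C (linearPart a 0)) hb1))
      convert h1 using 1
      rw [hD, map_sub, map_mul, map_mul]
      ring
  simpa using germIdeal_pow_le key

/-- The dimension of `ℂ[[u, v]] ⧸ I`, when `I` is cut out by finitely many independent linear
conditions. -/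
theorem finrank_quotient_eq {n : ℕ} {I : Ideal Germ} (φ : Germ →ₗ[ℂ] (Fin n → ℂ))
    (hφ : Function.Surjective φ) (hI : ∀ f, f ∈ I ↔ φ f = 0) :
    Module.finrank ℂ (Germ ⧸ I) = n := by
  have hker : LinearMap.ker φ = I.restrictScalars ℂ := by
    ext f; rw [LinearMap.mem_ker, Submodule.restrictScalars_mem, hI]
  have e1 := φ.quotKerEquivOfSurjective hφ
  rw [hker] at e1
  have e2 : (Germ ⧸ I) ≃ₗ[ℂ] (Germ ⧸ I.restrictScalars ℂ) :=
    (Submodule.Quotient.restrictScalarsEquiv ℂ I).symm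
  rw [(e2.trans e1).finrank_eq]
  simp

/-! ### Tjurina numbers of plane curve germs -/

/-- The Tjurina ideal `⟨g, ∂g/∂u, ∂g/∂v⟩`. -/
def tjurinaIdeal (g : Germ) : Ideal Germ := Ideal.span {g, der 0 g, der 1 g}

theorem self_mem_tjurinaIdeal (g : Germ) : g ∈ tjurinaIdeal g := Ideal.subset_span (by simp)

theorem der_mem_tjurinaIdeal (g : Germ) (i : Fin 2) : der i g ∈ tjurinaIdeal g := by
  fin_cases i
  · exact Ideal.subset_span (by simp)
  · exact Ideal.subset_span (by simp)

theorem tjurinaIdeal_le {g : Germ} {I : Ideal Germ} (h : g ∈ I) (hd : ∀ i, der i g ∈ I) :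
    tjurinaIdeal g ≤ I := by
  refine Ideal.span_le.2 ?_
  rintro x (rfl | rfl | rfl)
  · exact h
  · exact hd 0
  · exact hd 1

theorem exists_of_mem_tjurinaIdeal {g f : Germ} (h : f ∈ tjurinaIdeal g) :
    ∃ a b c : Germ, f = a * g + b * der 0 g + c * der 1 g := by
  obtain ⟨a, b, c, h⟩ := Submodule.mem_span_triple.1 h
  exact ⟨a, b, c, h.symm⟩

theorem tjurinaIdeal_mul_le (g U : Germ) : tjurinaIdeal (g * U) ≤ tjurinaIdeal g := by
  refine tjurinaIdeal_le (Ideal.mul_mem_right _ _ (self_mem_tjurinaIdeal g)) fun i => ?_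
  rw [der_mul]
  exact Ideal.add_mem _ (Ideal.mul_mem_right _ _ (self_mem_tjurinaIdeal g))
    (Ideal.mul_mem_left _ _ (der_mem_tjurinaIdeal g i))

theorem tjurinaIdeal_mul_unit (g : Germ) {U : Germ} (hU : IsUnit U) :
    tjurinaIdeal (g * U) = tjurinaIdeal g := by
  refine le_antisymm (tjurinaIdeal_mul_le g U) ?_
  obtain ⟨u, rfl⟩ := hU
  have := tjurinaIdeal_mul_le (g * u) (↑u⁻¹ : Germ)
  rwa [mul_assoc, Units.mul_inv, mul_one] at this

theorem linearPart_smul (c : ℂ) (f : Germ) (i : Fin 2) :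
    linearPart (c • f) i = c * linearPart f i := by
  simp [linearPart_eq]

theorem hessian_smul (c : ℂ) (f : Germ) (i j : Fin 2) :
    hessian (c • f) i j = c * hessian f i j := by
  simp [hessian]

theorem linearPart_der (g : Germ) (i j : Fin 2) : linearPart (der i g) j = hessian g j i := by
  rw [linearPart_eq, hessian]

/-- A germ of multiplicity two with nondegenerate Hessian has Tjurina number one. -/
theorem finrank_tjurina_of_hessian_det {g : Germ} (h0 : constantCoeff g = 0)
    (h1 : ∀ i, linearPart g i = 0)
    (h2 : hessian g 0 0 * hessian g 1 1 - hessian g 0 1 * hessian g 0 1 ≠ 0) :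
    Module.finrank ℂ (Germ ⧸ tjurinaIdeal g) = 1 := by
  have hd : ∀ i, constantCoeff (der i g) = 0 := fun i => by rw [← linearPart_eq, h1]
  have hle : germIdeal ≤ tjurinaIdeal g := by
    refine germIdeal_le_of_linearPart (der_mem_tjurinaIdeal g 0) (der_mem_tjurinaIdeal g 1)
      (hd 0) (hd 1) ?_
    simp only [linearPart_der]
    rwa [hessian_comm g 1 0]
  have heq : tjurinaIdeal g = germIdeal := le_antisymm
    (tjurinaIdeal_le (mem_germIdeal.2 h0) fun i => mem_germIdeal.2 (hd i)) hle
  refine finrank_quotient_eq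
    { toFun := fun f => ![constantCoeff f]
      map_add' := fun f f' => by ext i; fin_cases i; exact map_add _ f f'
      map_smul' := fun c f => by ext i; fin_cases i; simp }
    (fun y => ⟨MvPowerSeries.C (y 0), ?_⟩) fun f => ?_
  · ext i; fin_cases i
    exact MvPowerSeries.constantCoeff_C (σ := Fin 2) (y 0)
  · rw [heq, mem_germIdeal]
    simp

/-- If the leading forms of `P` and `Q` are quadratic forms whose resultant (the discriminant in
the hypothesis) does not vanish, then an ideal containing `P` and `Q` contains all monomials of
degree three: their multiples by the coefficients of the adjugate of the Sylvester matrix are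
combinations of `u P`, `v P`, `u Q`, `v Q`, up to terms of higher order. -/
theorem germIdeal_cube_le_of_discriminant {I : Ideal Germ} {P Q : Germ} (hPI : P ∈ I) (hQI : Q ∈ I)
    (hP0 : constantCoeff P = 0) (hQ0 : constantCoeff Q = 0) (hP1 : ∀ i, linearPart P i = 0)
    (hQ1 : ∀ i, linearPart Q i = 0) {t0 t1 t2 t3 : ℂ}
    (hp0 : hessian P 0 0 = t0) (hp1 : hessian P 0 1 = t1) (hp2 : hessian P 1 1 = t2)
    (hq0 : hessian Q 0 0 = t1) (hq1 : hessian Q 0 1 = t2) (hq2 : hessian Q 1 1 = t3)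
    (hD : (t0 * t3 - t1 * t2) ^ 2 - 4 * (t0 * t2 - t1 ^ 2) * (t1 * t3 - t2 ^ 2) ≠ 0) :
    germIdeal ^ 3 ≤ I := by
  have hP := sub_quadratic_mem hP0 hP1
  have hQ := sub_quadratic_mem hQ0 hQ1
  rw [hp0, hp1, hp2] at hP
  rw [hq0, hq1, hq2] at hQ
  have double : ∀ x : ℂ, 2 * MvPowerSeries.C (σ := Fin 2) (x / 2) = MvPowerSeries.C x := by
    intro x
    rw [two_mul, ← map_add]; congr 1; ring
  have hunit := (isUnit_iff_ne_zero.2 hD).map (MvPowerSeries.C (σ := Fin 2) (R := ℂ))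
  have hfour : MvPowerSeries.C (σ := Fin 2) (4 : ℂ) = 4 := map_ofNat _ 4
  simp only [map_sub, map_mul, map_pow, hfour] at hunit
  obtain ⟨R, hR⟩ : ∃ R, R = P - (MvPowerSeries.C (t0 / 2) * coord 0 ^ 2 +
    MvPowerSeries.C t1 * (coord 0 * coord 1) + MvPowerSeries.C (t2 / 2) * coord 1 ^ 2) := ⟨_, rfl⟩
  obtain ⟨R', hR'⟩ : ∃ R', R' = Q - (MvPowerSeries.C (t1 / 2) * coord 0 ^ 2 +
    MvPowerSeries.C t2 * (coord 0 * coord 1) + MvPowerSeries.C (t3 / 2) * coord 1 ^ 2) := ⟨_, rfl⟩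
  rw [← hR] at hP
  rw [← hR'] at hQ
  have lP : 2 * (P - R) = MvPowerSeries.C t0 * coord 0 ^ 2 +
      2 * MvPowerSeries.C t1 * (coord 0 * coord 1) + MvPowerSeries.C t2 * coord 1 ^ 2 := by
    rw [hR]
    linear_combination coord 0 ^ 2 * double t0 + coord 1 ^ 2 * double t2
  have lQ : 2 * (Q - R') = MvPowerSeries.C t1 * coord 0 ^ 2 +
      2 * MvPowerSeries.C t2 * (coord 0 * coord 1) + MvPowerSeries.C t3 * coord 1 ^ 2 := by
    rw [hR']
    linear_combination coord 0 ^ 2 * double t1 + coord 1 ^ 2 * double t3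
  have comb : ∀ a b c d : Germ,
      a * (coord 0 * (2 * (P - R))) + b * (coord 1 * (2 * (P - R))) +
        c * (coord 0 * (2 * (Q - R'))) + d * (coord 1 * (2 * (Q - R'))) ∈ I ⊔ germIdeal ^ 4 := by
    intro a b c d
    have hm : ∀ i, ∀ r ∈ germIdeal ^ 3, coord i * r ∈ germIdeal ^ 4 := fun i r hr => by
      rw [pow_succ']; exact Ideal.mul_mem_mul (coord_mem i) hr
    have e1 := Submodule.add_mem_sup
      (I.add_mem (Ideal.mul_mem_left _ (2 * a * coord 0 + 2 * b * coord 1) hPI)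
        (Ideal.mul_mem_left _ (2 * c * coord 0 + 2 * d * coord 1) hQI))
      (Ideal.add_mem _
        (Ideal.add_mem _ (Ideal.mul_mem_left _ (-2 * a) (hm 0 R hP))
          (Ideal.mul_mem_left _ (-2 * b) (hm 1 R hP)))
        (Ideal.add_mem _ (Ideal.mul_mem_left _ (-2 * c) (hm 0 R' hQ))
          (Ideal.mul_mem_left _ (-2 * d) (hm 1 R' hQ))))
    convert e1 using 1
    ring
  rw [lP, lQ] at comb
  generalize MvPowerSeries.C (σ := Fin 2) t0 = T0 at comb hunit
  generalize MvPowerSeries.C (σ := Fin 2) t1 = T1 at comb hunit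
  generalize MvPowerSeries.C (σ := Fin 2) t2 = T2 at comb hunit
  generalize MvPowerSeries.C (σ := Fin 2) t3 = T3 at comb hunit
  refine germIdeal_pow_le (germIdeal_pow_three_le (i := 0) (j := 1) (by decide) ?_ ?_ ?_ ?_)
  · rw [← Ideal.unit_mul_mem_iff_mem _ hunit]
    convert comb (T0 * T3 ^ 2 - 5 * T1 * T2 * T3 + 4 * T2 ^ 3)
      (-2 * T1 * T3 ^ 2 + 2 * T2 ^ 2 * T3) (4 * T1 ^ 2 * T3 - 3 * T1 * T2 ^ 2 - T0 * T2 * T3)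
      (2 * T1 * T2 * T3 - 2 * T2 ^ 3) using 1
    ring
  · rw [← Ideal.unit_mul_mem_iff_mem _ hunit]
    convert comb (2 * T1 ^ 2 * T3 - 2 * T1 * T2 ^ 2) (T0 * T3 ^ 2 - T1 * T2 * T3)
      (-2 * T0 * T1 * T3 + 2 * T0 * T2 ^ 2) (-T0 * T2 * T3 + T1 * T2 ^ 2) using 1
    ring
  · rw [← Ideal.unit_mul_mem_iff_mem _ hunit]
    convert comb (-T0 * T1 * T3 + T1 ^ 2 * T2) (-2 * T0 * T2 * T3 + 2 * T1 ^ 2 * T3)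
      (T0 ^ 2 * T3 - T0 * T1 * T2) (2 * T0 * T2 ^ 2 - 2 * T1 ^ 2 * T2) using 1
    ring
  · rw [← Ideal.unit_mul_mem_iff_mem _ hunit]
    convert comb (2 * T0 * T1 * T2 - 2 * T1 ^ 3)
      (4 * T0 * T2 ^ 2 - T0 * T1 * T3 - 3 * T1 ^ 2 * T2) (-2 * T0 ^ 2 * T2 + 2 * T0 * T1 ^ 2)
      (T0 ^ 2 * T3 - 5 * T0 * T1 * T2 + 4 * T1 ^ 3) using 1
    ring

/-- The linear map whose components are the constant coefficient, the linear part and a linear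
combination of the entries of the Hessian. -/
def jetMap (α β γ : ℂ) : Germ →ₗ[ℂ] (Fin 4 → ℂ) where
  toFun f := ![constantCoeff f, linearPart f 0, linearPart f 1,
    α * hessian f 0 0 + β * hessian f 0 1 + γ * hessian f 1 1]
  map_add' f f' := by
    ext i; fin_cases i
    · exact map_add _ f f'
    · exact linearPart_add f f' 0
    · exact linearPart_add f f' 1
    · simp [hessian_add]; ring
  map_smul' c f := by
    ext i; fin_cases i
    · simp
    · exact linearPart_smul c f 0
    · exact linearPart_smul c f 1
    · simp [hessian_smul]; ring

theorem jetMap_eq_zero_iff {α β γ : ℂ} {f : Germ} : jetMap α β γ f = 0 ↔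
    constantCoeff f = 0 ∧ linearPart f 0 = 0 ∧ linearPart f 1 = 0 ∧
      α * hessian f 0 0 + β * hessian f 0 1 + γ * hessian f 1 1 = 0 := by
  constructor
  · exact fun h => ⟨congrFun h 0, congrFun h 1, congrFun h 2, congrFun h 3⟩
  · rintro ⟨h0, h1, h2, h3⟩
    ext i; fin_cases i
    · exact h0
    · exact h1
    · exact h2
    · exact h3

theorem jetMap_surjective {α β γ : ℂ} (h : α ≠ 0 ∨ β ≠ 0 ∨ γ ≠ 0) :
    Function.Surjective (jetMap α β γ) := by
  intro y
  obtain ⟨a, b, c, h⟩ : ∃ a b c : ℂ, α * (2 * a) + β * b + γ * (2 * c) = y 3 := by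
    rcases h with h | h | h
    · exact ⟨y 3 / (2 * α), 0, 0, by field_simp; ring⟩
    · exact ⟨0, y 3 / β, 0, by field_simp; ring⟩
    · exact ⟨0, 0, y 3 / (2 * γ), by field_simp; ring⟩
  refine ⟨MvPowerSeries.C (y 0) + MvPowerSeries.C (y 1) * coord 0 +
    MvPowerSeries.C (y 2) * coord 1 + MvPowerSeries.C a * (coord 0 * coord 0) +
    MvPowerSeries.C b * (coord 0 * coord 1) + MvPowerSeries.C c * (coord 1 * coord 1), ?_⟩
  ext i
  fin_cases i
  · simp [jetMap]
  · simp [jetMap, linearPart_add, linearPart_mul]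
  · simp [jetMap, linearPart_add, linearPart_mul]
  · simp [jetMap, hessian_add, hessian_mul, linearPart_mul]
    linear_combination h

/-- Cramer's rule for two vectors in the plane orthogonal to their nonzero cross product. -/
theorem exists_combination_of_cross {t0 t1 t2 t3 x0 x1 x2 : ℂ}
    (h : t1 * t3 - t2 ^ 2 ≠ 0 ∨ -(t0 * t3 - t1 * t2) ≠ 0 ∨ t0 * t2 - t1 ^ 2 ≠ 0)
    (hx : (t1 * t3 - t2 ^ 2) * x0 + -(t0 * t3 - t1 * t2) * x1 + (t0 * t2 - t1 ^ 2) * x2 = 0) :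
    ∃ x y : ℂ, x0 = x * t0 + y * t1 ∧ x1 = x * t1 + y * t2 ∧ x2 = x * t2 + y * t3 := by
  rcases h with h | h | h
  · refine ⟨(t3 * x1 - t2 * x2) / (t1 * t3 - t2 ^ 2), (t1 * x2 - t2 * x1) / (t1 * t3 - t2 ^ 2),
      ?_, ?_, ?_⟩ <;>
      rw [div_mul_eq_mul_div, div_mul_eq_mul_div, ← add_div, eq_div_iff h]
    · linear_combination hx
    · ring
    · ring
  · rw [neg_ne_zero] at h
    refine ⟨(t3 * x0 - t1 * x2) / (t0 * t3 - t1 * t2), (t0 * x2 - t2 * x0) / (t0 * t3 - t1 * t2),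
      ?_, ?_, ?_⟩ <;>
      rw [div_mul_eq_mul_div, div_mul_eq_mul_div, ← add_div, eq_div_iff h]
    · ring
    · linear_combination -hx
    · ring
  · refine ⟨(t2 * x0 - t1 * x1) / (t0 * t2 - t1 ^ 2), (t0 * x1 - t1 * x0) / (t0 * t2 - t1 ^ 2),
      ?_, ?_, ?_⟩ <;>
      rw [div_mul_eq_mul_div, div_mul_eq_mul_div, ← add_div, eq_div_iff h]
    · ring
    · ring
    · linear_combination hx

/-- A germ of multiplicity three whose tangent cone consists of three different lines has Tjurina
number four. The hypothesis states that the discriminant of the tangent cone does not vanish. -/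
theorem finrank_tjurina_of_discriminant {g : Germ} (h0 : constantCoeff g = 0)
    (h1 : ∀ i, linearPart g i = 0) (h2 : ∀ i j, hessian g i j = 0) {t0 t1 t2 t3 : ℂ}
    (ht0 : hessian (der 0 g) 0 0 = t0) (ht1 : hessian (der 0 g) 0 1 = t1)
    (ht2 : hessian (der 0 g) 1 1 = t2) (ht3 : hessian (der 1 g) 1 1 = t3)
    (hD : (t0 * t3 - t1 * t2) ^ 2 - 4 * (t0 * t2 - t1 ^ 2) * (t1 * t3 - t2 ^ 2) ≠ 0) :
    Module.finrank ℂ (Germ ⧸ tjurinaIdeal g) = 4 := by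
  have hq0 : hessian (der 1 g) 0 0 = t1 := by
    rw [← ht1, hessian, hessian, der_comm g 0 1]
  have hq1 : hessian (der 1 g) 0 1 = t2 := by
    rw [← ht2, hessian, hessian, der_comm (der 1 g) 0 1, der_comm g 0 1]
  have hd : ∀ i, constantCoeff (der i g) = 0 := fun i => by rw [← linearPart_eq, h1]
  have hd1 : ∀ i j, linearPart (der i g) j = 0 := fun i j => by rw [linearPart_der, h2]
  have hPJ := der_mem_tjurinaIdeal g 0
  have hQJ := der_mem_tjurinaIdeal g 1
  have hcube := germIdeal_cube_le_of_discriminant hPJ hQJ (hd 0) (hd 1) (hd1 0) (hd1 1) ht0 ht1 ht2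
    hq0 hq1 ht3 hD
  have hex : ∀ f ∈ tjurinaIdeal g, ∃ a b c : Germ, f = a * g + b * der 0 g + c * der 1 g :=
    fun f hf => exists_of_mem_tjurinaIdeal hf
  have hd0 := hd 0
  have hd' := hd 1
  have hd10 := hd1 0
  have hd1' := hd1 1
  generalize der 0 g = P at *
  generalize der 1 g = Q at *
  have hne : t1 * t3 - t2 ^ 2 ≠ 0 ∨ -(t0 * t3 - t1 * t2) ≠ 0 ∨ t0 * t2 - t1 ^ 2 ≠ 0 := by
    by_contra! h
    apply hD
    rw [h.1, neg_eq_zero.1 h.2.1]; ring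
  refine finrank_quotient_eq (jetMap _ _ _) (jetMap_surjective hne) fun f => ?_
  rw [jetMap_eq_zero_iff]
  constructor
  · intro hf
    obtain ⟨a, b, c, rfl⟩ := hex f hf
    refine ⟨?_, ?_, ?_, ?_⟩
    · simp [h0, hd0, hd']
    · simp [linearPart_add, linearPart_mul, h0, h1, hd0, hd', hd10, hd1']
    · simp [linearPart_add, linearPart_mul, h0, h1, hd0, hd', hd10, hd1']
    · simp [hessian_add, hessian_mul, h0, h1, h2, hd0, hd', hd10, hd1', ht0, ht1, ht2, ht3, hq0,
        hq1]
      ring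
  · rintro ⟨f0, f1, f2, f3⟩
    obtain ⟨x, y, hx0, hx1, hx2⟩ := exists_combination_of_cross hne f3
    have hmem : f - (MvPowerSeries.C x * P + MvPowerSeries.C y * Q) ∈ germIdeal ^ 3 := by
      refine mem_germIdeal_cube ?_ (fun i => ?_) fun i j => ?_
      · simp [f0, hd0, hd']
      · fin_cases i <;>
          simp [linearPart_sub, linearPart_add, linearPart_mul, f1, f2, hd0, hd', hd10, hd1']
      · have c1 := hessian_comm f 1 0
        have c2 := hessian_comm P 1 0
        have c3 := hessian_comm Q 1 0
        fin_cases i <;> fin_cases j <;>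
          simp [hessian_sub, hessian_add, hessian_mul, c1, c2, c3, ht0, ht1, ht2, ht3, hq0, hq1,
            hx0, hx1, hx2, hd0, hd', hd10, hd1']
    have := (tjurinaIdeal g).add_mem (hcube hmem) ((tjurinaIdeal g).add_mem
      (Ideal.mul_mem_left _ (MvPowerSeries.C x) hPJ)
      (Ideal.mul_mem_left _ (MvPowerSeries.C y) hQJ))
    convert this using 1
    ring

/-! ### Nodes, tacnodes and ordinary triple points -/

theorem transversal_iff {a b : Germ} : Transversal a b ↔
    linearPart a 0 * linearPart b 1 - linearPart a 1 * linearPart b 0 ≠ 0 := by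
  rw [Transversal, LinearIndependent.pair_iff]
  constructor
  · intro h hdet
    have h1 := h (linearPart b 1) (-linearPart a 1) (by
      ext i; fin_cases i
      · simp; linear_combination hdet
      · simp; ring)
    have h2 := h (linearPart b 0) (-linearPart a 0) (by
      ext i; fin_cases i
      · simp; ring
      · simp; linear_combination -hdet)
    have h3 := h 0 1 (by
      ext i; fin_cases i
      · simpa using h2.1
      · simpa using h1.1)
    exact one_ne_zero h3.2
  · intro hdet s t h
    have h0 := congrFun h 0
    have h1 := congrFun h 1
    simp only [Pi.add_apply, Pi.smul_apply, smul_eq_mul, Pi.zero_apply] at h0 h1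
    constructor
    · refine (mul_eq_zero.1 (?_ : s * _ = 0)).resolve_right hdet
      linear_combination linearPart b 1 * h0 - linearPart b 0 * h1
    · refine (mul_eq_zero.1 (?_ : t * _ = 0)).resolve_right hdet
      linear_combination linearPart a 0 * h1 - linearPart a 1 * h0

theorem IsNodeGerm.jet {g : Germ} (h : IsNodeGerm g) : constantCoeff g = 0 ∧
    (∀ i, linearPart g i = 0) ∧
    hessian g 0 0 * hessian g 1 1 - hessian g 0 1 * hessian g 0 1 ≠ 0 := by
  obtain ⟨a, b, ha, hb, hab, rfl⟩ := h
  refine ⟨by simp [ha.1], fun i => by simp [linearPart_mul, ha.1, hb.1], ?_⟩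
  rw [transversal_iff] at hab
  simp only [hessian_mul, ha.1, hb.1]
  intro h0
  apply hab
  rw [← pow_eq_zero_iff two_ne_zero]
  linear_combination -h0

theorem IsTacnodeGerm.jet {g : Germ} (h : IsTacnodeGerm g) : constantCoeff g = 0 ∧
    (∀ i, linearPart g i = 0) ∧
    hessian g 0 0 * hessian g 1 1 - hessian g 0 1 * hessian g 0 1 = 0 ∧
    ∃ i j, hessian g i j ≠ 0 := by
  obtain ⟨a, b, ha, hb, hab, -, rfl⟩ := h
  rw [transversal_iff, not_not] at hab
  refine ⟨by simp [ha.1], fun i => by simp [linearPart_mul, ha.1, hb.1], ?_, ?_⟩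
  · simp only [hessian_mul, ha.1, hb.1]
    linear_combination (-(linearPart a 0 * linearPart b 1 - linearPart a 1 * linearPart b 0)) * hab
  · by_contra! hH
    simp only [hessian_mul, ha.1, hb.1, zero_mul, zero_add] at hH
    obtain ⟨i, hi⟩ := Function.ne_iff.1 ha.2
    obtain ⟨j, hj⟩ := Function.ne_iff.1 hb.2
    have h00 := hH 0 0
    have h11 := hH 1 1
    have h01 := hH 0 1
    have e0 : linearPart a 0 * linearPart b 0 = 0 := by linear_combination h00 / 2
    have e1 : linearPart a 1 * linearPart b 1 = 0 := by linear_combination h11 / 2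
    have e2 : linearPart a 0 * linearPart b 1 = 0 := by linear_combination (h01 + hab) / 2
    have e3 : linearPart a 1 * linearPart b 0 = 0 := by linear_combination (h01 - hab) / 2
    have : linearPart a i * linearPart b j = 0 := by
      fin_cases i <;> fin_cases j <;> assumption
    exact (mul_ne_zero hi hj) this

theorem IsOrdinaryTripleGerm.jet {g : Germ} (h : IsOrdinaryTripleGerm g) :
    constantCoeff g = 0 ∧ (∀ i, linearPart g i = 0) ∧ ∀ i j, hessian g i j = 0 := by
  obtain ⟨a, ha, -, rfl⟩ := h
  have h0 := fun i => (ha i).1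
  rw [Fin.prod_univ_three]
  refine ⟨by simp [h0], fun i => by simp [linearPart_mul, h0], fun i j => ?_⟩
  simp [hessian_mul, linearPart_mul, h0]

theorem IsNodeGerm.not_isTacnodeGerm {g : Germ} (h : IsNodeGerm g) : ¬ IsTacnodeGerm g :=
  fun h' => h.jet.2.2 h'.jet.2.2.1

theorem IsNodeGerm.not_isOrdinaryTripleGerm {g : Germ} (h : IsNodeGerm g) :
    ¬ IsOrdinaryTripleGerm g := fun h' => h.jet.2.2 (by simp [h'.jet.2.2])

theorem IsTacnodeGerm.not_isOrdinaryTripleGerm {g : Germ} (h : IsTacnodeGerm g) :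
    ¬ IsOrdinaryTripleGerm g := fun h' => by
  obtain ⟨i, j, hij⟩ := h.jet.2.2.2
  exact hij (h'.jet.2.2 i j)

theorem IsNodeGerm.finrank_tjurina {g : Germ} (h : IsNodeGerm g) :
    Module.finrank ℂ (Germ ⧸ tjurinaIdeal g) = 1 :=
  finrank_tjurina_of_hessian_det h.jet.1 h.jet.2.1 h.jet.2.2

theorem hessian_der_mul_mul {a b c : Germ} (ha : constantCoeff a = 0) (hb : constantCoeff b = 0)
    (hc : constantCoeff c = 0) (i j k : Fin 2) : hessian (der i (a * b * c)) j k =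
      linearPart a i * (linearPart b j * linearPart c k + linearPart b k * linearPart c j) +
      linearPart b i * (linearPart a j * linearPart c k + linearPart a k * linearPart c j) +
      linearPart c i * (linearPart a j * linearPart b k + linearPart a k * linearPart b j) := by
  simp only [der_mul, hessian_add, hessian_mul, linearPart_mul, linearPart_add, map_mul, map_add,
    ha, hb, hc, ← linearPart_eq]
  ring

theorem IsOrdinaryTripleGerm.finrank_tjurina {g : Germ} (h : IsOrdinaryTripleGerm g) :
    Module.finrank ℂ (Germ ⧸ tjurinaIdeal g) = 4 := by
  obtain ⟨h0, h1, h2⟩ := h.jet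
  refine finrank_tjurina_of_discriminant h0 h1 h2 rfl rfl rfl rfl ?_
  obtain ⟨a, ha, hpw, rfl⟩ := h
  have c0 := fun i => (ha i).1
  have p01 := transversal_iff.1 (hpw (show (0 : Fin 3) ≠ 1 by decide))
  have p02 := transversal_iff.1 (hpw (show (0 : Fin 3) ≠ 2 by decide))
  have p12 := transversal_iff.1 (hpw (show (1 : Fin 3) ≠ 2 by decide))
  rw [Fin.prod_univ_three]
  simp only [hessian_der_mul_mul (c0 0) (c0 1) (c0 2)]
  intro hD
  -- the discriminant is a multiple of the square of the product of the three pairwise determinants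
  refine pow_ne_zero 2 (mul_ne_zero (mul_ne_zero p01 p02) p12) ?_
  linear_combination (-1 / 48) * hD

theorem exists_of_constantCoeff_eq_zero' {f : Germ} (hf : constantCoeff f = 0) {i j : Fin 2}
    (hij : i ≠ j) : ∃ a b : Germ, f = coord i * a + coord j * b := by
  obtain ⟨a, b, h⟩ := exists_of_constantCoeff_eq_zero hf
  fin_cases i <;> fin_cases j
  · exact absurd rfl hij
  · exact ⟨a, b, h⟩
  · exact ⟨b, a, by rw [h]; exact add_comm _ _⟩
  · exact absurd rfl hij

theorem isUnit_of_constantCoeff {U : Germ} (h : constantCoeff U ≠ 0) : IsUnit U :=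
  MvPowerSeries.isUnit_iff_constantCoeff.2 (isUnit_iff_ne_zero.2 h)

/-- The line `u = 0` and the conic `c u + u² + v² = 0` form a tacnode. -/
theorem isTacnodeGerm_line_mul_conic {i j : Fin 2} (hij : i ≠ j) {c : ℂ} (hc : c ≠ 0) {U : Germ}
    (hU : constantCoeff U ≠ 0) : IsTacnodeGerm
      (coord i * (MvPowerSeries.C c * coord i + coord i ^ 2 + coord j ^ 2) * U) := by
  set q := MvPowerSeries.C c * coord i + coord i ^ 2 + coord j ^ 2 with hq
  have lq : ∀ k, linearPart q k = if k = i then c else 0 := fun k => by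
    simp [hq, linearPart_add, linearPart_mul, pow_two]
  have q0 : constantCoeff q = 0 := by simp [hq]
  have lqU : ∀ k, linearPart (q * U) k = if k = i then constantCoeff U * c else 0 := fun k => by
    rw [linearPart_mul, q0, lq]; simp
  refine ⟨coord i, q * U, ⟨constantCoeff_coord i, fun h => ?_⟩, ⟨by simp [q0], fun h => ?_⟩, ?_, ?_,
    by ring⟩
  · simpa using congrFun h i
  · have := congrFun h i
    rw [lqU, if_pos rfl] at this
    exact mul_ne_zero hU hc this
  · rw [transversal_iff, not_not]
    simp only [lqU, linearPart_coord]
    fin_cases i <;> simp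
  · obtain ⟨u, hu⟩ := isUnit_of_constantCoeff hU
    refine finrank_quotient_eq
      { toFun := fun f => ![constantCoeff f, linearPart f j]
        map_add' := fun f f' => by
          ext k; fin_cases k
          · exact map_add _ f f'
          · exact linearPart_add f f' j
        map_smul' := fun z f => by
          ext k; fin_cases k
          · simp
          · exact linearPart_smul z f j } (fun y => ?_) fun f => ?_
    · refine ⟨MvPowerSeries.C (y 0) + MvPowerSeries.C (y 1) * coord j, ?_⟩
      ext k; fin_cases k
      · simp
      · simp [linearPart_add, linearPart_mul]
    · constructor
      · intro hf
        obtain ⟨a, b, rfl⟩ := Ideal.mem_span_pair.1 hf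
        ext k; fin_cases k
        · simp [q0]
        · simp [linearPart_add, linearPart_mul, q0, lq, hij.symm]
      · intro hf
        have f0 : constantCoeff f = 0 := congrFun hf 0
        have f1 : linearPart f j = 0 := congrFun hf 1
        obtain ⟨a, b, rfl⟩ := exists_of_constantCoeff_eq_zero' f0 hij
        have b0 : constantCoeff b = 0 := by
          simpa [linearPart_add, linearPart_mul, hij.symm] using f1
        obtain ⟨a', b', rfl⟩ := exists_of_constantCoeff_eq_zero' b0 hij
        refine Ideal.mem_span_pair.2 ⟨a + coord j * a' - b' * (MvPowerSeries.C c + coord i),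
          b' * (↑u⁻¹ : Germ), ?_⟩
        have hUu : U * (↑u⁻¹ : Germ) = 1 := by rw [← hu, Units.mul_inv]
        rw [hq]
        linear_combination (b' * (MvPowerSeries.C c * coord i + coord i ^ 2 + coord j ^ 2)) * hUu

/-- The Tjurina number of the tacnode formed by `u = 0` and `c u + u² + v² = 0` is three. -/
theorem finrank_tjurina_line_mul_conic {i j : Fin 2} (hij : i ≠ j) {c : ℂ} (hc : c ≠ 0) {U : Germ}
    (hU : constantCoeff U ≠ 0) : Module.finrank ℂ (Germ ⧸ tjurinaIdeal
      (coord i * (MvPowerSeries.C c * coord i + coord i ^ 2 + coord j ^ 2) * U)) = 3 := by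
  rw [tjurinaIdeal_mul_unit _ (isUnit_of_constantCoeff hU)]
  obtain ⟨J, hJ⟩ : ∃ J, J = tjurinaIdeal
    (coord i * (MvPowerSeries.C c * coord i + coord i ^ 2 + coord j ^ 2)) := ⟨_, rfl⟩
  obtain ⟨q, hq⟩ : ∃ q : Germ, q = 2 * (MvPowerSeries.C c * coord i) + 3 * coord i ^ 2 +
    coord j ^ 2 := ⟨_, rfl⟩
  have di : der i (coord i * (MvPowerSeries.C c * coord i + coord i ^ 2 + coord j ^ 2)) = q := by
    simp [pow_two, hij, hq]
    ring
  have dj : der j (coord i * (MvPowerSeries.C c * coord i + coord i ^ 2 + coord j ^ 2)) =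
      2 * (coord i * coord j) := by
    simp [pow_two, hij.symm]
    ring
  have c2 : constantCoeff (2 : Germ) = 2 := map_ofNat _ 2
  have hqJ : q ∈ J := by rw [hJ, ← di]; exact der_mem_tjurinaIdeal _ i
  have hxy : coord i * coord j ∈ J := by
    have h1 := der_mem_tjurinaIdeal
      (coord i * (MvPowerSeries.C c * coord i + coord i ^ 2 + coord j ^ 2)) j
    rw [dj, ← hJ] at h1
    have h2 : IsUnit (2 : Germ) := isUnit_of_constantCoeff (by simp [c2])
    exact (Ideal.unit_mul_mem_iff_mem _ h2).1 h1
  have hxx : coord i ^ 2 ∈ J := by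
    have h2 : IsUnit (2 * MvPowerSeries.C c + 3 * coord i : Germ) :=
      isUnit_of_constantCoeff (by simpa [c2] using hc)
    rw [← Ideal.unit_mul_mem_iff_mem _ h2]
    have := J.sub_mem (J.mul_mem_left (coord i) hqJ) (J.mul_mem_left (coord j) hxy)
    convert this using 1
    rw [hq]; ring
  have hyyy : coord j ^ 3 ∈ J := by
    have := J.sub_mem (J.mul_mem_left (coord j) hqJ)
      (J.mul_mem_left (2 * MvPowerSeries.C c + 3 * coord i) hxy)
    convert this using 1
    rw [hq]; ring
  have hcube : germIdeal ^ 3 ≤ J := by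
    refine germIdeal_pow_three_le hij ?_ ?_ ?_ hyyy
    · rw [pow_succ]; exact J.mul_mem_right _ hxx
    · exact J.mul_mem_right _ hxx
    · rw [pow_two, ← mul_assoc]; exact J.mul_mem_right _ hxy
  have hle : ∀ f ∈ J, ∃ a b d : Germ, f = a * q + b * (coord i * coord j) +
      d * (coord i * coord i) := by
    intro f hf
    rw [hJ] at hf
    have hx : tjurinaIdeal (coord i * (MvPowerSeries.C c * coord i + coord i ^ 2 + coord j ^ 2)) ≤
        Ideal.span {q, coord i * coord j, coord i ^ 2} := by
      refine tjurinaIdeal_le ?_ fun k => ?_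
      · refine Submodule.mem_span_triple.2 ⟨0, coord j, MvPowerSeries.C c + coord i, ?_⟩
        simp only [smul_eq_mul]; ring
      · by_cases hk : k = i
        · rw [hk, di]; exact Ideal.subset_span (by simp)
        · have : k = j := by omega
          rw [this, dj]
          exact Ideal.mul_mem_left _ _ (Ideal.subset_span (by simp))
    obtain ⟨a, b, d, h⟩ := Submodule.mem_span_triple.1 (hx hf)
    exact ⟨a, b, d, by rw [← h, smul_eq_mul, smul_eq_mul, smul_eq_mul]; ring⟩
  have lq : ∀ k, linearPart q k = if k = i then 2 * c else 0 := fun k => by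
    simp [hq, linearPart_add, linearPart_mul, pow_two, c2]
  have q0 : constantCoeff q = 0 := by simp [hq]
  have Hq : hessian q j j = 2 := by
    simp [hq, hessian_add, hessian_mul, linearPart_mul, pow_two, hij.symm]
    norm_num
  rw [← hJ]
  refine finrank_quotient_eq
    { toFun := fun f => ![constantCoeff f, linearPart f j, linearPart f i - c * hessian f j j]
      map_add' := fun f f' => by
        ext k; fin_cases k
        · exact map_add _ f f'
        · exact linearPart_add f f' j
        · simp [linearPart_add, hessian_add]; ring
      map_smul' := fun z f => by
        ext k; fin_cases k
        · simp
        · exact linearPart_smul z f j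
        · simp [linearPart_smul, hessian_smul]; ring } (fun y => ?_) fun f => ?_
  · refine ⟨MvPowerSeries.C (y 0) + MvPowerSeries.C (y 1) * coord j +
      MvPowerSeries.C (y 2) * coord i, ?_⟩
    ext k; fin_cases k
    · simp
    · simp [linearPart_add, linearPart_mul, hij.symm]
    · simp [linearPart_add, linearPart_mul, hessian_add, hessian_mul, hij]
  · constructor
    · intro hf
      obtain ⟨a, b, d, rfl⟩ := hle f hf
      ext k; fin_cases k
      · simp [q0]
      · simp [linearPart_add, linearPart_mul, q0, lq, hij.symm]
      · simp [linearPart_add, linearPart_mul, hessian_add, hessian_mul, q0, lq, Hq, hij.symm]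
        ring
    · intro hf
      have f0 : constantCoeff f = 0 := congrFun hf 0
      have f1 : linearPart f j = 0 := congrFun hf 1
      have f2 : linearPart f i - c * hessian f j j = 0 := congrFun hf 2
      obtain ⟨f', hf'⟩ : ∃ f', f' = f - MvPowerSeries.C (hessian f j j / 2) * q := ⟨_, rfl⟩
      have g0 : constantCoeff f' = 0 := by rw [hf']; simp [f0, q0]
      have g1 : ∀ k, linearPart f' k = 0 := fun k => by
        rw [hf', linearPart_sub, linearPart_mul, lq, q0]
        by_cases hk : k = i
        · rw [hk, if_pos rfl]; simp; linear_combination f2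
        · have : k = j := by omega
          rw [this, f1]; simp [hij.symm]
      have g2 : hessian f' j j = 0 := by
        rw [hf', hessian_sub, hessian_mul, Hq, q0]; simp
      have h3 := hcube (sub_quadratic_mem g0 g1)
      have hsq : ∀ k, MvPowerSeries.C (hessian f' k k / 2) * coord k ^ 2 ∈ J := fun k => by
        by_cases hk : k = i
        · rw [hk]; exact J.mul_mem_left _ hxx
        · have : k = j := by omega
          rw [this, g2]; simp
      have h01 : coord 0 * coord 1 ∈ J := by
        fin_cases i <;> fin_cases j
        · exact absurd rfl hij
        · exact hxy
        · rw [mul_comm]; exact hxy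
        · exact absurd rfl hij
      have h4 : f' ∈ J := by
        have := J.add_mem h3 (J.add_mem (J.add_mem (hsq 0) (J.mul_mem_left
          (MvPowerSeries.C (hessian f' 0 1)) h01)) (hsq 1))
        convert this using 1
        ring
      have := J.add_mem h4 (J.mul_mem_left (MvPowerSeries.C (hessian f j j / 2)) hqJ)
      rw [hf'] at this
      convert this using 1
      ring

/-! ### Germs of plane curves -/

/-- The representative of `p` whose coordinate with index `chartIndex p` is `1`. -/
def affinePoint (p : Plane) : Fin 3 → ℂ := (p.rep (chartIndex p))⁻¹ • p.rep

theorem affinePoint_chartIndex (p : Plane) : affinePoint p (chartIndex p) = 1 := by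
  simp [affinePoint, rep_chartIndex_ne_zero p]

theorem affinePoint_ne_zero (p : Plane) : affinePoint p ≠ 0 := fun h => by
  have := affinePoint_chartIndex p
  simp [h] at this

theorem constantCoeff_localEquation (f : S) (p : Plane) :
    MvPolynomial.constantCoeff (localEquation f p) = eval (affinePoint p) f := by
  induction f using MvPolynomial.induction_on with
  | C a => simp [localEquation]
  | add f g hf hg => simpa [localEquation] using congrArg₂ (· + ·) hf hg
  | mul_X f i hf =>
    have h1 : localEquation (f * X i) p = localEquation f p * localEquation (X i) p :=
      map_mul _ _ _
    rw [h1, map_mul, map_mul, hf, eval_X]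
    congr 1
    rw [localEquation, aeval_X]
    rcases Fin.eq_self_or_eq_succAbove (chartIndex p) i with rfl | ⟨j, rfl⟩
    · rw [Fin.insertNth_apply_same, affinePoint_chartIndex, map_one]
    · rw [Fin.insertNth_apply_succAbove]
      simp [affinePoint, div_eq_inv_mul]

theorem pderiv_localEquation (f : S) (p : Plane) (s : Fin 2) :
    pderiv s (localEquation f p) =
      localEquation (pderiv ((chartIndex p).succAbove s) f) p := by
  have hmul : ∀ f g : S, localEquation (f * g) p = localEquation f p * localEquation g p :=
    fun f g => map_mul _ f g
  have hadd : ∀ f g : S, localEquation (f + g) p = localEquation f p + localEquation g p :=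
    fun f g => map_add _ f g
  induction f using MvPolynomial.induction_on with
  | C a => simp [localEquation, algebraMap_eq]
  | add f g hf hg => rw [hadd, map_add, hf, hg, map_add, hadd]
  | mul_X f i hf =>
    rw [hmul, Derivation.leibniz, Derivation.leibniz, hadd, hf]
    simp only [smul_eq_mul, hmul]
    congr 2
    rw [localEquation, aeval_X, localEquation]
    rcases Fin.eq_self_or_eq_succAbove (chartIndex p) i with rfl | ⟨j, rfl⟩
    · rw [Fin.insertNth_apply_same, pderiv_one, pderiv_X_of_ne (Fin.succAbove_ne _ s).symm,
        map_zero]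
    · rw [Fin.insertNth_apply_succAbove]
      by_cases hj : s = j
      · subst hj; simp
      · rw [pderiv_X_of_ne fun h => hj (Fin.succAbove_right_injective h).symm, map_zero, map_add,
          pderiv_C, add_zero, pderiv_X_of_ne (Ne.symm hj)]

theorem constantCoeff_germ (f : S) (p : Plane) :
    constantCoeff (germ f p) = eval (affinePoint p) f := by
  rw [← constantCoeff_localEquation, germ, ← MvPowerSeries.coeff_zero_eq_constantCoeff_apply,
    MvPolynomial.coeff_coe]
  rfl

theorem der_germ (f : S) (p : Plane) (s : Fin 2) :
    der s (germ f p) = germ (pderiv ((chartIndex p).succAbove s) f) p := by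
  rw [germ, MvPowerSeries.pderiv_coe, pderiv_localEquation, germ]

/-- The linear part of the germ at `p` consists of the partial derivatives of `f` other than the
one that belongs to the chart. -/
theorem linearPart_germ (f : S) (p : Plane) (s : Fin 2) : linearPart (germ f p) s =
    eval (affinePoint p) (pderiv ((chartIndex p).succAbove s) f) := by
  rw [linearPart_eq, der_germ, constantCoeff_germ]

theorem germ_mul (f g : S) (p : Plane) : germ (f * g) p = germ f p * germ g p := by
  simp [germ, localEquation]

theorem germ_one (p : Plane) : germ 1 p = 1 := by
  simp [germ, localEquation]

theorem germ_prod {ι : Type*} (s : Finset ι) (g : ι → S) (p : Plane) :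
    germ (∏ i ∈ s, g i) p = ∏ i ∈ s, germ (g i) p := by
  classical
  induction s using Finset.induction_on with
  | empty => simp [germ_one]
  | insert i s hi ih => rw [Finset.prod_insert hi, Finset.prod_insert hi, germ_mul, ih]

theorem tjurinaNumber_eq (f : S) (p : Plane) :
    tjurinaNumber f p = Module.finrank ℂ (Germ ⧸ tjurinaIdeal (germ f p)) := by
  rw [tjurinaNumber, tjurinaIdeal, germ, MvPowerSeries.pderiv_coe, MvPowerSeries.pderiv_coe]

/-- The gradient of a polynomial at `v`. -/
def grad (g : S) (v : Fin 3 → ℂ) : Fin 3 → ℂ := fun i => eval v (pderiv i g)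

theorem sum_mul_grad {g : S} {n : ℕ} (hg : g.IsHomogeneous n) (v : Fin 3 → ℂ) :
    ∑ i, v i * grad g v i = n * eval v g := by
  have := congrArg (eval v) hg.sum_X_mul_pderiv
  simpa [grad] using this

theorem grad_smul {g : S} {n : ℕ} (hg : g.IsHomogeneous n) (t : ℂ) (v : Fin 3 → ℂ) :
    grad g (t • v) = t ^ (n - 1) • grad g v :=
  funext fun _ => eval_smul_of_isHomogeneous hg.pderiv t v

theorem grad_mul (g h : S) (v : Fin 3 → ℂ) :
    grad (g * h) v = eval v g • grad h v + eval v h • grad g v := by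
  ext i; simp [grad]

/-- A vector annihilated by `p` is determined by its entries away from the chart index. Euler's
identity makes the gradient at a point of a curve such a vector, so that the linear part of the
local equation recovers the gradient. -/
theorem eq_zero_of_succAbove {p : Plane}
    {w : Fin 3 → ℂ} (hw : ∑ i, affinePoint p i * w i = 0)
    (h : ∀ s, w ((chartIndex p).succAbove s) = 0) : w = 0 := by
  have h0 : w (chartIndex p) = 0 := by
    rw [Fin.sum_univ_succAbove _ (chartIndex p), affinePoint_chartIndex] at hw
    simpa [h] using hw
  funext i
  rcases Fin.eq_self_or_eq_succAbove (chartIndex p) i with rfl | ⟨j, rfl⟩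
  · exact h0
  · exact h j

theorem affinePoint_mk {v : Fin 3 → ℂ} (hv : v ≠ 0) :
    ∃ t : ℂ, t ≠ 0 ∧ affinePoint (Projectivization.mk ℂ v hv) = t • v := by
  obtain ⟨a, ha⟩ := Projectivization.exists_smul_eq_mk_rep ℂ v hv
  refine ⟨((Projectivization.mk ℂ v hv).rep (chartIndex _))⁻¹ * a, mul_ne_zero
    (inv_ne_zero (rep_chartIndex_ne_zero _)) a.ne_zero, ?_⟩
  rw [affinePoint, mul_smul]
  congr 1
  exact ha.symm

theorem isSingularPoint_iff {f : S} {n : ℕ} (hf : f.IsHomogeneous n) {p : Plane} :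
    IsSingularPoint f p ↔ eval (affinePoint p) f = 0 ∧ grad f (affinePoint p) = 0 := by
  have hc := inv_ne_zero (rep_chartIndex_ne_zero p)
  rw [affinePoint, eval_smul_of_isHomogeneous hf, grad_smul hf, smul_eq_zero, mul_eq_zero]
  simp only [pow_ne_zero _ hc, false_or]
  exact and_congr_right fun _ => funext_iff.symm

theorem isSingularPoint_of_germ {f : S} {n : ℕ} (hf : f.IsHomogeneous n) {p : Plane}
    (h0 : constantCoeff (germ f p) = 0) (h1 : ∀ i, linearPart (germ f p) i = 0) :
    IsSingularPoint f p := by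
  rw [constantCoeff_germ] at h0
  refine (isSingularPoint_iff hf).2 ⟨h0, eq_zero_of_succAbove (p := p) ?_ fun s => ?_⟩
  · rw [sum_mul_grad hf, h0, mul_zero]
  · rw [← h1 s, linearPart_germ]; rfl

/-! ### Products of smooth forms -/

/-- A form of positive degree whose gradient does not vanish outside the origin. -/
def IsSmoothForm (g : S) : Prop :=
  ∃ n, g.IsHomogeneous n ∧ ∀ v, v ≠ 0 → grad g v ≠ 0

theorem IsSmoothForm.eval_smul_eq_zero {g : S} (hg : IsSmoothForm g) {t : ℂ} (ht : t ≠ 0)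
    {v : Fin 3 → ℂ} : eval (t • v) g = 0 ↔ eval v g = 0 := by
  obtain ⟨n, hn, -⟩ := hg
  simp [eval_smul_of_isHomogeneous hn, ht]

theorem IsSmoothForm.eval_affinePoint_mk {g : S} (hg : IsSmoothForm g) {v : Fin 3 → ℂ}
    (hv : v ≠ 0) : eval (affinePoint (Projectivization.mk ℂ v hv)) g = 0 ↔ eval v g = 0 := by
  obtain ⟨t, ht, h⟩ := affinePoint_mk hv
  rw [h, hg.eval_smul_eq_zero ht]

theorem IsSmoothForm.isSmoothBranch {g : S} (hg : IsSmoothForm g) {p : Plane}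
    (h0 : eval (affinePoint p) g = 0) : IsSmoothBranch (germ g p) := by
  obtain ⟨n, hn, hgrad⟩ := hg
  refine ⟨by rw [constantCoeff_germ, h0], fun h => hgrad _ (affinePoint_ne_zero p) ?_⟩
  refine eq_zero_of_succAbove (p := p) ?_ fun s => ?_
  · rw [sum_mul_grad hn, h0, mul_zero]
  · have := congrFun h s
    rwa [linearPart_germ] at this

/-- The curves `g = 0` and `h = 0` meet at `v` with different tangent lines. -/
def AreTransversal (g h : S) (v : Fin 3 → ℂ) : Prop := crossProduct (grad g v) (grad h v) ≠ 0

theorem AreTransversal.smul {g h : S} (hg : IsSmoothForm g) (hh : IsSmoothForm h)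
    {v : Fin 3 → ℂ} (H : AreTransversal g h v) {t : ℂ} (ht : t ≠ 0) :
    AreTransversal g h (t • v) := by
  obtain ⟨n, hn, -⟩ := hg
  obtain ⟨m, hm, -⟩ := hh
  simp only [AreTransversal, grad_smul hn, grad_smul hm, map_smul, LinearMap.smul_apply]
  exact smul_ne_zero (pow_ne_zero _ ht) (smul_ne_zero (pow_ne_zero _ ht) H)

theorem AreTransversal.transversal {g h : S} (hg : IsSmoothForm g) (hh : IsSmoothForm h) {p : Plane}
    (hg0 : eval (affinePoint p) g = 0) (hh0 : eval (affinePoint p) h = 0)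
    (H : AreTransversal g h (affinePoint p)) : Transversal (germ g p) (germ h p) := by
  obtain ⟨n, hn, -⟩ := hg
  obtain ⟨m, hm, -⟩ := hh
  have hli := crossProduct_ne_zero_iff_linearIndependent.1 H
  rw [LinearIndependent.pair_iff] at hli
  refine LinearIndependent.pair_iff.2 fun s t hst => hli s t ?_
  refine eq_zero_of_succAbove (p := p) ?_ fun k => ?_
  · simp only [Pi.add_apply, Pi.smul_apply, smul_eq_mul, mul_add, Finset.sum_add_distrib]
    have h1 := sum_mul_grad hn (affinePoint p)
    have h2 := sum_mul_grad hm (affinePoint p)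
    rw [hg0, mul_zero] at h1
    rw [hh0, mul_zero] at h2
    simp only [mul_left_comm _ s, mul_left_comm _ t, ← Finset.mul_sum, h1, h2, mul_zero, add_zero]
  · have := congrFun hst k
    simp only [Pi.add_apply, Pi.smul_apply, linearPart_germ] at this
    exact this

section Mul

variable {a b c U : Germ}

theorem IsSmoothBranch.mul_unit (hb : IsSmoothBranch b) (hU : constantCoeff U ≠ 0) :
    IsSmoothBranch (b * U) := by
  refine ⟨by simp [hb.1], fun h => hb.2 (funext fun i => ?_)⟩
  have := congrFun h i
  rw [linearPart_mul, hb.1, zero_mul, zero_add] at this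
  exact (mul_eq_zero.1 this).resolve_left hU

theorem Transversal.mul_unit (h : Transversal a b) (hb : constantCoeff b = 0)
    (hU : constantCoeff U ≠ 0) : Transversal a (b * U) := by
  rw [transversal_iff] at h ⊢
  simp only [linearPart_mul, hb, zero_mul, zero_add]
  convert mul_ne_zero hU h using 1
  ring

end Mul

section Family

variable {ι : Type*} {g : ι → S}

/-- A singular point of a product of smooth forms lies on two of the components. -/
theorem exists_ne_of_isSingularPoint [Fintype ι] (hg : ∀ i, IsSmoothForm (g i)) {p : Plane}
    (hp : IsSingularPoint (∏ i, g i) p) :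
    ∃ i j, i ≠ j ∧ eval p.rep (g i) = 0 ∧ eval p.rep (g j) = 0 := by
  classical
  have h0 := hp.1
  rw [map_prod, Finset.prod_eq_zero_iff] at h0
  obtain ⟨i, -, hi⟩ := h0
  by_contra! h
  have hgrad : grad (∏ i, g i) p.rep = 0 := funext hp.2
  rw [← Finset.mul_prod_erase _ _ (Finset.mem_univ i), grad_mul, hi, zero_smul, zero_add,
    smul_eq_zero, map_prod, Finset.prod_eq_zero_iff] at hgrad
  rcases hgrad with ⟨j, hj, hj0⟩ | hgrad
  · exact h i j (Finset.ne_of_mem_erase hj).symm hi hj0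
  · obtain ⟨n, -, hn⟩ := hg i
    exact hn _ p.rep_nonzero hgrad

theorem AreTransversal.germ (hg : ∀ i, IsSmoothForm (g i))
    {v : Fin 3 → ℂ} (hv : v ≠ 0) {i j : ι} (hi : eval v (g i) = 0)
    (hj : eval v (g j) = 0) (h : AreTransversal (g i) (g j) v) :
    Transversal (germ (g i) (Projectivization.mk ℂ v hv))
      (germ (g j) (Projectivization.mk ℂ v hv)) := by
  refine AreTransversal.transversal (hg i) (hg j) (((hg i).eval_affinePoint_mk hv).2 hi)
    (((hg j).eval_affinePoint_mk hv).2 hj) ?_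
  obtain ⟨t, ht, h'⟩ := affinePoint_mk hv
  rw [h']
  exact h.smul (hg i) (hg j) ht

theorem constantCoeff_prod_germ_ne_zero (hg : ∀ i, IsSmoothForm (g i))
    {v : Fin 3 → ℂ} (hv : v ≠ 0) {s : Finset ι}
    (hs : ∀ k ∈ s, eval v (g k) ≠ 0) :
    constantCoeff (∏ k ∈ s, ConicLine.germ (g k) (Projectivization.mk ℂ v hv)) ≠ 0 := by
  rw [map_prod, Finset.prod_ne_zero_iff]
  intro k hk
  rw [constantCoeff_germ, Ne, (hg k).eval_affinePoint_mk hv]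
  exact hs k hk

theorem exists_germ_prod_eq_two [Fintype ι] (hg : ∀ i, IsSmoothForm (g i))
    {v : Fin 3 → ℂ} (hv : v ≠ 0) {i j : ι} (hij : i ≠ j)
    (h : ∀ k, eval v (g k) = 0 ↔ k = i ∨ k = j) :
    ∃ U : Germ, constantCoeff U ≠ 0 ∧ germ (∏ i, g i) (Projectivization.mk ℂ v hv) =
      germ (g i) (Projectivization.mk ℂ v hv) * germ (g j) (Projectivization.mk ℂ v hv) * U := by
  classical
  refine ⟨∏ k ∈ (Finset.univ.erase i).erase j, germ (g k) (Projectivization.mk ℂ v hv),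
    constantCoeff_prod_germ_ne_zero hg hv fun k hk h0 => ?_, ?_⟩
  · simp only [Finset.mem_erase, Finset.mem_univ, and_true] at hk
    exact ((h k).1 h0).elim hk.2 hk.1
  · rw [germ_prod, ← Finset.mul_prod_erase _ _ (Finset.mem_univ i),
      ← Finset.mul_prod_erase (Finset.univ.erase i) _
        (Finset.mem_erase.2 ⟨hij.symm, Finset.mem_univ j⟩), mul_assoc]

theorem isNode_of_incidence [Fintype ι] (hg : ∀ i, IsSmoothForm (g i))
    {v : Fin 3 → ℂ} (hv : v ≠ 0) {i j : ι} (hij : i ≠ j)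
    (h : ∀ k, eval v (g k) = 0 ↔ k = i ∨ k = j) (ht : AreTransversal (g i) (g j) v) :
    IsNode (∏ i, g i) (Projectivization.mk ℂ v hv) := by
  have hi := (h i).2 (Or.inl rfl)
  have hj := (h j).2 (Or.inr rfl)
  obtain ⟨U, hU, hgU⟩ := exists_germ_prod_eq_two hg hv hij h
  have bi := (hg i).isSmoothBranch (((hg i).eval_affinePoint_mk hv).2 hi)
  have bj := (hg j).isSmoothBranch (((hg j).eval_affinePoint_mk hv).2 hj)
  exact ⟨_, _, bi, bj.mul_unit hU, (ht.germ hg hv hi hj).mul_unit bj.1 hU,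
    by rw [hgU, mul_assoc]⟩

theorem isOrdinaryTriplePoint_of_incidence [Fintype ι] (hg : ∀ i, IsSmoothForm (g i))
    {v : Fin 3 → ℂ} (hv : v ≠ 0) {i j l : ι} (hij : i ≠ j)
    (hil : i ≠ l) (hjl : j ≠ l) (h : ∀ k, eval v (g k) = 0 ↔ k = i ∨ k = j ∨ k = l)
    (tij : AreTransversal (g i) (g j) v) (til : AreTransversal (g i) (g l) v)
    (tjl : AreTransversal (g j) (g l) v) :
    IsOrdinaryTriplePoint (∏ i, g i) (Projectivization.mk ℂ v hv) := by
  classical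
  have hi := (h i).2 (Or.inl rfl)
  have hj := (h j).2 (Or.inr (Or.inl rfl))
  have hl := (h l).2 (Or.inr (Or.inr rfl))
  have bi := (hg i).isSmoothBranch (((hg i).eval_affinePoint_mk hv).2 hi)
  have bj := (hg j).isSmoothBranch (((hg j).eval_affinePoint_mk hv).2 hj)
  have bl := (hg l).isSmoothBranch (((hg l).eval_affinePoint_mk hv).2 hl)
  have hU := constantCoeff_prod_germ_ne_zero hg hv
    (s := ((Finset.univ.erase i).erase j).erase l) fun k hk h0 => by
      simp only [Finset.mem_erase, Finset.mem_univ, and_true] at hk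
      exact ((h k).1 h0).elim hk.2.2 fun h' => h'.elim hk.2.1 hk.1
  have Tij := tij.germ hg hv hi hj
  have Til := (til.germ hg hv hi hl).mul_unit bl.1 hU
  have Tjl := (tjl.germ hg hv hj hl).mul_unit bl.1 hU
  have symm : ∀ {a b : Germ}, Transversal a b → Transversal b a := fun {a b} H => by
    rw [transversal_iff] at H ⊢
    intro h0
    exact H (by linear_combination -h0)
  -- the components that do not pass through the point form a unit, absorbed in the third branch
  refine ⟨![germ (g i) (Projectivization.mk ℂ v hv), germ (g j) (Projectivization.mk ℂ v hv),
    germ (g l) (Projectivization.mk ℂ v hv) * ∏ k ∈ ((Finset.univ.erase i).erase j).erase l,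
      germ (g k) (Projectivization.mk ℂ v hv)], ?_, ?_, ?_⟩
  rotate_left 2
  · rw [Fin.prod_univ_three, germ_prod, ← Finset.mul_prod_erase _ _ (Finset.mem_univ i),
      ← Finset.mul_prod_erase (Finset.univ.erase i) _
        (Finset.mem_erase.2 ⟨hij.symm, Finset.mem_univ j⟩),
      ← Finset.mul_prod_erase ((Finset.univ.erase i).erase j) _
        (Finset.mem_erase.2 ⟨hjl.symm, Finset.mem_erase.2 ⟨hil.symm, Finset.mem_univ l⟩⟩),
      ← mul_assoc]
    rfl
  · intro k
    fin_cases k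
    · exact bi
    · exact bj
    · exact bl.mul_unit hU
  · intro k k' hk
    fin_cases k <;> fin_cases k'
    · exact absurd rfl hk
    · exact Tij
    · exact Til
    · exact symm Tij
    · exact absurd rfl hk
    · exact Tjl
    · exact symm Til
    · exact symm Tjl
    · exact absurd rfl hk

/-- A tacnode formed by a component that is a coordinate axis in the local coordinates, and a
component that is the conic `c u + u² + v² = 0`. -/
theorem isTacnode_of_incidence [Fintype ι] (hg : ∀ i, IsSmoothForm (g i))
    {v : Fin 3 → ℂ} (hv : v ≠ 0) {i j : ι} (hij : i ≠ j)
    (h : ∀ k, eval v (g k) = 0 ↔ k = i ∨ k = j) {s t : Fin 2} (hst : s ≠ t) {c : ℂ} (hc : c ≠ 0)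
    (hi : germ (g i) (Projectivization.mk ℂ v hv) = coord s)
    (hj : germ (g j) (Projectivization.mk ℂ v hv) =
      MvPowerSeries.C c * coord s + coord s ^ 2 + coord t ^ 2) :
    IsTacnode (∏ i, g i) (Projectivization.mk ℂ v hv) ∧
      tjurinaNumber (∏ i, g i) (Projectivization.mk ℂ v hv) = 3 := by
  obtain ⟨U, hU, hgU⟩ := exists_germ_prod_eq_two hg hv hij h
  rw [IsTacnode, tjurinaNumber_eq, hgU, hi, hj]
  exact ⟨isTacnodeGerm_line_mul_conic hst hc hU, finrank_tjurina_line_mul_conic hst hc hU⟩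

end Family

/-! ### Counting singular points -/

/-- The weak combinatorics and the total Tjurina number of a curve whose singular points are
listed by type. The three types exclude each other, since their second jets differ. -/
theorem hasWeakCombinatorics_of_points {f : S} {m d k n t r : ℕ} (hf : f.IsHomogeneous m)
    (harr : IsConicLineArrangement d k f) {N : Fin n → Plane} {T : Fin t → Plane}
    {R : Fin r → Plane} (hN : N.Injective) (hT : T.Injective) (hR : R.Injective)
    (nodes : ∀ i, IsNode f (N i)) (tacnodes : ∀ i, IsTacnode f (T i) ∧ tjurinaNumber f (T i) = 3)
    (triples : ∀ i, IsOrdinaryTriplePoint f (R i))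
    (sing : ∀ p, IsSingularPoint f p →
      p ∈ Set.range N ∨ p ∈ Set.range T ∨ p ∈ Set.range R) :
    HasWeakCombinatorics f d k n t r ∧ totalTjurina f = n + 3 * t + 4 * r := by
  have sN : ∀ {p}, IsNode f p → IsSingularPoint f p := fun h =>
    isSingularPoint_of_germ hf h.jet.1 h.jet.2.1
  have sT : ∀ {p}, IsTacnode f p → IsSingularPoint f p := fun h =>
    isSingularPoint_of_germ hf h.jet.1 h.jet.2.1
  have sR : ∀ {p}, IsOrdinaryTriplePoint f p → IsSingularPoint f p := fun h =>
    isSingularPoint_of_germ hf h.jet.1 h.jet.2.1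
  have eN : {p | IsNode f p} = Set.range N := by
    ext p
    refine ⟨fun h => ?_, ?_⟩
    · rcases sing p (sN h) with h' | ⟨i, rfl⟩ | ⟨i, rfl⟩
      · exact h'
      · exact absurd (tacnodes i).1 (IsNodeGerm.not_isTacnodeGerm h)
      · exact absurd (triples i) (IsNodeGerm.not_isOrdinaryTripleGerm h)
    · rintro ⟨i, rfl⟩; exact nodes i
  have eT : {p | IsTacnode f p} = Set.range T := by
    ext p
    refine ⟨fun h => ?_, ?_⟩
    · rcases sing p (sT h) with ⟨i, rfl⟩ | h' | ⟨i, rfl⟩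
      · exact absurd h (IsNodeGerm.not_isTacnodeGerm (nodes i))
      · exact h'
      · exact absurd (triples i) (IsTacnodeGerm.not_isOrdinaryTripleGerm h)
    · rintro ⟨i, rfl⟩; exact (tacnodes i).1
  have eR : {p | IsOrdinaryTriplePoint f p} = Set.range R := by
    ext p
    refine ⟨fun h => ?_, ?_⟩
    · rcases sing p (sR h) with ⟨i, rfl⟩ | ⟨i, rfl⟩ | h'
      · exact absurd h (IsNodeGerm.not_isOrdinaryTripleGerm (nodes i))
      · exact absurd h (IsTacnodeGerm.not_isOrdinaryTripleGerm (tacnodes i).1)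
      · exact h'
    · rintro ⟨i, rfl⟩; exact triples i
  have card : ∀ {l : ℕ} {P : Fin l → Plane}, P.Injective → (Set.range P).encard = l := by
    intro l P hP
    rw [← Set.image_univ, hP.encard_image, Set.encard_univ]
    simp
  refine ⟨⟨harr, fun p hp => ?_, by rw [eN, card hN], by rw [eT, card hT], by rw [eR, card hR]⟩, ?_⟩
  · rcases sing p hp with ⟨i, rfl⟩ | ⟨i, rfl⟩ | ⟨i, rfl⟩
    · exact Or.inl (nodes i)
    · exact Or.inr (Or.inl (tacnodes i).1)
    · exact Or.inr (Or.inr (triples i))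
  · have hset : {p | IsSingularPoint f p} = Set.range N ∪ (Set.range T ∪ Set.range R) := by
      ext p
      refine ⟨sing p, ?_⟩
      rintro (⟨i, rfl⟩ | ⟨i, rfl⟩ | ⟨i, rfl⟩)
      · exact sN (nodes i)
      · exact sT (tacnodes i).1
      · exact sR (triples i)
    have hTR : Disjoint (Set.range T) (Set.range R) := by
      rw [← eT, ← eR, Set.disjoint_left]
      exact fun p h h' => IsTacnodeGerm.not_isOrdinaryTripleGerm h h'
    have hNTR : Disjoint (Set.range N) (Set.range T ∪ Set.range R) := by
      rw [← eN, ← eT, ← eR, Set.disjoint_left]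
      rintro p h (h' | h')
      · exact IsNodeGerm.not_isTacnodeGerm h h'
      · exact IsNodeGerm.not_isOrdinaryTripleGerm h h'
    have hfin : ∀ {l : ℕ} (P : Fin l → Plane), (Set.range P).Finite := fun P => Set.finite_range P
    have h1 : totalTjurina f = ∑ᶠ p ∈ {p | IsSingularPoint f p}, tjurinaNumber f p := rfl
    rw [h1, hset, finsum_mem_union hNTR (hfin N) ((hfin T).union (hfin R)),
      finsum_mem_union hTR (hfin T) (hfin R), finsum_mem_range hN, finsum_mem_range hT,
      finsum_mem_range hR, finsum_eq_sum_of_fintype, finsum_eq_sum_of_fintype,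
      finsum_eq_sum_of_fintype,
      Finset.sum_congr rfl fun i _ => (tjurinaNumber_eq f (N i)).trans
        (IsNodeGerm.finrank_tjurina (nodes i)),
      Finset.sum_congr rfl fun i _ => (tacnodes i).2,
      Finset.sum_congr rfl fun i _ => (tjurinaNumber_eq f (R i)).trans
        (IsOrdinaryTripleGerm.finrank_tjurina (triples i))]
    simp
    ring

end LocalTheory

/-! ### Lines and smooth conics -/

/-- The linear form with coefficient vector `a`. -/
def linearForm (a : Fin 3 → ℂ) : S := ∑ i, C (a i) * X i

theorem linearForm_eq (a : Fin 3 → ℂ) :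
    linearForm a = C (a 0) * X 0 + C (a 1) * X 1 + C (a 2) * X 2 :=
  Fin.sum_univ_three _

theorem isHomogeneous_linearForm (a : Fin 3 → ℂ) : (linearForm a).IsHomogeneous 1 :=
  IsHomogeneous.sum _ _ _ fun _ _ => isHomogeneous_C_mul_X _ _

theorem eval_linearForm (a v : Fin 3 → ℂ) : eval v (linearForm a) = a ⬝ᵥ v := by
  simp [linearForm, dotProduct]

theorem pderiv_linearForm (a : Fin 3 → ℂ) (i : Fin 3) : pderiv i (linearForm a) = C (a i) := by
  simp [linearForm, Derivation.leibniz, pderiv_X, Pi.single_apply]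

theorem grad_linearForm (a v : Fin 3 → ℂ) : grad (linearForm a) v = a :=
  funext fun i => by simp [grad, pderiv_linearForm]

theorem exists_eq_linearForm {l : S} (hl : l.IsHomogeneous 1) : ∃ a, l = linearForm a := by
  refine ⟨fun i => coeff 0 (pderiv i l), ?_⟩
  have h := hl.sum_X_mul_pderiv
  rw [one_smul] at h
  rw [← h, h, linearForm]
  nth_rewrite 1 [← h]
  refine Finset.sum_congr rfl fun i _ => ?_
  have h0 : (pderiv i l).totalDegree = 0 := (totalDegree_zero_iff_isHomogeneous _).2 hl.pderiv
  nth_rewrite 1 [totalDegree_eq_zero_iff_eq_C.1 h0]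
  rw [mul_comm]

theorem isLine_linearForm {a : Fin 3 → ℂ} (ha : a ≠ 0) : IsLine (linearForm a) := by
  refine ⟨isHomogeneous_linearForm a, fun h => ha (funext fun i => ?_)⟩
  have := pderiv_linearForm a i
  rw [h, map_zero] at this
  exact C_injective _ _ (this.symm.trans C_0.symm)

theorem IsLine.exists_eq {l : S} (hl : IsLine l) : ∃ a, a ≠ 0 ∧ l = linearForm a := by
  obtain ⟨a, rfl⟩ := exists_eq_linearForm hl.1
  refine ⟨a, ?_, rfl⟩
  rintro rfl
  exact hl.2 (by simp [linearForm])

theorem IsLine.isSmoothForm {l : S} (hl : IsLine l) : IsSmoothForm l := by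
  obtain ⟨a, ha, rfl⟩ := hl.exists_eq
  exact ⟨1, isHomogeneous_linearForm a, fun v _ => by rwa [grad_linearForm]⟩

theorem IsSmoothConic.isSmoothForm {q : S} (hq : IsSmoothConic q) : IsSmoothForm q :=
  ⟨2, hq.1, fun v hv h => hv (hq.2 v fun i => congrFun h i)⟩

theorem IsSmoothConic.ne_zero {q : S} (hq : IsSmoothConic q) : q ≠ 0 := by
  rintro rfl
  have := hq.2 (Pi.single 0 1) fun i => by simp
  simpa using congrFun this 0

theorem not_associated_linearForm {a b : Fin 3 → ℂ} (h : crossProduct a b ≠ 0) :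
    ¬ Associated (linearForm a) (linearForm b) := by
  rintro ⟨u, hu⟩
  obtain ⟨c, -, hc⟩ := MvPolynomial.isUnit_iff_eq_C_of_isReduced.1 u.isUnit
  refine h ?_
  have : b = c • a := funext fun i => by
    have h1 := congrArg (pderiv i) hu
    rw [hc, mul_comm, Derivation.leibniz, pderiv_C, smul_zero, add_zero, pderiv_linearForm,
      pderiv_linearForm, smul_eq_mul, ← C_mul] at h1
    exact (C_injective _ _ h1).symm
  rw [this, map_smul, cross_self, smul_zero]

/-- Two lines of the projective plane meet. -/
theorem exists_common_zero {l l' : S} (hl : l.IsHomogeneous 1) (hl' : l'.IsHomogeneous 1) :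
    ∃ v : Fin 3 → ℂ, v ≠ 0 ∧ eval v l = 0 ∧ eval v l' = 0 := by
  obtain ⟨a, rfl⟩ := exists_eq_linearForm hl
  obtain ⟨b, rfl⟩ := exists_eq_linearForm hl'
  obtain ⟨v, hv, h⟩ := Matrix.exists_mulVec_eq_zero_iff.2
    (Matrix.det_eq_zero_of_row_eq_zero (A := Matrix.of ![a, b, 0]) 2 fun _ => rfl)
  refine ⟨v, hv, ?_, ?_⟩
  · rw [eval_linearForm]; exact congrFun h 0
  · rw [eval_linearForm]; exact congrFun h 1

theorem eq_C_add_of_totalDegree_eq_one {p : S} (hp : p.totalDegree = 1) :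
    p = C (coeff 0 p) + homogeneousComponent 1 p := by
  have h := sum_homogeneousComponent p
  rw [hp, Finset.sum_range_succ, Finset.sum_range_one, homogeneousComponent_zero] at h
  exact h.symm

/-- A factorization of a smooth conic into two lines would make their intersection point
singular. -/
theorem IsSmoothConic.irreducible {q : S} (hq : IsSmoothConic q) : Irreducible q := by
  have hunit : ∀ p : S, p ≠ 0 → ¬ IsUnit p → p.totalDegree ≠ 0 := fun p hp hu h0 => by
    rw [totalDegree_eq_zero_iff_eq_C.1 h0] at hu hp
    exact hu ((isUnit_iff_ne_zero.2 fun h => hp (by rw [h, C_0])).map C)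
  constructor
  · intro hu
    obtain ⟨c, -, hc⟩ := MvPolynomial.isUnit_iff_eq_C_of_isReduced.1 hu
    have := hq.1.totalDegree hq.ne_zero
    simp [hc] at this
  · intro a b hab
    by_contra! h
    have h0 := hq.ne_zero
    rw [hab] at h0
    have ha0 := left_ne_zero_of_mul h0
    have hb0 := right_ne_zero_of_mul h0
    have hdeg := hq.1.totalDegree hq.ne_zero
    rw [hab, totalDegree_mul_of_isDomain ha0 hb0] at hdeg
    have ha := hunit a ha0 h.1
    have hb := hunit b hb0 h.2
    have h1 := homogeneousComponent_isHomogeneous 1 a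
    have h2 := homogeneousComponent_isHomogeneous 1 b
    have ea := eq_C_add_of_totalDegree_eq_one (p := a) (by omega)
    have eb := eq_C_add_of_totalDegree_eq_one (p := b) (by omega)
    generalize homogeneousComponent 1 a = l at *
    generalize homogeneousComponent 1 b = l' at *
    have key : q = l * l' := by
      have h3 : homogeneousComponent 2 q = q := by
        rw [homogeneousComponent_of_mem hq.1, if_pos rfl]
      have h4 : q = C (coeff 0 a * coeff 0 b) + (C (coeff 0 a) * l' + C (coeff 0 b) * l) +
          l * l' := by
        rw [C_mul, hab]
        nth_rewrite 1 [ea]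
        nth_rewrite 1 [eb]
        ring
      have h5 : (C (coeff 0 a) * l' + C (coeff 0 b) * l).IsHomogeneous 1 :=
        (h2.C_mul _).add (h1.C_mul _)
      rw [h4, map_add, map_add, homogeneousComponent_of_mem (isHomogeneous_C _ _),
        homogeneousComponent_of_mem h5, homogeneousComponent_of_mem (h1.mul h2)] at h3
      rw [h4, ← h3]
      simp
    obtain ⟨v, hv, e1, e2⟩ := exists_common_zero h1 h2
    refine hv (hq.2 v fun i => ?_)
    rw [key, Derivation.leibniz]
    simp [e1, e2]

theorem squarefree_prod_of_irreducible {ι : Type*} [Fintype ι] {g : ι → S}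
    (h : ∀ i, Irreducible (g i)) (hne : Pairwise fun i j => ¬ Associated (g i) (g j)) :
    Squarefree (∏ i, g i) :=
  Finset.squarefree_prod_of_pairwise_isCoprime
    (fun i _ j _ hij => (h i).isRelPrime_iff_not_dvd.2 fun hd =>
      hne hij ((h i).associated_of_dvd (h j) hd)) fun i _ => (h i).squarefree

/-- The components are irreducible and pairwise not associated, so their product is reduced. -/
theorem IsConicLineArrangement.squarefree {d k : ℕ} {f : S} (h : IsConicLineArrangement d k f) :
    Squarefree f := by
  obtain ⟨l, q, hl, hq, hll, hqq, rfl⟩ := h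
  have hlq : ∀ i j, ¬ Associated (l i) (q j) := fun i j ⟨u, hu⟩ => by
    have := congrArg totalDegree hu
    obtain ⟨c, -, hc⟩ := MvPolynomial.isUnit_iff_eq_C_of_isReduced.1 u.isUnit
    rw [totalDegree_mul_of_isDomain (hl i).2 u.ne_zero, (hl i).1.totalDegree (hl i).2, hc,
      totalDegree_C, (hq j).1.totalDegree (hq j).ne_zero] at this
    omega
  have := squarefree_prod_of_irreducible (g := Sum.elim l q) (fun i => by
    rcases i with i | i
    · exact irreducible_of_isLine (hl i)
    · exact (hq i).irreducible) (by
    rintro (i | i) (j | j) hij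
    · exact hll fun h => hij (congrArg _ h)
    · exact hlq i j
    · exact fun h => hlq j i h.symm
    · exact hqq fun h => hij (congrArg _ h))
  rwa [Fintype.prod_sum_type] at this

/-- The conic `x² + y² = ρ z²`. -/
def circle (ρ : ℂ) : S := X 0 ^ 2 + X 1 ^ 2 - C ρ * X 2 ^ 2

theorem isHomogeneous_circle (ρ : ℂ) : (circle ρ).IsHomogeneous 2 :=
  ((isHomogeneous_X_pow _ _).add (isHomogeneous_X_pow _ _)).sub ((isHomogeneous_X_pow _ _).C_mul _)

theorem eval_circle (ρ : ℂ) (v : Fin 3 → ℂ) :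
    eval v (circle ρ) = v 0 ^ 2 + v 1 ^ 2 - ρ * v 2 ^ 2 := by
  simp [circle]

theorem grad_circle (ρ : ℂ) (v : Fin 3 → ℂ) :
    grad (circle ρ) v = ![2 * v 0, 2 * v 1, -(2 * ρ * v 2)] := by
  ext i
  fin_cases i <;> simp [grad, circle, pderiv_X, Derivation.leibniz, Derivation.leibniz_pow]
  ring

theorem isSmoothConic_circle {ρ : ℂ} (hρ : ρ ≠ 0) : IsSmoothConic (circle ρ) := by
  refine ⟨isHomogeneous_circle ρ, fun v hv => ?_⟩
  have h := grad_circle ρ v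
  have h0 : grad (circle ρ) v = 0 := funext hv
  rw [h0] at h
  have e0 := congrFun h 0
  have e1 := congrFun h 1
  have e2 := congrFun h 2
  simp [hρ] at e0 e1 e2
  ext i
  fin_cases i <;> assumption

/-! ### Local equations in the affine plane `z = 1` -/

section Chart

variable {v : Fin 3 → ℂ} (hv : v ≠ 0)

theorem chartIndex_mk (h2 : v 2 = 1) : chartIndex (Projectivization.mk ℂ v hv) = 2 := by
  obtain ⟨a, ha⟩ := Projectivization.exists_smul_eq_mk_rep ℂ v hv
  rw [chartIndex, if_pos]
  rw [← ha, Pi.smul_apply, h2]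
  exact smul_ne_zero a.ne_zero one_ne_zero

/-- At a point with last coordinate `1`, the local equation is the Taylor expansion. -/
theorem localEquation_mk (h2 : v 2 = 1) (f : S) : localEquation f (Projectivization.mk ℂ v hv) =
    aeval ![X 0 + C (v 0), X 1 + C (v 1), (1 : MvPolynomial (Fin 2) ℂ)] f := by
  obtain ⟨a, ha⟩ := Projectivization.exists_smul_eq_mk_rep ℂ v hv
  have hdiv : ∀ i, (Projectivization.mk ℂ v hv).rep i / (Projectivization.mk ℂ v hv).rep 2 = v i :=
    fun i => by
      rw [← ha, Pi.smul_apply, Pi.smul_apply, h2, Units.smul_def, Units.smul_def, smul_eq_mul,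
        smul_eq_mul, mul_one, mul_div_cancel_left₀ _ a.ne_zero]
  rw [localEquation, chartIndex_mk hv h2]
  congr 2
  funext i
  simp only [hdiv]
  fin_cases i <;> rfl

theorem germ_circle_mk (h2 : v 2 = 1) {ρ : ℂ} (h : eval v (circle ρ) = 0) :
    germ (circle ρ) (Projectivization.mk ℂ v hv) =
      MvPowerSeries.C (2 * v 0) * coord 0 + MvPowerSeries.C (2 * v 1) * coord 1 +
        coord 0 ^ 2 + coord 1 ^ 2 := by
  rw [eval_circle, h2] at h
  have e : localEquation (circle ρ) (Projectivization.mk ℂ v hv) =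
      C (2 * v 0) * X 0 + C (2 * v 1) * X 1 + X 0 ^ 2 + X 1 ^ 2 := by
    rw [localEquation_mk hv h2]
    have h' : C (v 0) ^ 2 + C (v 1) ^ 2 - (C ρ : MvPolynomial (Fin 2) ℂ) = 0 := by
      rw [← C_pow, ← C_pow, ← C_add, ← C_sub, ← C_0]
      congr 1
      linear_combination h
    simp only [circle, map_sub, map_add, map_pow, map_mul, aeval_X, aeval_C, algebraMap_eq,
      Matrix.cons_val_zero, Matrix.cons_val_one, Matrix.cons_val, map_ofNat]
    linear_combination h'
  rw [germ, e]
  simp [coord]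

theorem germ_linearForm_mk (h2 : v 2 = 1) {a : Fin 3 → ℂ} (h : eval v (linearForm a) = 0) :
    germ (linearForm a) (Projectivization.mk ℂ v hv) =
      MvPowerSeries.C (a 0) * coord 0 + MvPowerSeries.C (a 1) * coord 1 := by
  rw [eval_linearForm, dotProduct, Fin.sum_univ_three, h2] at h
  have e : localEquation (linearForm a) (Projectivization.mk ℂ v hv) =
      C (a 0) * X 0 + C (a 1) * X 1 := by
    rw [localEquation_mk hv h2]
    have h' : C (a 0) * C (v 0) + C (a 1) * C (v 1) + (C (a 2) : MvPolynomial (Fin 2) ℂ) = 0 := by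
      rw [← C_mul, ← C_mul, ← C_add, ← C_add, ← C_0]
      congr 1
      linear_combination h
    simp only [linearForm_eq, map_add, map_mul, aeval_X, aeval_C, algebraMap_eq,
      Matrix.cons_val_zero, Matrix.cons_val_one, Matrix.cons_val]
    linear_combination h'
  rw [germ, e]
  simp [coord]

end Chart

/-! ### Vectors and their cross products -/

theorem exists_smul_eq_of_crossProduct_eq_zero {n v : Fin 3 → ℂ} (hn : n ≠ 0)
    (h : crossProduct n v = 0) : ∃ c : ℂ, v = c • n := by
  by_contra! h'
  refine crossProduct_ne_zero_iff_linearIndependent.2 ?_ h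
  exact (LinearIndependent.pair_iff' hn).2 fun a ha => h' a ha.symm

/-- Two distinct lines have only one point in common. -/
theorem exists_smul_eq_of_dotProduct_eq_zero {a b p v : Fin 3 → ℂ} (hab : crossProduct a b ≠ 0)
    (hp : p ≠ 0) (hap : a ⬝ᵥ p = 0) (hbp : b ⬝ᵥ p = 0) (hav : a ⬝ᵥ v = 0) (hbv : b ⬝ᵥ v = 0) :
    ∃ c : ℂ, v = c • p := by
  have key : ∀ w, a ⬝ᵥ w = 0 → b ⬝ᵥ w = 0 → ∃ c : ℂ, w = c • crossProduct a b := by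
    intro w ha hb
    refine exists_smul_eq_of_crossProduct_eq_zero hab ?_
    rw [cross_cross_eq_smul_sub_smul, ha, hb, zero_smul, zero_smul, sub_zero]
  obtain ⟨c, rfl⟩ := key v hav hbv
  obtain ⟨e, rfl⟩ := key p hap hbp
  have he : e ≠ 0 := by rintro rfl; simp at hp
  exact ⟨c / e, by rw [smul_smul, div_mul_cancel₀ _ he]⟩

/-! ### Arrangements of a circle and lines -/

/-- The components of the arrangement of the circle `x² + y² = ρ z²`, at index `none`, and the
lines with coefficient vectors `a i`. -/
def component {d : ℕ} (ρ : ℂ) (a : Fin d → Fin 3 → ℂ) : Option (Fin d) → S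
  | none => circle ρ
  | some i => linearForm (a i)

section Component

variable {d : ℕ} {ρ : ℂ} {a : Fin d → Fin 3 → ℂ}

theorem prod_component : ∏ i, component ρ a i = (∏ i, linearForm (a i)) * circle ρ := by
  rw [Fintype.prod_option, mul_comm]
  rfl

/-- The certificate of a tacnode formed by the circle and a line parallel to a coordinate axis
in the affine plane `z = 1`. -/
structure IsAxisTangency (ρ : ℂ) (a : Fin d → Fin 3 → ℂ) (v : Fin 3 → ℂ) (i : Fin d)
    (s t : Fin 2) : Prop where
  ne : s ≠ t
  last : v 2 = 1
  incidence : ∀ k, eval v (component ρ a k) = 0 ↔ k = none ∨ k = some i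
  point_ne_zero : v s.castSucc ≠ 0
  point_eq_zero : v t.castSucc = 0
  line_eq_one : a i s.castSucc = 1
  line_eq_zero : a i t.castSucc = 0

theorem isAxisTangency_iff {v : Fin 3 → ℂ} {i : Fin d} {s t : Fin 2} :
    IsAxisTangency ρ a v i s t ↔ s ≠ t ∧ v 2 = 1 ∧
      (∀ k, eval v (component ρ a k) = 0 ↔ k = none ∨ k = some i) ∧ v s.castSucc ≠ 0 ∧
      v t.castSucc = 0 ∧ a i s.castSucc = 1 ∧ a i t.castSucc = 0 :=
  ⟨fun h => ⟨h.1, h.2, h.3, h.4, h.5, h.6, h.7⟩, fun h =>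
    ⟨h.1, h.2.1, h.2.2.1, h.2.2.2.1, h.2.2.2.2.1, h.2.2.2.2.2.1, h.2.2.2.2.2.2⟩⟩

theorem isSmoothForm_component (hρ : ρ ≠ 0) (ha : ∀ i, a i ≠ 0) (i : Option (Fin d)) :
    IsSmoothForm (component ρ a i) := by
  rcases i with _ | i
  · exact (isSmoothConic_circle hρ).isSmoothForm
  · exact (isLine_linearForm (ha i)).isSmoothForm

/-- In the local coordinates the line is an axis and the circle is `c u + u² + v² = 0`, where `c`
is twice the coordinate of the point that does not vanish. -/
theorem IsAxisTangency.isTacnode {v : Fin 3 → ℂ} {i : Fin d} {s t : Fin 2}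
    (h : IsAxisTangency ρ a v i s t) (hρ : ρ ≠ 0) (ha : ∀ i, a i ≠ 0) (hv : v ≠ 0) :
    IsTacnode (∏ i, component ρ a i) (Projectivization.mk ℂ v hv) ∧
      tjurinaNumber (∏ i, component ρ a i) (Projectivization.mk ℂ v hv) = 3 := by
  have h0 : eval v (circle ρ) = 0 := (h.incidence none).2 (Or.inl rfl)
  have h1 : eval v (linearForm (a i)) = 0 := (h.incidence (some i)).2 (Or.inr rfl)
  refine isTacnode_of_incidence (isSmoothForm_component hρ ha) hv (Option.some_ne_none i)
    (fun k => (h.incidence k).trans or_comm) h.ne (mul_ne_zero two_ne_zero h.point_ne_zero) ?_ ?_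
  · refine (germ_linearForm_mk hv h.last h1).trans ?_
    have e1 := h.line_eq_one
    have e0 := h.line_eq_zero
    have hst := h.ne
    fin_cases s <;> fin_cases t <;> simp_all
  · refine (germ_circle_mk hv h.last h0).trans ?_
    have e0 := h.point_eq_zero
    have hst := h.ne
    fin_cases s <;> fin_cases t <;> simp_all
    ring

/-- The certificate for the weak combinatorics of the arrangement of a circle and lines: vectors
representing its nodes, tacnodes and triple points, with the components through them. The last two
fields state that the list is complete: each common point of two components is on it. -/
structure CombinatoricsCertificate (ρ : ℂ) (a : Fin d → Fin 3 → ℂ) {n t r : ℕ}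
    (N : Fin n → Fin 3 → ℂ) (T : Fin t → Fin 3 → ℂ) (R : Fin r → Fin 3 → ℂ) : Prop where
  radius_ne_zero : ρ ≠ 0
  line_ne_zero : ∀ i, a i ≠ 0
  lines_ne : ∀ i j, i < j → crossProduct (a i) (a j) ≠ 0
  nodes : ∀ i, ∃ j k, j ≠ k ∧ (∀ l, eval (N i) (component ρ a l) = 0 ↔ l = j ∨ l = k) ∧
    AreTransversal (component ρ a j) (component ρ a k) (N i)
  tacnodes : ∀ i, ∃ j s t, IsAxisTangency ρ a (T i) j s t
  triples : ∀ i, ∃ j k l, j ≠ k ∧ j ≠ l ∧ k ≠ l ∧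
    (∀ m, eval (R i) (component ρ a m) = 0 ↔ m = j ∨ m = k ∨ m = l) ∧
    AreTransversal (component ρ a j) (component ρ a k) (R i) ∧
    AreTransversal (component ρ a j) (component ρ a l) (R i) ∧
    AreTransversal (component ρ a k) (component ρ a l) (R i)
  nodes_ne : ∀ i j, i < j → crossProduct (N i) (N j) ≠ 0
  tacnodes_ne : ∀ i j, i < j → crossProduct (T i) (T j) ≠ 0
  triples_ne : ∀ i j, i < j → crossProduct (R i) (R j) ≠ 0
  nodes_ne_zero : ∀ i, N i ≠ 0
  triples_ne_zero : ∀ i, R i ≠ 0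
  line_inter_line : ∀ i j, i < j → (∃ k, a i ⬝ᵥ N k = 0 ∧ a j ⬝ᵥ N k = 0) ∨
    (∃ k, a i ⬝ᵥ T k = 0 ∧ a j ⬝ᵥ T k = 0) ∨ (∃ k, a i ⬝ᵥ R k = 0 ∧ a j ⬝ᵥ R k = 0)
  circle_inter_line : ∀ i x y z, x ^ 2 + y ^ 2 - ρ * z ^ 2 = 0 →
    a i 0 * x + a i 1 * y + a i 2 * z = 0 → (∃ k, ∃ c : ℂ, ![x, y, z] = c • N k) ∨
    (∃ k, ∃ c : ℂ, ![x, y, z] = c • T k) ∨ (∃ k, ∃ c : ℂ, ![x, y, z] = c • R k)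

theorem mk_injective {n : ℕ} {N : Fin n → Fin 3 → ℂ} (hN0 : ∀ i, N i ≠ 0)
    (hN : ∀ i j, i < j → crossProduct (N i) (N j) ≠ 0) :
    (fun i => (Projectivization.mk ℂ (N i) (hN0 i) : Plane)).Injective := by
  intro i j hij
  obtain ⟨c, hc⟩ := (Projectivization.mk_eq_mk_iff' ℂ _ _ _ _).1 hij
  rcases lt_trichotomy i j with h | h | h
  · exact absurd (by rw [← hc, LinearMap.map_smul₂, cross_self, smul_zero]) (hN i j h)
  · exact h
  · exact absurd (by rw [← hc, map_smul, cross_self, smul_zero]) (hN j i h)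

theorem mem_range_mk {n : ℕ} {N : Fin n → Fin 3 → ℂ} (hN0 : ∀ i, N i ≠ 0) {p : Plane}
    (h : ∃ k, ∃ c : ℂ, p.rep = c • N k) :
    p ∈ Set.range fun i => (Projectivization.mk ℂ (N i) (hN0 i) : Plane) := by
  obtain ⟨k, c, hc⟩ := h
  refine ⟨k, ?_⟩
  rw [← p.mk_rep, eq_comm]
  exact (Projectivization.mk_eq_mk_iff' ℂ _ _ _ _).2 ⟨c, hc.symm⟩

namespace CombinatoricsCertificate

variable {n t r : ℕ} {N : Fin n → Fin 3 → ℂ} {T : Fin t → Fin 3 → ℂ} {R : Fin r → Fin 3 → ℂ}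

theorem tacnodes_ne_zero (h : CombinatoricsCertificate ρ a N T R) (i : Fin t) : T i ≠ 0 := by
  obtain ⟨j, s, t, hT⟩ := h.tacnodes i
  intro h0
  simpa [h0] using hT.last

theorem isConicLineArrangement (h : CombinatoricsCertificate ρ a N T R) :
    IsConicLineArrangement d 1 (∏ i, component ρ a i) := by
  refine ⟨fun i => linearForm (a i), fun _ => circle ρ,
    fun i => isLine_linearForm (h.line_ne_zero i),
    fun _ => isSmoothConic_circle h.radius_ne_zero, fun i j hij => ?_,
    fun i j hij => absurd (Subsingleton.elim i j) hij, ?_⟩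
  · rcases lt_or_gt_of_ne hij with hlt | hlt
    · exact not_associated_linearForm (h.lines_ne i j hlt)
    · exact fun h' => not_associated_linearForm (h.lines_ne j i hlt) h'.symm
  · rw [prod_component, Fin.prod_univ_one]

theorem isHomogeneous (ρ : ℂ) (a : Fin d → Fin 3 → ℂ) :
    (∏ i, component ρ a i).IsHomogeneous (d + 2) := by
  rw [prod_component]
  have := IsHomogeneous.prod (R := ℂ) Finset.univ (fun i => linearForm (a i)) (fun _ => 1)
    fun i _ => isHomogeneous_linearForm (a i)
  simpa using this.mul (isHomogeneous_circle ρ)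

theorem listed_of_line_inter_line (h : CombinatoricsCertificate ρ a N T R) {i j : Fin d}
    (hij : i < j) {v : Fin 3 → ℂ} (hi : a i ⬝ᵥ v = 0) (hj : a j ⬝ᵥ v = 0) :
    (∃ k, ∃ c : ℂ, v = c • N k) ∨ (∃ k, ∃ c : ℂ, v = c • T k) ∨ ∃ k, ∃ c : ℂ, v = c • R k := by
  have hne := h.lines_ne i j hij
  rcases h.line_inter_line i j hij with ⟨k, h1, h2⟩ | ⟨k, h1, h2⟩ | ⟨k, h1, h2⟩
  · exact Or.inl ⟨k, exists_smul_eq_of_dotProduct_eq_zero hne (h.nodes_ne_zero k) h1 h2 hi hj⟩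
  · exact Or.inr (Or.inl
      ⟨k, exists_smul_eq_of_dotProduct_eq_zero hne (h.tacnodes_ne_zero k) h1 h2 hi hj⟩)
  · exact Or.inr (Or.inr
      ⟨k, exists_smul_eq_of_dotProduct_eq_zero hne (h.triples_ne_zero k) h1 h2 hi hj⟩)

theorem listed_of_circle_inter_line (h : CombinatoricsCertificate ρ a N T R) {i : Fin d}
    {v : Fin 3 → ℂ} (h0 : eval v (circle ρ) = 0) (hi : a i ⬝ᵥ v = 0) :
    (∃ k, ∃ c : ℂ, v = c • N k) ∨ (∃ k, ∃ c : ℂ, v = c • T k) ∨ ∃ k, ∃ c : ℂ, v = c • R k := by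
  rw [eval_circle] at h0
  rw [dotProduct, Fin.sum_univ_three] at hi
  have e : v = ![v 0, v 1, v 2] := by
    ext k; fin_cases k <;> rfl
  rw [e]
  exact h.circle_inter_line i _ _ _ h0 hi

/-- A singular point lies on two components, hence is on the list; the type of a listed point is
determined by the components through it. -/
theorem hasWeakCombinatorics (h : CombinatoricsCertificate ρ a N T R) :
    HasWeakCombinatorics (∏ i, component ρ a i) d 1 n t r ∧
      totalTjurina (∏ i, component ρ a i) = n + 3 * t + 4 * r := by
  have hG := isSmoothForm_component h.radius_ne_zero h.line_ne_zero
  refine hasWeakCombinatorics_of_points (isHomogeneous ρ a) h.isConicLineArrangement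
    (mk_injective h.nodes_ne_zero h.nodes_ne) (mk_injective h.tacnodes_ne_zero h.tacnodes_ne)
    (mk_injective h.triples_ne_zero h.triples_ne) (fun i => ?_) (fun i => ?_) (fun i => ?_)
    fun p hp => ?_
  · obtain ⟨j, k, hjk, hinc, htr⟩ := h.nodes i
    exact isNode_of_incidence hG _ hjk hinc htr
  · obtain ⟨j, s, t, hT⟩ := h.tacnodes i
    exact hT.isTacnode h.radius_ne_zero h.line_ne_zero _
  · obtain ⟨j, k, l, hjk, hjl, hkl, hinc, t1, t2, t3⟩ := h.triples i
    exact isOrdinaryTriplePoint_of_incidence hG _ hjk hjl hkl hinc t1 t2 t3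
  · obtain ⟨i, j, hij, hi, hj⟩ := exists_ne_of_isSingularPoint hG hp
    have key : (∃ k, ∃ c : ℂ, p.rep = c • N k) ∨
        (∃ k, ∃ c : ℂ, p.rep = c • T k) ∨ ∃ k, ∃ c : ℂ, p.rep = c • R k := by
      rcases i with _ | i <;> rcases j with _ | j
      · exact absurd rfl hij
      · exact h.listed_of_circle_inter_line hi ((eval_linearForm _ _).symm.trans hj)
      · exact h.listed_of_circle_inter_line hj ((eval_linearForm _ _).symm.trans hi)
      · have hi' := (eval_linearForm _ _).symm.trans hi
        have hj' := (eval_linearForm _ _).symm.trans hj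
        rcases lt_or_gt_of_ne fun h' : i = j => hij (congrArg some h') with hlt | hlt
        · exact h.listed_of_line_inter_line hlt hi' hj'
        · exact h.listed_of_line_inter_line hlt hj' hi'
    exact key.imp (mem_range_mk _) (Or.imp (mem_range_mk _) (mem_range_mk _))

theorem totalDegree_eq (h : CombinatoricsCertificate ρ a N T R) :
    (∏ i, component ρ a i).totalDegree = d + 2 :=
  (isHomogeneous ρ a).totalDegree h.isConicLineArrangement.squarefree.ne_zero

end CombinatoricsCertificate

end Component

/-! ### Weak combinatorics of the explicit arrangements -/

theorem cross_eq_zero_iff (u v : Fin 3 → ℂ) : crossProduct u v = 0 ↔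
    u 1 * v 2 - u 2 * v 1 = 0 ∧ u 2 * v 0 - u 0 * v 2 = 0 ∧ u 0 * v 1 - u 1 * v 0 = 0 := by
  simp [cross_apply]

/-- The coefficient vectors of the lines of `curve3`. -/
def lines3 : Fin 1 → Fin 3 → ℂ :=
  ![![-1, 1, 4]]

theorem certificate3 : CombinatoricsCertificate 16 lines3
    ![![4, 0, 1], ![0, -4, 1]] ![] ![] where
  radius_ne_zero := by norm_num
  line_ne_zero := by simp [lines3]
  lines_ne := by simp [lines3]
  nodes := by
    simp only [Fin.forall_fin_succ, AreTransversal, IsEmpty.forall_iff, and_true]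
    refine ⟨⟨none, some 0, ?_⟩, ⟨none, some 0, ?_⟩⟩
    all_goals simp [Option.forall, Fin.forall_fin_succ, component, eval_circle, eval_linearForm,
      grad_circle, grad_linearForm, lines3, cross_eq_zero_iff]
    all_goals norm_num
  tacnodes i := i.elim0
  triples i := i.elim0
  nodes_ne := by simp [Fin.forall_fin_succ, cross_eq_zero_iff]
  tacnodes_ne := by simp
  triples_ne := by simp
  nodes_ne_zero := by simp [Fin.forall_fin_succ]
  triples_ne_zero := by simp
  line_inter_line := by simp [Fin.exists_fin_succ, lines3]
  circle_inter_line i x y z h0 h := by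
    fin_cases i
    all_goals simp [lines3, Fin.exists_fin_succ] at h ⊢
    -- eliminating `y` from the two equations leaves the product of the lines joining the points
    -- of intersection to `(0 : 1 : 0)`
    · have : x * (x - 4 * z) = 0 := by grind
      grind

/-- The coefficient vectors of the lines of `curve4`. -/
def lines4 : Fin 2 → Fin 3 → ℂ :=
  ![![-1, 1, -4], ![1, 1, -4]]

theorem certificate4 : CombinatoricsCertificate 16 lines4
    ![![-4, 0, 1], ![4, 0, 1]] ![] ![![0, 4, 1]] where
  radius_ne_zero := by norm_num
  line_ne_zero := by simp [Fin.forall_fin_succ, lines4]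
  lines_ne := by simp [Fin.forall_fin_succ, lines4, cross_eq_zero_iff]
  nodes := by
    simp only [Fin.forall_fin_succ, AreTransversal, IsEmpty.forall_iff, and_true]
    refine ⟨⟨none, some 0, ?_⟩, ⟨none, some 1, ?_⟩⟩
    all_goals simp [Option.forall, Fin.forall_fin_succ, component, eval_circle, eval_linearForm,
      grad_circle, grad_linearForm, lines4, cross_eq_zero_iff]
    all_goals norm_num
  tacnodes i := i.elim0
  triples := by
    simp only [Fin.forall_fin_succ, AreTransversal, IsEmpty.forall_iff, and_true]
    refine ⟨none, some 0, some 1, ?_⟩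
    all_goals simp [Option.forall, Fin.forall_fin_succ, component, eval_circle, eval_linearForm,
      grad_circle, grad_linearForm, lines4, cross_eq_zero_iff]
    all_goals norm_num
  nodes_ne := by simp [Fin.forall_fin_succ, cross_eq_zero_iff]
  tacnodes_ne := by simp
  triples_ne := by simp
  nodes_ne_zero := by simp [Fin.forall_fin_succ]
  triples_ne_zero := by simp
  line_inter_line := by simp [Fin.forall_fin_succ, Fin.exists_fin_succ, lines4]
  circle_inter_line i x y z h0 h := by
    fin_cases i
    all_goals simp [lines4, Fin.exists_fin_succ] at h ⊢
    · have : x * (x + 4 * z) = 0 := by grind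
      grind
    · have : x * (x - 4 * z) = 0 := by grind
      grind

/-- The coefficient vectors of the lines of `curve4'`. -/
def lines4' : Fin 2 → Fin 3 → ℂ :=
  ![![0, 1, -4], ![-1, 1, 0]]

/-- The two points on the line `y = x` and the circle have coordinates `±2 √2`. -/
theorem certificate4' {s : ℂ} (hs : s ^ 2 = 2) : CombinatoricsCertificate 16 lines4'
    ![![4, 4, 1], ![2 * s, 2 * s, 1], ![-(2 * s), -(2 * s), 1]]
    ![![0, 4, 1]] ![] where
  radius_ne_zero := by norm_num
  line_ne_zero := by simp [Fin.forall_fin_succ, lines4']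
  lines_ne := by simp [Fin.forall_fin_succ, lines4', cross_eq_zero_iff]
  nodes := by
    simp only [Fin.forall_fin_succ, AreTransversal, IsEmpty.forall_iff, and_true]
    refine ⟨⟨some 0, some 1, ?_⟩, ⟨none, some 1, ?_⟩, ⟨none, some 1, ?_⟩⟩
    all_goals simp [Option.forall, Fin.forall_fin_succ, component, eval_circle, eval_linearForm,
      grad_circle, grad_linearForm, lines4', cross_eq_zero_iff]
    all_goals grind
  tacnodes := by
    simp only [Fin.forall_fin_succ, isAxisTangency_iff, IsEmpty.forall_iff, and_true]
    refine ⟨0, 1, 0, ?_⟩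
    all_goals simp [Option.forall, Fin.forall_fin_succ, component, eval_circle, eval_linearForm,
      lines4']
    all_goals norm_num
  triples i := i.elim0
  nodes_ne := by
    simp [Fin.forall_fin_succ, cross_eq_zero_iff]
    grind
  tacnodes_ne := by simp
  triples_ne := by simp
  nodes_ne_zero := by simp [Fin.forall_fin_succ]
  triples_ne_zero := by simp
  line_inter_line := by simp [Fin.forall_fin_succ, Fin.exists_fin_succ, lines4']
  circle_inter_line i x y z h0 h := by
    fin_cases i
    all_goals simp [lines4', Fin.exists_fin_succ] at h ⊢
    · have : x * x = 0 := by grind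
      grind
    · have : (x - 2 * s * z) * (x + 2 * s * z) = 0 := by grind
      grind

/-- The coefficient vectors of the lines of `curve5`. -/
def lines5 : Fin 3 → Fin 3 → ℂ :=
  ![![-1, 1, 4], ![1, 1, -4], ![-1, 1, -4]]

theorem certificate5 : CombinatoricsCertificate 16 lines5
    ![![0, -4, 1], ![-4, 0, 1], ![1, 1, 0]] ![] ![![4, 0, 1], ![0, 4, 1]] where
  radius_ne_zero := by norm_num
  line_ne_zero := by simp [Fin.forall_fin_succ, lines5]
  lines_ne := by
    simp [Fin.forall_fin_succ, lines5, cross_eq_zero_iff]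
    norm_num
  nodes := by
    simp only [Fin.forall_fin_succ, AreTransversal, IsEmpty.forall_iff, and_true]
    refine ⟨⟨none, some 0, ?_⟩, ⟨none, some 2, ?_⟩, ⟨some 0, some 2, ?_⟩⟩
    all_goals simp [Option.forall, Fin.forall_fin_succ, component, eval_circle, eval_linearForm,
      grad_circle, grad_linearForm, lines5, cross_eq_zero_iff]
    all_goals norm_num
  tacnodes i := i.elim0
  triples := by
    simp only [Fin.forall_fin_succ, AreTransversal, IsEmpty.forall_iff, and_true]
    refine ⟨⟨none, some 0, some 1, ?_⟩, ⟨none, some 1, some 2, ?_⟩⟩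
    all_goals simp [Option.forall, Fin.forall_fin_succ, component, eval_circle, eval_linearForm,
      grad_circle, grad_linearForm, lines5, cross_eq_zero_iff]
    all_goals norm_num
  nodes_ne := by simp [Fin.forall_fin_succ, cross_eq_zero_iff]
  tacnodes_ne := by simp
  triples_ne := by simp [Fin.forall_fin_succ, cross_eq_zero_iff]
  nodes_ne_zero := by simp [Fin.forall_fin_succ]
  triples_ne_zero := by simp [Fin.forall_fin_succ]
  line_inter_line := by simp [Fin.forall_fin_succ, Fin.exists_fin_succ, lines5]
  circle_inter_line i x y z h0 h := by
    fin_cases i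
    all_goals simp [lines5, Fin.exists_fin_succ] at h ⊢
    · have : x * (x - 4 * z) = 0 := by grind
      grind
    · have : x * (x - 4 * z) = 0 := by grind
      grind
    · have : x * (x + 4 * z) = 0 := by grind
      grind

/-- The coefficient vectors of the lines of `curve6`. -/
def lines6 : Fin 4 → Fin 3 → ℂ :=
  ![![-1, 1, 4], ![1, 1, -4], ![-1, 1, -4], ![1, 1, 4]]

theorem certificate6 : CombinatoricsCertificate 16 lines6
    ![![1, 1, 0], ![1, -1, 0]] ![] ![![4, 0, 1], ![0, 4, 1], ![0, -4, 1], ![-4, 0, 1]] where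
  radius_ne_zero := by norm_num
  line_ne_zero := by simp [Fin.forall_fin_succ, lines6]
  lines_ne := by
    simp [Fin.forall_fin_succ, lines6, cross_eq_zero_iff]
    norm_num
  nodes := by
    simp only [Fin.forall_fin_succ, AreTransversal, IsEmpty.forall_iff, and_true]
    refine ⟨⟨some 0, some 2, ?_⟩, ⟨some 1, some 3, ?_⟩⟩
    all_goals simp [Option.forall, Fin.forall_fin_succ, component, eval_circle, eval_linearForm,
      grad_linearForm, lines6, cross_eq_zero_iff]
    all_goals norm_num
  tacnodes i := i.elim0
  triples := by
    simp only [Fin.forall_fin_succ, AreTransversal, IsEmpty.forall_iff, and_true]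
    refine ⟨⟨none, some 0, some 1, ?_⟩, ⟨none, some 1, some 2, ?_⟩, ⟨none, some 0, some 3, ?_⟩,
      ⟨none, some 2, some 3, ?_⟩⟩
    all_goals simp [Option.forall, Fin.forall_fin_succ, component, eval_circle, eval_linearForm,
      grad_circle, grad_linearForm, lines6, cross_eq_zero_iff]
    all_goals norm_num
  nodes_ne := by
    simp [Fin.forall_fin_succ, cross_eq_zero_iff]
    norm_num
  tacnodes_ne := by simp
  triples_ne := by
    simp [Fin.forall_fin_succ, cross_eq_zero_iff]
    norm_num
  nodes_ne_zero := by simp [Fin.forall_fin_succ]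
  triples_ne_zero := by simp [Fin.forall_fin_succ]
  line_inter_line := by simp [Fin.forall_fin_succ, Fin.exists_fin_succ, lines6]
  circle_inter_line i x y z h0 h := by
    fin_cases i
    all_goals simp [lines6, Fin.exists_fin_succ] at h ⊢
    · have : x * (x - 4 * z) = 0 := by grind
      grind
    · have : x * (x - 4 * z) = 0 := by grind
      grind
    · have : x * (x + 4 * z) = 0 := by grind
      grind
    · have : x * (x + 4 * z) = 0 := by grind
      grind

/-- The coefficient vectors of the lines of `curve7`. -/
def lines7 : Fin 5 → Fin 3 → ℂ :=
  ![![1, 0, -1], ![1, 0, 1], ![0, 1, -1], ![0, 1, 1], ![1, 1, 0]]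

/-- The two points on the line `y = -x` and the circle have coordinates `±1 / √2`. -/
theorem certificate7 {s : ℂ} (hs : s ^ 2 = 2) : CombinatoricsCertificate 1 lines7
    ![![1, 1, 1], ![-1, -1, 1], ![0, 1, 0], ![1, 0, 0], ![1, -1, s], ![1, -1, -s]]
    ![![1, 0, 1], ![-1, 0, 1], ![0, 1, 1], ![0, -1, 1]] ![![1, -1, 1], ![-1, 1, 1]] where
  radius_ne_zero := by norm_num
  line_ne_zero := by simp [Fin.forall_fin_succ, lines7]
  lines_ne := by
    simp [Fin.forall_fin_succ, lines7, cross_eq_zero_iff]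
    norm_num
  nodes := by
    simp only [Fin.forall_fin_succ, AreTransversal, IsEmpty.forall_iff, and_true]
    refine ⟨⟨some 0, some 2, ?_⟩, ⟨some 1, some 3, ?_⟩, ⟨some 0, some 1, ?_⟩,
      ⟨some 2, some 3, ?_⟩, ⟨none, some 4, ?_⟩, ⟨none, some 4, ?_⟩⟩
    all_goals simp [Option.forall, Fin.forall_fin_succ, component, eval_circle, eval_linearForm,
      grad_circle, grad_linearForm, lines7, cross_eq_zero_iff]
    all_goals grind
  tacnodes := by
    simp only [Fin.forall_fin_succ, isAxisTangency_iff, IsEmpty.forall_iff, and_true]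
    refine ⟨⟨0, 0, 1, ?_⟩, ⟨1, 0, 1, ?_⟩, ⟨2, 1, 0, ?_⟩, ⟨3, 1, 0, ?_⟩⟩
    all_goals simp [Option.forall, Fin.forall_fin_succ, component, eval_circle, eval_linearForm,
      lines7]
  triples := by
    simp only [Fin.forall_fin_succ, AreTransversal, IsEmpty.forall_iff, and_true]
    refine ⟨⟨some 0, some 3, some 4, ?_⟩, ⟨some 1, some 2, some 4, ?_⟩⟩
    all_goals simp [Option.forall, Fin.forall_fin_succ, component, eval_circle, eval_linearForm,
      grad_linearForm, lines7, cross_eq_zero_iff]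
  nodes_ne := by
    simp [Fin.forall_fin_succ, cross_eq_zero_iff]
    grind
  tacnodes_ne := by
    simp [Fin.forall_fin_succ, cross_eq_zero_iff]
    norm_num
  triples_ne := by
    simp [Fin.forall_fin_succ, cross_eq_zero_iff]
    norm_num
  nodes_ne_zero := by simp [Fin.forall_fin_succ]
  triples_ne_zero := by simp [Fin.forall_fin_succ]
  line_inter_line := by simp [Fin.forall_fin_succ, Fin.exists_fin_succ, lines7]
  circle_inter_line i x y z h0 h := by
    fin_cases i
    all_goals simp [lines7, Fin.exists_fin_succ] at h ⊢
    · have : y * y = 0 := by grind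
      grind
    · have : y * y = 0 := by grind
      grind
    · have : x * x = 0 := by grind
      grind
    · have : x * x = 0 := by grind
      grind
    · have : (s * x - z) * (s * x + z) = 0 := by grind
      grind

/-! ### Presentations of the Jacobian modules of the explicit arrangements -/

theorem eval_lineHom (t : ℂ) (v : Fin 3 → ℂ) (F : S) :
    (lineHom v F).eval t = eval (t • v) F := by
  induction F using MvPolynomial.induction_on with
  | C a => simp [lineHom]
  | add p q hp hq => simp [hp, hq]
  | mul_X p i hp =>
    rw [map_mul, Polynomial.eval_mul, hp, map_mul, lineHom, aeval_X, Polynomial.eval_mul,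
      Polynomial.eval_X, Polynomial.eval_C, eval_X, Pi.smul_apply, smul_eq_mul]

/-- Homogeneity can be tested on values, since the ground field is infinite. -/
theorem isHomogeneous_of_eval_smul {F : S} {n : ℕ}
    (h : ∀ (t : ℂ) (v : Fin 3 → ℂ), eval (t • v) F = t ^ n * eval v F) : F.IsHomogeneous n := by
  have hline : ∀ v, lineHom v F = Polynomial.X ^ n * Polynomial.C (eval v F) := fun v => by
    refine Polynomial.funext fun t => ?_
    rw [eval_lineHom, h, Polynomial.eval_mul, Polynomial.eval_pow, Polynomial.eval_X,
      Polynomial.eval_C]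
  have hcomp : ∀ k, k ≠ n → homogeneousComponent k F = 0 := by
    refine fun k hk => MvPolynomial.funext fun v => ?_
    have h1 : (lineHom v F).coeff k = eval v (homogeneousComponent k F) := by
      conv_lhs => rw [← sum_homogeneousComponent F]
      simp only [map_sum, lineHom_of_isHomogeneous (homogeneousComponent_isHomogeneous _ F),
        Polynomial.finsetSum_coeff, Polynomial.coeff_mul_C, Polynomial.coeff_X_pow, ite_mul,
        one_mul, zero_mul]
      rw [Finset.sum_ite_eq]
      split_ifs with hmem
      · rfl
      · rw [homogeneousComponent_eq_zero _ _ (by simpa using hmem), map_zero]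
    rw [← h1, hline, mul_comm, Polynomial.coeff_C_mul, Polynomial.coeff_X_pow, if_neg hk, mul_zero,
      map_zero]
  intro d hd
  by_contra hne
  have h1 := congrArg (coeff d) (hcomp _ hne)
  rw [coeff_homogeneousComponent] at h1
  rw [if_pos (by rw [Finsupp.degree_eq_weight_one]; rfl), coeff_zero] at h1
  exact hd h1

section Minors

variable (A : Matrix (Fin 3) (Fin 3) S) (u : Fin 3 → S)

theorem signedMinor_extendedMatrix_zero :
    signedMinor (extendedMatrix A u) (0 : Fin 3).castSucc = -(A 1 ⬝ᵥ crossProduct (A 2) u) := by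
  rw [signedMinor, Matrix.det_fin_three]
  have h : ∀ j, extendedMatrix A u 3 j = -u j := extendedMatrix_last A u
  have h1 : ∀ j, extendedMatrix A u 1 j = A 1 j := extendedMatrix_castSucc A u 1
  have h2 : ∀ j, extendedMatrix A u 2 j = A 2 j := extendedMatrix_castSucc A u 2
  simp [h, h1, h2, cross_apply, dotProduct, Fin.sum_univ_three]
  ring

theorem signedMinor_extendedMatrix_one :
    signedMinor (extendedMatrix A u) (1 : Fin 3).castSucc = A 0 ⬝ᵥ crossProduct (A 2) u := by
  rw [signedMinor, Matrix.det_fin_three]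
  have h : ∀ j, extendedMatrix A u 3 j = -u j := extendedMatrix_last A u
  have h1 : ∀ j, extendedMatrix A u 0 j = A 0 j := extendedMatrix_castSucc A u 0
  have h2 : ∀ j, extendedMatrix A u 2 j = A 2 j := extendedMatrix_castSucc A u 2
  simp [Fin.succAbove, h, h1, h2, cross_apply, dotProduct, Fin.sum_univ_three]
  ring

theorem signedMinor_extendedMatrix_two :
    signedMinor (extendedMatrix A u) (2 : Fin 3).castSucc = -(A 0 ⬝ᵥ crossProduct (A 1) u) := by
  rw [signedMinor, Matrix.det_fin_three]
  have h : ∀ j, extendedMatrix A u 3 j = -u j := extendedMatrix_last A u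
  have h1 : ∀ j, extendedMatrix A u 0 j = A 0 j := extendedMatrix_castSucc A u 0
  have h2 : ∀ j, extendedMatrix A u 1 j = A 1 j := extendedMatrix_castSucc A u 1
  simp [Fin.succAbove, h, h1, h2, cross_apply, dotProduct, Fin.sum_univ_three]
  ring

theorem signedMinor_extendedMatrix_last :
    signedMinor (extendedMatrix A u) (Fin.last 3) = -(A 0 ⬝ᵥ crossProduct (A 1) (A 2)) := by
  rw [signedMinor, Matrix.det_fin_three]
  have h0 : ∀ j, extendedMatrix A u 0 j = A 0 j := extendedMatrix_castSucc A u 0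
  have h1 : ∀ j, extendedMatrix A u 1 j = A 1 j := extendedMatrix_castSucc A u 1
  have h2 : ∀ j, extendedMatrix A u 2 j = A 2 j := extendedMatrix_castSucc A u 2
  simp [Fin.succAbove, Fin.last, h0, h1, h2, cross_apply, dotProduct, Fin.sum_univ_three]
  ring

end Minors

theorem pderiv_ofNat (i : Fin 3) (n : ℕ) [n.AtLeastTwo] : pderiv i (ofNat(n) : S) = 0 :=
  (pderiv i).map_natCast n

theorem sqrt_two_sq : ((√2 : ℝ) : ℂ) ^ 2 = 2 := by
  rw [← Complex.ofReal_pow, Real.sq_sqrt zero_le_two, Complex.ofReal_ofNat]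

theorem isDualBasis_curve3 : IsDualBasis ![X 0 + X 1, X 0 - 4 * X 2, X 2]
    ![![0, 1, 0], ![1, -1, 0], ![4, -4, 1]] where
  homogeneous i := by
    fin_cases i <;> refine isHomogeneous_of_eval_smul fun t v => ?_ <;> simp <;> ring
  eval_eq i j := by fin_cases i <;> fin_cases j <;> simp
  sum_eq i := by
    fin_cases i <;> simp [Fin.sum_univ_three, map_ofNat]
    ring

theorem isDualBasis_curve7 : IsDualBasis ![X 1 - X 0, X 2, X 0]
    ![![0, 1, 0], ![0, 0, 1], ![1, 1, 0]] where
  homogeneous i := by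
    fin_cases i <;> refine isHomogeneous_of_eval_smul fun t v => ?_ <;> simp
    ring
  eval_eq i j := by fin_cases i <;> fin_cases j <;> simp
  sum_eq i := by fin_cases i <;> simp [Fin.sum_univ_three]

theorem curve3_eq : curve3 = ∏ i, component 16 lines3 i := by
  rw [prod_component]
  simp [curve3, conic16, circle, lines3, linearForm_eq, map_ofNat]
  ring

/-- The form whose class generates the Jacobian module of `curve3`. -/
def jacobianClass3 : S :=
  192 * X 0 - 192 * X 1 - 768 * X 2

/-- The coefficients expressing `x + y`, `x - 4 z`, `z ^ 2` times `jacobianClass3` through the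
partial derivatives of `curve3`; one column for each of the three multiples. -/
def jacobianMatrix3 : Matrix (Fin 3) (Fin 3) S :=
  !![-96, -96, 2 * X 0 + 6 * X 1 + 48 * X 2;
    -96, 0, -6 * X 0 + 2 * X 1;
    0, -24, 3 * X 0 + 8 * X 2]

theorem presentation3 : JacobianPresentation curve3 jacobianClass3 3 1 0 1
    ![X 0 + X 1, X 0 - 4 * X 2, X 2] ![![0, 1, 0], ![1, -1, 0], ![4, -4, 1]]
    jacobianMatrix3 48 where
  homogeneous := by rw [curve3_eq]; exact CombinatoricsCertificate.isHomogeneous _ _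
  degree_ne_zero := by norm_num
  squarefree := by rw [curve3_eq]; exact certificate3.isConicLineArrangement.squarefree
  homogeneous_w := isHomogeneous_of_eval_smul fun t v => by simp [jacobianClass3]; ring
  dual := isDualBasis_curve3
  homogeneous_A i j := by
    fin_cases i <;> fin_cases j <;> refine isHomogeneous_of_eval_smul fun t v => ?_ <;>
      simp [jacobianMatrix3] <;> ring
  ne_zero := by norm_num
  minor i := by
    fin_cases i
    · refine (signedMinor_extendedMatrix_zero _ _).trans ?_
      simp [jacobianMatrix3, curve3, conic16, cross_apply, dotProduct, Fin.sum_univ_three, pderiv_X,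
        Derivation.leibniz, Derivation.leibniz_pow, pderiv_ofNat, map_ofNat]
      ring
    · refine (signedMinor_extendedMatrix_one _ _).trans ?_
      simp [jacobianMatrix3, curve3, conic16, cross_apply, dotProduct, Fin.sum_univ_three, pderiv_X,
        Derivation.leibniz, Derivation.leibniz_pow, pderiv_ofNat, map_ofNat]
      ring
    · refine (signedMinor_extendedMatrix_two _ _).trans ?_
      simp [jacobianMatrix3, curve3, conic16, cross_apply, dotProduct, Fin.sum_univ_three, pderiv_X,
        Derivation.leibniz, Derivation.leibniz_pow, pderiv_ofNat, map_ofNat]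
      ring
  minor_last := by
    rw [signedMinor_extendedMatrix_last]
    simp [jacobianMatrix3, jacobianClass3, cross_apply, dotProduct, Fin.sum_univ_three,
      map_ofNat]
    ring
  regular := ⟨2, by
    simp [curve3, conic16, pderiv_X, Derivation.leibniz, Derivation.leibniz_pow, pderiv_ofNat,
      map_ofNat]
    norm_num⟩

theorem curve4_eq : curve4 = ∏ i, component 16 lines4 i := by
  rw [prod_component]
  simp [curve4, conic16, Fin.prod_univ_succ, circle, lines4, linearForm_eq, map_ofNat]
  ring

/-- The form whose class generates the Jacobian module of `curve4`. -/
def jacobianClass4 : S :=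
  16 * X 0 * X 1 ^ 2 - 64 * X 0 * X 1 * X 2

/-- The coefficients expressing `x`, `y`, `z` times `jacobianClass4` through the partial
derivatives of `curve4`; one column for each of the three multiples. -/
def jacobianMatrix4 : Matrix (Fin 3) (Fin 3) S :=
  !![0, 4 * X 1 - 32 * X 2, 2 * X 1 - 12 * X 2;
    -4 * X 1 - 32 * X 2, 0, -2 * X 0;
    -2 * X 1 - 4 * X 2, -2 * X 0, -X 0]

theorem presentation4 : JacobianPresentation curve4 jacobianClass4 4 3 1 0
    X (fun j => Pi.single j 1) jacobianMatrix4 (-1) where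
  homogeneous := by rw [curve4_eq]; exact CombinatoricsCertificate.isHomogeneous _ _
  degree_ne_zero := by norm_num
  squarefree := by rw [curve4_eq]; exact certificate4.isConicLineArrangement.squarefree
  homogeneous_w := isHomogeneous_of_eval_smul fun t v => by simp [jacobianClass4]; ring
  dual := isDualBasis_X
  homogeneous_A i j := by
    fin_cases i <;> fin_cases j <;> refine isHomogeneous_of_eval_smul fun t v => ?_ <;>
      simp [jacobianMatrix4] <;> ring
  ne_zero := by norm_num
  minor i := by
    fin_cases i
    · refine (signedMinor_extendedMatrix_zero _ _).trans ?_
      simp [jacobianMatrix4, curve4, conic16, cross_apply, dotProduct, Fin.sum_univ_three, pderiv_X,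
        Derivation.leibniz, Derivation.leibniz_pow, pderiv_ofNat]
      ring
    · refine (signedMinor_extendedMatrix_one _ _).trans ?_
      simp [jacobianMatrix4, curve4, conic16, cross_apply, dotProduct, Fin.sum_univ_three, pderiv_X,
        Derivation.leibniz, Derivation.leibniz_pow, pderiv_ofNat]
      ring
    · refine (signedMinor_extendedMatrix_two _ _).trans ?_
      simp [jacobianMatrix4, curve4, conic16, cross_apply, dotProduct, Fin.sum_univ_three, pderiv_X,
        Derivation.leibniz, Derivation.leibniz_pow, pderiv_ofNat]
      ring
  minor_last := by
    rw [signedMinor_extendedMatrix_last]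
    simp [jacobianMatrix4, jacobianClass4, cross_apply, dotProduct, Fin.sum_univ_three]
    ring
  regular := ⟨2, by
    simp [curve4, conic16, pderiv_X, Derivation.leibniz, Derivation.leibniz_pow, pderiv_ofNat,
      map_ofNat]
    norm_num⟩

theorem curve4'_eq : curve4' = ∏ i, component 16 lines4' i := by
  rw [prod_component]
  simp [curve4', conic16, Fin.prod_univ_succ, circle, lines4', linearForm_eq, map_ofNat]
  ring

/-- The form whose class generates the Jacobian module of `curve4'`. -/
def jacobianClass4' : S :=
  64 * X 0 * X 1 * X 2 - 256 * X 0 * X 2 ^ 2 + 32 * X 1 ^ 3 - 192 * X 1 ^ 2 * X 2 +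
    1024 * X 2 ^ 3

/-- The coefficients expressing `x`, `y`, `z` times `jacobianClass4'` through the partial
derivatives of `curve4'`; one column for each of the three multiples. -/
def jacobianMatrix4' : Matrix (Fin 3) (Fin 3) S :=
  !![8 * X 0 - 8 * X 1 + 32 * X 2, 4 * X 0 + 32 * X 2, X 0 + 8 * X 2;
    16 * X 0 + 32 * X 2, 8 * X 0 + 12 * X 1 + 32 * X 2, X 1 + 24 * X 2;
    4 * X 0 + 2 * X 1, 2 * X 0 + 4 * X 1 + 4 * X 2, X 1 + 3 * X 2]

theorem presentation4' : JacobianPresentation curve4' jacobianClass4' 4 3 1 0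
    X (fun j => Pi.single j 1) jacobianMatrix4' 2 where
  homogeneous := by rw [curve4'_eq]; exact CombinatoricsCertificate.isHomogeneous _ _
  degree_ne_zero := by norm_num
  squarefree := by
    rw [curve4'_eq]
    exact (certificate4' sqrt_two_sq).isConicLineArrangement.squarefree
  homogeneous_w := isHomogeneous_of_eval_smul fun t v => by simp [jacobianClass4']; ring
  dual := isDualBasis_X
  homogeneous_A i j := by
    fin_cases i <;> fin_cases j <;> refine isHomogeneous_of_eval_smul fun t v => ?_ <;>
      simp [jacobianMatrix4'] <;> ring
  ne_zero := by norm_num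
  minor i := by
    fin_cases i
    · refine (signedMinor_extendedMatrix_zero _ _).trans ?_
      simp [jacobianMatrix4', curve4', conic16, cross_apply, dotProduct, Fin.sum_univ_three,
        pderiv_X, Derivation.leibniz, Derivation.leibniz_pow, pderiv_ofNat, map_ofNat]
      ring
    · refine (signedMinor_extendedMatrix_one _ _).trans ?_
      simp [jacobianMatrix4', curve4', conic16, cross_apply, dotProduct, Fin.sum_univ_three,
        pderiv_X, Derivation.leibniz, Derivation.leibniz_pow, pderiv_ofNat, map_ofNat]
      ring
    · refine (signedMinor_extendedMatrix_two _ _).trans ?_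
      simp [jacobianMatrix4', curve4', conic16, cross_apply, dotProduct, Fin.sum_univ_three,
        pderiv_X, Derivation.leibniz, Derivation.leibniz_pow, pderiv_ofNat, map_ofNat]
      ring
  minor_last := by
    rw [signedMinor_extendedMatrix_last]
    simp [jacobianMatrix4', jacobianClass4', cross_apply, dotProduct, Fin.sum_univ_three,
      map_ofNat]
    ring
  regular := ⟨0, by
    simp [curve4', conic16, pderiv_X, Derivation.leibniz, Derivation.leibniz_pow, pderiv_ofNat,
      map_ofNat]⟩

theorem curve5_eq : curve5 = ∏ i, component 16 lines5 i := by
  rw [prod_component]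
  simp [curve5, conic16, Fin.prod_univ_succ, circle, lines5, linearForm_eq, map_ofNat]
  ring

/-- The form whose class generates the Jacobian module of `curve5`. -/
def jacobianClass5 : S :=
  640 * X 0 ^ 2 * X 1 ^ 2 + 2560 * X 0 ^ 2 * X 1 * X 2 + 1280 * X 0 * X 1 ^ 3 -
    10240 * X 0 * X 1 ^ 2 * X 2 + 20480 * X 0 * X 1 * X 2 ^ 2 - 1920 * X 1 ^ 4 +
    7680 * X 1 ^ 3 * X 2 + 30720 * X 1 ^ 2 * X 2 ^ 2 - 122880 * X 1 * X 2 ^ 3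

/-- The coefficients expressing `x`, `y`, `z ^ 2` times `jacobianClass5` through the partial
derivatives of `curve5`; one column for each of the three multiples. -/
def jacobianMatrix5 : Matrix (Fin 3) (Fin 3) S :=
  !![-128 * X 0,
    32 * X 0 - 160 * X 1 + 640 * X 2,
    2 * X 0 ^ 2 + 104 * X 0 * X 2 - 10 * X 1 ^ 2 + 40 * X 1 * X 2;
    -480 * X 0 + 32 * X 1 + 640 * X 2,
    -448 * X 1,
    -10 * X 0 ^ 2 + 12 * X 0 * X 1 + 40 * X 0 * X 2 - 10 * X 1 ^ 2 - 136 * X 1 * X 2 -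
      320 * X 2 ^ 2;
    -40 * X 0 + 40 * X 1 + 32 * X 2,
    40 * X 0 - 40 * X 1 + 32 * X 2,
    5 * X 0 ^ 2 + 5 * X 0 * X 1 + 12 * X 0 * X 2 - 10 * X 1 ^ 2 - 16 * X 2 ^ 2]

theorem presentation5 : JacobianPresentation curve5 jacobianClass5 5 4 1 1
    X (fun j => Pi.single j 1) jacobianMatrix5 (-80) where
  homogeneous := by rw [curve5_eq]; exact CombinatoricsCertificate.isHomogeneous _ _
  degree_ne_zero := by norm_num
  squarefree := by rw [curve5_eq]; exact certificate5.isConicLineArrangement.squarefree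
  homogeneous_w := isHomogeneous_of_eval_smul fun t v => by simp [jacobianClass5]; ring
  dual := isDualBasis_X
  homogeneous_A i j := by
    fin_cases i <;> fin_cases j <;> refine isHomogeneous_of_eval_smul fun t v => ?_ <;>
      simp [jacobianMatrix5] <;> ring
  ne_zero := by norm_num
  minor i := by
    fin_cases i
    · refine (signedMinor_extendedMatrix_zero _ _).trans ?_
      simp [jacobianMatrix5, curve5, conic16, cross_apply, dotProduct, Fin.sum_univ_three, pderiv_X,
        Derivation.leibniz, Derivation.leibniz_pow, pderiv_ofNat, map_ofNat]
      ring
    · refine (signedMinor_extendedMatrix_one _ _).trans ?_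
      simp [jacobianMatrix5, curve5, conic16, cross_apply, dotProduct, Fin.sum_univ_three, pderiv_X,
        Derivation.leibniz, Derivation.leibniz_pow, pderiv_ofNat, map_ofNat]
      ring
    · refine (signedMinor_extendedMatrix_two _ _).trans ?_
      simp [jacobianMatrix5, curve5, conic16, cross_apply, dotProduct, Fin.sum_univ_three, pderiv_X,
        Derivation.leibniz, Derivation.leibniz_pow, pderiv_ofNat, map_ofNat]
      ring
  minor_last := by
    rw [signedMinor_extendedMatrix_last]
    simp [jacobianMatrix5, jacobianClass5, cross_apply, dotProduct, Fin.sum_univ_three,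
      map_ofNat]
    ring
  regular := ⟨2, by
    simp [curve5, conic16, pderiv_X, Derivation.leibniz, Derivation.leibniz_pow, pderiv_ofNat,
      map_ofNat]
    norm_num⟩

theorem curve6_eq : curve6 = ∏ i, component 16 lines6 i := by
  rw [prod_component]
  simp [curve6, conic16, Fin.prod_univ_succ, circle, lines6, linearForm_eq, map_ofNat]
  ring

/-- The form whose class generates the Jacobian module of `curve6`. -/
def jacobianClass6 : S :=
  6144 * X 0 ^ 3 * X 1 * X 2 + 6144 * X 0 * X 1 ^ 3 * X 2 - 98304 * X 0 * X 1 * X 2 ^ 3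

/-- The coefficients expressing `x`, `y`, `z ^ 3` times `jacobianClass6` through the partial
derivatives of `curve6`; one column for each of the three multiples. -/
def jacobianMatrix6 : Matrix (Fin 3) (Fin 3) S :=
  !![0, -768 * X 2, X 0 ^ 2 * X 1 + 3 * X 1 ^ 3 - 96 * X 1 * X 2 ^ 2;
    -768 * X 2, 0, 3 * X 0 ^ 3 + X 0 * X 1 ^ 2 - 96 * X 0 * X 2 ^ 2;
    -48 * X 1, -48 * X 0, -8 * X 0 * X 1 * X 2]

theorem presentation6 : JacobianPresentation curve6 jacobianClass6 6 5 1 2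
    X (fun j => Pi.single j 1) jacobianMatrix6 (-24) where
  homogeneous := by rw [curve6_eq]; exact CombinatoricsCertificate.isHomogeneous _ _
  degree_ne_zero := by norm_num
  squarefree := by rw [curve6_eq]; exact certificate6.isConicLineArrangement.squarefree
  homogeneous_w := isHomogeneous_of_eval_smul fun t v => by simp [jacobianClass6]; ring
  dual := isDualBasis_X
  homogeneous_A i j := by
    fin_cases i <;> fin_cases j <;> refine isHomogeneous_of_eval_smul fun t v => ?_ <;>
      simp [jacobianMatrix6] <;> ring
  ne_zero := by norm_num
  minor i := by
    fin_cases i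
    · refine (signedMinor_extendedMatrix_zero _ _).trans ?_
      simp [jacobianMatrix6, curve6, conic16, cross_apply, dotProduct, Fin.sum_univ_three, pderiv_X,
        Derivation.leibniz, Derivation.leibniz_pow, pderiv_ofNat, map_ofNat]
      ring
    · refine (signedMinor_extendedMatrix_one _ _).trans ?_
      simp [jacobianMatrix6, curve6, conic16, cross_apply, dotProduct, Fin.sum_univ_three, pderiv_X,
        Derivation.leibniz, Derivation.leibniz_pow, pderiv_ofNat, map_ofNat]
      ring
    · refine (signedMinor_extendedMatrix_two _ _).trans ?_
      simp [jacobianMatrix6, curve6, conic16, cross_apply, dotProduct, Fin.sum_univ_three, pderiv_X,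
        Derivation.leibniz, Derivation.leibniz_pow, pderiv_ofNat, map_ofNat]
      ring
  minor_last := by
    rw [signedMinor_extendedMatrix_last]
    simp [jacobianMatrix6, jacobianClass6, cross_apply, dotProduct, Fin.sum_univ_three,
      map_ofNat]
    ring
  regular := ⟨2, by
    simp [curve6, conic16, pderiv_X, Derivation.leibniz, Derivation.leibniz_pow, pderiv_ofNat,
      map_ofNat]
    norm_num⟩

theorem curve7_eq : curve7 = ∏ i, component 1 lines7 i := by
  rw [prod_component]
  simp [curve7, Fin.prod_univ_succ, circle, lines7, linearForm_eq]
  ring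

/-- The form whose class generates the Jacobian module of `curve7`. -/
def jacobianClass7 : S :=
  56 * X 0 ^ 3 * X 1 ^ 2 * X 2 ^ 2 - 56 * X 0 ^ 3 * X 2 ^ 4 - 84 * X 0 ^ 2 * X 1 ^ 5 +
    168 * X 0 ^ 2 * X 1 ^ 3 * X 2 ^ 2 - 84 * X 0 ^ 2 * X 1 * X 2 ^ 4 - 28 * X 0 * X 1 ^ 6 +
    56 * X 0 * X 1 ^ 4 * X 2 ^ 2 - 84 * X 0 * X 1 ^ 2 * X 2 ^ 4 + 56 * X 0 * X 2 ^ 6 +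
    84 * X 1 ^ 5 * X 2 ^ 2 - 168 * X 1 ^ 3 * X 2 ^ 4 + 84 * X 1 * X 2 ^ 6

/-- The coefficients expressing `y - x`, `z`, `x ^ 2` times `jacobianClass7` through the partial
derivatives of `curve7`; one column for each of the three multiples. -/
def jacobianMatrix7 : Matrix (Fin 3) (Fin 3) S :=
  !![-16 * X 0 ^ 2 - 12 * X 0 * X 1 - 14 * X 1 ^ 2 + 42 * X 2 ^ 2,
    -2 * X 0 * X 2 + 28 * X 1 * X 2,
    10 * X 0 ^ 3 + 13 * X 0 ^ 2 * X 1 + 15 * X 0 * X 1 ^ 2 - 24 * X 0 * X 2 ^ 2;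
    40 * X 0 * X 1 + 2 * X 1 ^ 2 - 42 * X 2 ^ 2,
    42 * X 0 * X 2 - 16 * X 1 * X 2,
    -25 * X 0 ^ 2 * X 1 - 15 * X 0 * X 1 ^ 2 + 42 * X 0 * X 2 ^ 2 - 6 * X 1 ^ 3 +
      18 * X 1 * X 2 ^ 2;
    40 * X 0 * X 2 - 40 * X 1 * X 2,
    42 * X 0 * X 1 - 16 * X 2 ^ 2,
    -25 * X 0 ^ 2 * X 2 + 27 * X 0 * X 1 * X 2 + 15 * X 1 ^ 2 * X 2 - 3 * X 2 ^ 3]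

theorem presentation7 : JacobianPresentation curve7 jacobianClass7 7 7 2 1
    ![X 1 - X 0, X 2, X 0] ![![0, 1, 0], ![0, 0, 1], ![1, 1, 0]] jacobianMatrix7 (-126) where
  homogeneous := by rw [curve7_eq]; exact CombinatoricsCertificate.isHomogeneous _ _
  degree_ne_zero := by norm_num
  squarefree := by
    rw [curve7_eq]
    exact (certificate7 sqrt_two_sq).isConicLineArrangement.squarefree
  homogeneous_w := isHomogeneous_of_eval_smul fun t v => by simp [jacobianClass7]; ring
  dual := isDualBasis_curve7
  homogeneous_A i j := by
    fin_cases i <;> fin_cases j <;> refine isHomogeneous_of_eval_smul fun t v => ?_ <;>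
      simp [jacobianMatrix7] <;> ring
  ne_zero := by norm_num
  minor i := by
    fin_cases i
    · refine (signedMinor_extendedMatrix_zero _ _).trans ?_
      simp [jacobianMatrix7, curve7, cross_apply, dotProduct, Fin.sum_univ_three, pderiv_X,
        Derivation.leibniz, Derivation.leibniz_pow, map_ofNat]
      ring
    · refine (signedMinor_extendedMatrix_one _ _).trans ?_
      simp [jacobianMatrix7, curve7, cross_apply, dotProduct, Fin.sum_univ_three, pderiv_X,
        Derivation.leibniz, Derivation.leibniz_pow, map_ofNat]
      ring
    · refine (signedMinor_extendedMatrix_two _ _).trans ?_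
      simp [jacobianMatrix7, curve7, cross_apply, dotProduct, Fin.sum_univ_three, pderiv_X,
        Derivation.leibniz, Derivation.leibniz_pow, map_ofNat]
      ring
  minor_last := by
    rw [signedMinor_extendedMatrix_last]
    simp [jacobianMatrix7, jacobianClass7, cross_apply, dotProduct, Fin.sum_univ_three,
      map_ofNat]
    ring
  regular := ⟨0, by
    simp [curve7, pderiv_X, Derivation.leibniz, Derivation.leibniz_pow, map_ofNat]⟩

/-! ### Directional derivatives and conics in adapted coordinates -/

/-- The derivative in the direction `x`. -/
def dirDeriv (x : Fin 3 → ℂ) : Derivation ℂ S S := mkDerivation ℂ fun i => C (x i)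

theorem dirDeriv_X (x : Fin 3 → ℂ) (i : Fin 3) : dirDeriv x (X i) = C (x i) := mkDerivation_X _ _ _

theorem dirDeriv_C (x : Fin 3 → ℂ) (c : ℂ) : dirDeriv x (C c) = 0 :=
  (dirDeriv x).map_algebraMap c

theorem dirDeriv_eq_sum (x : Fin 3 → ℂ) (F : S) : dirDeriv x F = ∑ i, C (x i) * pderiv i F := by
  have : dirDeriv x = ∑ i, (C (x i) : S) • pderiv i := by
    refine MvPolynomial.derivation_ext fun j => ?_
    rw [dirDeriv_X, ← Derivation.coeFnAddMonoidHom_apply, map_sum, Finset.sum_apply]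
    simp [pderiv_X, Pi.single_apply]
  rw [this, ← Derivation.coeFnAddMonoidHom_apply, map_sum, Finset.sum_apply]
  simp

theorem dirDeriv_comm (x y : Fin 3 → ℂ) (F : S) :
    dirDeriv x (dirDeriv y F) = dirDeriv y (dirDeriv x F) := by
  have : ⁅dirDeriv x, dirDeriv y⁆ = 0 := MvPolynomial.derivation_ext fun i => by
    simp [Derivation.commutator_apply, dirDeriv_X]
  have h := congrArg (fun D : Derivation ℂ S S => D F) this
  simpa [Derivation.commutator_apply, sub_eq_zero] using h

theorem eval_dirDeriv (x y : Fin 3 → ℂ) (F : S) : eval y (dirDeriv x F) = x ⬝ᵥ grad F y := by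
  rw [dirDeriv_eq_sum]
  simp [dotProduct, grad]

theorem dirDeriv_of_isHomogeneous_one {l : S} (hl : l.IsHomogeneous 1) (x : Fin 3 → ℂ) :
    dirDeriv x l = C (eval x l) := by
  obtain ⟨a, rfl⟩ := exists_eq_linearForm hl
  rw [dirDeriv_eq_sum, eval_linearForm, dotProduct, map_sum]
  exact Finset.sum_congr rfl fun i _ => by rw [pderiv_linearForm, C_mul, mul_comm]

theorem IsHomogeneous.dirDeriv {F : S} {n : ℕ} (hF : F.IsHomogeneous n) (x : Fin 3 → ℂ) :
    (dirDeriv x F).IsHomogeneous (n - 1) := by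
  rw [dirDeriv_eq_sum]
  exact IsHomogeneous.sum _ _ _ fun i _ => hF.pderiv.C_mul _

theorem dirDeriv_mem_jacobianIdeal (f : S) (x : Fin 3 → ℂ) : dirDeriv x f ∈ jacobianIdeal f := by
  rw [dirDeriv_eq_sum]
  exact Ideal.sum_mem _ fun i _ => Ideal.mul_mem_left _ _ (pderiv_mem_jacobianIdeal f i)

/-- A line and a point on it are part of a system of coordinates. -/
theorem exists_isDualBasis {a p : Fin 3 → ℂ} (ha : a ≠ 0) (hp : p ≠ 0) (hap : a ⬝ᵥ p = 0) :
    ∃ (l : Fin 3 → S) (v : Fin 3 → Fin 3 → ℂ), IsDualBasis l v ∧ l 0 = linearForm a ∧ v 1 = p := by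
  obtain ⟨i, hi⟩ := Function.ne_iff.1 hp
  obtain ⟨b, hb⟩ : ∃ b : Fin 3 → ℂ, b ⬝ᵥ p = 1 := ⟨Pi.single i (p i)⁻¹, by
    rw [single_dotProduct, inv_mul_cancel₀ hi]⟩
  have hw : crossProduct a b ≠ 0 := fun h => by
    obtain ⟨c, rfl⟩ := exists_smul_eq_of_crossProduct_eq_zero ha h
    rw [smul_dotProduct, hap, smul_zero] at hb
    exact zero_ne_one hb
  obtain ⟨k, hk⟩ := Function.ne_iff.1 hw
  obtain ⟨c, hcp, hc⟩ : ∃ c : Fin 3 → ℂ, c ⬝ᵥ p = 0 ∧ c ⬝ᵥ crossProduct a b ≠ 0 := by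
    refine ⟨Pi.single k 1 - p k • b, ?_, ?_⟩
    · rw [sub_dotProduct, smul_dotProduct, hb, single_dotProduct]; simp
    · rw [sub_dotProduct, smul_dotProduct, dot_cross_self, single_dotProduct]; simpa using hk
  set A : Matrix (Fin 3) (Fin 3) ℂ := ![a, b, c] with hA
  have hdet : IsUnit A.det := by
    rw [isUnit_iff_ne_zero, hA, ← triple_product_eq_det, triple_product_permutation,
      triple_product_permutation]
    exact hc
  have hAA := A.mul_nonsing_inv hdet
  have hAA' := A.nonsing_inv_mul hdet
  refine ⟨fun j => linearForm (A j), fun j i => A⁻¹ i j, ⟨fun j => isHomogeneous_linearForm _,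
    fun i j => ?_, fun i => ?_⟩, rfl, ?_⟩
  · rw [eval_linearForm]
    have := congrFun (congrFun hAA i) j
    rw [Matrix.one_apply] at this
    rw [← this, Matrix.mul_apply]
    rfl
  · have h1 : ∀ k, ∑ j, A⁻¹ i j * A j k = (1 : Matrix (Fin 3) (Fin 3) ℂ) i k := fun k => by
      rw [← hAA', Matrix.mul_apply]
    simp only [linearForm, Finset.mul_sum, ← mul_assoc, ← C_mul]
    rw [Finset.sum_comm]
    simp only [← Finset.sum_mul, ← map_sum, h1, Matrix.one_apply]
    simp
  · have h1 : A.mulVec p = Pi.single 1 1 := by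
      ext j
      fin_cases j
      · exact hap
      · exact hb
      · exact hcp
    have h2 := congrArg A⁻¹.mulVec h1
    rw [Matrix.mulVec_mulVec, hAA', Matrix.one_mulVec] at h2
    rw [h2]
    ext j
    simp

/-- The entries of the symmetric matrix of the quadratic form `2 q` in the basis `v`. -/
def polar (q : S) (v : Fin 3 → Fin 3 → ℂ) (j k : Fin 3) : ℂ := eval (v k) (dirDeriv (v j) q)

theorem polar_eq (q : S) (v : Fin 3 → Fin 3 → ℂ) (j k : Fin 3) :
    polar q v j k = v j ⬝ᵥ grad q (v k) := eval_dirDeriv _ _ _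

theorem polar_comm {q : S} (hq : q.IsHomogeneous 2) (v : Fin 3 → Fin 3 → ℂ) (j k : Fin 3) :
    polar q v j k = polar q v k j := by
  refine C_injective (Fin 3) ℂ ?_
  rw [polar, polar, ← dirDeriv_of_isHomogeneous_one (IsHomogeneous.dirDeriv hq _),
    ← dirDeriv_of_isHomogeneous_one (IsHomogeneous.dirDeriv hq _), dirDeriv_comm]

namespace IsDualBasis

variable {l : Fin 3 → S} {v : Fin 3 → Fin 3 → ℂ}

theorem eq_sum (h : IsDualBasis l v) {F : S} (hF : F.IsHomogeneous 1) :
    F = ∑ k, C (eval (v k) F) * l k := by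
  obtain ⟨a, rfl⟩ := exists_eq_linearForm hF
  simp only [eval_linearForm, dotProduct, map_sum, Finset.sum_mul]
  rw [Finset.sum_comm, linearForm]
  refine Finset.sum_congr rfl fun i _ => ?_
  rw [h.sum_eq i, Finset.mul_sum]
  exact Finset.sum_congr rfl fun j _ => by rw [C_mul, mul_assoc]

theorem eq_zero_of_dotProduct (h : IsDualBasis l v) {a : Fin 3 → ℂ} (ha : ∀ j, v j ⬝ᵥ a = 0) :
    a = 0 := by
  by_contra h0
  refine (isLine_linearForm h0).2 ?_
  rw [h.eq_sum (isHomogeneous_linearForm a)]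
  exact Finset.sum_eq_zero fun k _ => by rw [eval_linearForm, dotProduct_comm, ha, C_0, zero_mul]

/-- Euler's identity, applied twice. -/
theorem two_mul_eq (h : IsDualBasis l v) {q : S} (hq : q.IsHomogeneous 2) :
    2 * q = ∑ j, ∑ k, C (polar q v j k) * l j * l k := by
  have h1 := hq.sum_X_mul_pderiv
  have h2 : ∑ i, X i * pderiv i q = ∑ j, l j * dirDeriv (v j) q := by
    simp only [dirDeriv_eq_sum, Finset.mul_sum]
    rw [Finset.sum_comm]
    refine Finset.sum_congr rfl fun i _ => ?_
    nth_rewrite 1 [h.sum_eq i]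
    rw [Finset.sum_mul]
    exact Finset.sum_congr rfl fun j _ => by ring
  rw [h2, nsmul_eq_mul] at h1
  rw [← Nat.cast_two, ← h1]
  refine Finset.sum_congr rfl fun j _ => ?_
  rw [h.eq_sum (IsHomogeneous.dirDeriv hq (v j)), Finset.mul_sum]
  exact Finset.sum_congr rfl fun k _ => by rw [polar]; ring

/-- The restriction of a conic to the line `l 0 = 0`, as a binary quadratic form. -/
theorem eval_eq_of_eval_zero (h : IsDualBasis l v) {q : S} (hq : q.IsHomogeneous 2) {x : Fin 3 → ℂ}
    (hx : eval x (l 0) = 0) : 2 * eval x q = polar q v 1 1 * eval x (l 1) ^ 2 +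
      2 * polar q v 1 2 * eval x (l 1) * eval x (l 2) + polar q v 2 2 * eval x (l 2) ^ 2 := by
  have h1 := congrArg (eval x) (h.two_mul_eq hq)
  simp only [map_mul, map_add, eval_C, map_ofNat, Fin.sum_univ_three, hx] at h1
  rw [h1, polar_comm hq v 2 1]
  ring

theorem eq_add_of_eval_zero (h : IsDualBasis l v) {x : Fin 3 → ℂ} (hx : eval x (l 0) = 0) :
    x = eval x (l 1) • v 1 + eval x (l 2) • v 2 := by
  ext i
  have := congrArg (eval x) (h.sum_eq i)
  simp only [eval_X, map_add, map_mul, eval_C, Fin.sum_univ_three, hx] at this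
  rw [this]
  simp
  ring

theorem eval_add_smul (h : IsDualBasis l v) (s t : ℂ) (i : Fin 3) :
    eval (s • v 1 + t • v 2) (l i) =
      s * (if i = 1 then 1 else 0) + t * (if i = 2 then 1 else 0) := by
  rw [← h.eval_eq i 1, ← h.eval_eq i 2]
  obtain ⟨a, ha⟩ := exists_eq_linearForm (h.homogeneous i)
  rw [ha]
  simp only [eval_linearForm, dotProduct_add, dotProduct_smul, smul_eq_mul]

theorem eval_zero (h : IsDualBasis l v) (i : Fin 3) : eval 0 (l i) = 0 := by
  obtain ⟨a, ha⟩ := exists_eq_linearForm (h.homogeneous i)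
  rw [ha, eval_linearForm, dotProduct_zero]

theorem dotProduct_grad (h : IsDualBasis l v) {q : S} (hq : q.IsHomogeneous 2) (j : Fin 3)
    (x : Fin 3 → ℂ) : v j ⬝ᵥ grad q x = ∑ k, polar q v j k * eval x (l k) := by
  rw [← eval_dirDeriv, h.eq_sum (IsHomogeneous.dirDeriv hq (v j)), map_sum]
  exact Finset.sum_congr rfl fun k _ => by rw [map_mul, eval_C, polar]

/-- A line meets a conic. -/
theorem exists_eval_eq_zero (h : IsDualBasis l v) {q : S} (hq : q.IsHomogeneous 2) :
    ∃ x, x ≠ 0 ∧ eval x (l 0) = 0 ∧ eval x q = 0 := by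
  obtain ⟨s, t, hst, hroot⟩ : ∃ s t : ℂ, (s ≠ 0 ∨ t ≠ 0) ∧
      polar q v 1 1 * s ^ 2 + 2 * polar q v 1 2 * s * t + polar q v 2 2 * t ^ 2 = 0 := by
    by_cases h11 : polar q v 1 1 = 0
    · exact ⟨1, 0, Or.inl one_ne_zero, by simp [h11]⟩
    · obtain ⟨d, hd⟩ := IsAlgClosed.exists_eq_mul_self
        (discrim (polar q v 1 1) (2 * polar q v 1 2) (polar q v 2 2))
      obtain ⟨s, hs⟩ := exists_quadratic_eq_zero h11 ⟨d, hd⟩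
      exact ⟨s, 1, Or.inr one_ne_zero, by linear_combination hs⟩
  have hl := h.eval_add_smul s t
  have h0 : eval (s • v 1 + t • v 2) (l 0) = 0 := by rw [hl]; simp
  refine ⟨s • v 1 + t • v 2, fun hx => ?_, h0, ?_⟩
  · have e1 := hl 1
    have e2 := hl 2
    rw [hx, h.eval_zero] at e1 e2
    simp at e1 e2
    exact hst.elim (fun h => h e1.symm) fun h => h e2.symm
  · have := h.eval_eq_of_eval_zero hq h0
    rw [hl 1, hl 2] at this
    simp at this
    have h2 : (2 : ℂ) * eval (s • v 1 + t • v 2) q = 0 := by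
      rw [← hroot, ← this]
    exact (mul_eq_zero.1 h2).resolve_left two_ne_zero

end IsDualBasis

/-! ### A smooth conic and a tangent line -/

section Tangent

variable {l : Fin 3 → S} {v : Fin 3 → Fin 3 → ℂ} {q : S} {b c e g : ℂ}

/-- The derivatives of a conic, touching the line `l 0 = 0` at its point with `l 2 = 0`, times the
line. They are combinations of the three quadratic forms `2 b l₀ l₁ + c l₂²`, `l₀²` and `l₀
l₂`. -/
theorem dirDeriv_tangent (h : IsDualBasis l v)
    (hq : q = l 0 * (C e * l 0 + C b * l 1 + C g * l 2) + C c * l 2 ^ 2) (x : Fin 3 → ℂ) :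
    dirDeriv x (l 0 * q) = C (eval x (l 0)) * (2 * C b * l 0 * l 1 + C c * l 2 ^ 2) +
      C (3 * e * eval x (l 0) + b * eval x (l 1) + g * eval x (l 2)) * l 0 ^ 2 +
      C (2 * g * eval x (l 0) + 2 * c * eval x (l 2)) * (l 0 * l 2) := by
  have h0 := dirDeriv_of_isHomogeneous_one (h.homogeneous 0) x
  have h1 := dirDeriv_of_isHomogeneous_one (h.homogeneous 1) x
  have h2 := dirDeriv_of_isHomogeneous_one (h.homogeneous 2) x
  simp only [hq, Derivation.leibniz, Derivation.leibniz_pow, map_add, smul_eq_mul, h0, h1, h2,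
    dirDeriv_C, C_mul, map_ofNat, nsmul_eq_mul]
  push_cast
  ring

/-- The Hilbert–Burch matrix of the Jacobian ideal of a smooth conic together with one of its
tangent lines. -/
def tangentMatrix (l : Fin 3 → S) (b c : ℂ) : Matrix (Fin 3) (Fin 2) S :=
  !![0, l 0; l 2, -(2 * C b * l 1); -l 0, -(C c * l 2)]

theorem signedMinor_tangentMatrix_zero :
    signedMinor (tangentMatrix l b c) 0 = -(2 * C b * l 0 * l 1 + C c * l 2 ^ 2) := by
  simp [signedMinor, tangentMatrix, Matrix.det_fin_two]
  ring

theorem signedMinor_tangentMatrix_one : signedMinor (tangentMatrix l b c) 1 = -l 0 ^ 2 := by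
  simp [signedMinor, tangentMatrix, Matrix.det_fin_two, Fin.succAbove]
  ring

theorem signedMinor_tangentMatrix_two : signedMinor (tangentMatrix l b c) 2 = -(l 0 * l 2) := by
  simp [signedMinor, tangentMatrix, Matrix.det_fin_two, Fin.succAbove]

/-- The derivatives in the directions of the dual basis generate the ideal of the three quadratic
forms that are the maximal minors of the Hilbert–Burch matrix. -/
theorem jacobianIdeal_tangent (h : IsDualBasis l v)
    (hq : q = l 0 * (C e * l 0 + C b * l 1 + C g * l 2) + C c * l 2 ^ 2) (hb : b ≠ 0)
    (hc : c ≠ 0) : jacobianIdeal (l 0 * q) =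
      Ideal.span (Set.range (signedMinor (tangentMatrix l b c))) := by
  have hcancel : ∀ {t : ℂ} {I : Ideal S} {F : S}, t ≠ 0 → C t * F ∈ I → F ∈ I := by
    intro t I F ht hF
    have := I.mul_mem_left (C t⁻¹) hF
    rwa [← mul_assoc, ← C_mul, inv_mul_cancel₀ ht, C_1, one_mul] at this
  refine le_antisymm (Ideal.span_le.2 ?_) (Ideal.span_le.2 ?_)
  · have hK : ∀ i, signedMinor (tangentMatrix l b c) i ∈
        Ideal.span (Set.range (signedMinor (tangentMatrix l b c))) :=
      fun i => Ideal.subset_span ⟨i, rfl⟩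
    have k0 := hK 0
    have k1 := hK 1
    have k2 := hK 2
    rw [signedMinor_tangentMatrix_zero, neg_mem_iff] at k0
    rw [signedMinor_tangentMatrix_one, neg_mem_iff] at k1
    rw [signedMinor_tangentMatrix_two, neg_mem_iff] at k2
    rintro _ ⟨i, rfl⟩
    have hi : pderiv i (l 0 * q) = dirDeriv (Pi.single i 1) (l 0 * q) := by
      rw [dirDeriv_eq_sum, Finset.sum_eq_single i] <;> simp +contextual
    change pderiv i (l 0 * q) ∈ _
    rw [hi, dirDeriv_tangent h hq]
    exact add_mem (add_mem (Ideal.mul_mem_left _ _ k0) (Ideal.mul_mem_left _ _ k1))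
      (Ideal.mul_mem_left _ _ k2)
  · have d0 := dirDeriv_mem_jacobianIdeal (l 0 * q) (v 0)
    have d1 := dirDeriv_mem_jacobianIdeal (l 0 * q) (v 1)
    have d2 := dirDeriv_mem_jacobianIdeal (l 0 * q) (v 2)
    rw [dirDeriv_tangent h hq] at d0 d1 d2
    simp [h.eval_eq] at d0 d1 d2
    have e1 := hcancel hb (by simpa using d1)
    have e2 : l 0 * l 2 ∈ jacobianIdeal (l 0 * q) := by
      refine hcancel (mul_ne_zero two_ne_zero hc) ?_
      refine (Ideal.add_mem_iff_right _ (Ideal.mul_mem_left _ (C g) e1)).1 ?_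
      simpa using d2
    have e0 : 2 * C b * l 0 * l 1 + C c * l 2 ^ 2 ∈ jacobianIdeal (l 0 * q) := by
      refine (Ideal.add_mem_iff_left _ (Ideal.mul_mem_left _ (C (3 * e)) e1)).1
        ((Ideal.add_mem_iff_left _ (Ideal.mul_mem_left _ (C (2 * g)) e2)).1 ?_)
      simpa using d0
    rintro _ ⟨i, rfl⟩
    fin_cases i
    · change signedMinor (tangentMatrix l b c) 0 ∈ _
      rw [signedMinor_tangentMatrix_zero]
      exact neg_mem e0
    · change signedMinor (tangentMatrix l b c) 1 ∈ _
      rw [signedMinor_tangentMatrix_one]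
      exact neg_mem e1
    · change signedMinor (tangentMatrix l b c) 2 ∈ _
      rw [signedMinor_tangentMatrix_two]
      exact neg_mem e2

/-- A smooth conic with a tangent line is a free curve: its Jacobian ideal is saturated. -/
theorem saturatedJacobianIdeal_tangent_le (h : IsDualBasis l v)
    (hq : q = l 0 * (C e * l 0 + C b * l 1 + C g * l 2) + C c * l 2 ^ 2) (hb : b ≠ 0)
    (hc : c ≠ 0) : saturatedJacobianIdeal (l 0 * q) ≤ jacobianIdeal (l 0 * q) := by
  have hev : eval (v 2) (signedMinor (tangentMatrix l b c) 0) ≠ 0 := by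
    rw [signedMinor_tangentMatrix_zero]
    simp [h.eval_eq, hc]
  have h01 : ∀ i : Fin 3, i ≠ 2 → eval (v 2) (l i) = 0 := fun i hi => by simp [h.eval_eq, hi]
  refine saturatedJacobianIdeal_le le_rfl fun F hF => ?_
  rw [jacobianIdeal_tangent h hq hb hc] at hF ⊢
  refine mem_span_signedMinor_of_mul_mem (fun p hp => ?_) (h.prime 0) (h.not_dvd zero_ne_one)
    h.isPrime_span ⟨0, fun hmem => hev ?_⟩
    (hF _ (mem_irrelevantIdeal_of_isHomogeneous_one (h.homogeneous 0)))
    (hF _ (mem_irrelevantIdeal_of_isHomogeneous_one (h.homogeneous 1)))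
  · by_contra! hdvd
    have hp0 : p ∣ l 0 := by
      have := hdvd 1
      rw [signedMinor_tangentMatrix_one, dvd_neg] at this
      exact hp.dvd_of_dvd_pow this
    have hp0' := hp.irreducible.associated_of_dvd (h.prime 0).irreducible hp0
    obtain ⟨F, hF⟩ := hp0'.symm.dvd.trans (hdvd 0)
    exact hev (by rw [hF, map_mul, h01 0 (by decide), zero_mul])
  · obtain ⟨s, t, hst⟩ := Ideal.mem_span_pair.1 hmem
    rw [← hst, map_add, map_mul, map_mul, h01 0 (by decide), h01 1 (by decide)]
    simp

end Tangent

/-- A line and a smooth conic which meet in a point with a common tangent do not form a nearly free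
curve. -/
theorem not_isNearlyFree_of_tangent {a p : Fin 3 → ℂ} {q : S} (ha : a ≠ 0) (hq : IsSmoothConic q)
    (hp : p ≠ 0) (hap : a ⬝ᵥ p = 0) (ht : ¬ AreTransversal (linearForm a) q p) :
    ¬ IsNearlyFree (linearForm a * q) := by
  obtain ⟨l, v, h, hl, rfl⟩ := exists_isDualBasis ha hp hap
  rw [← hl]
  rw [AreTransversal, grad_linearForm, not_not] at ht
  obtain ⟨κ, hκ⟩ := exists_smul_eq_of_crossProduct_eq_zero ha ht
  have hgrad : ∀ x, x ≠ 0 → grad q x ≠ 0 := fun x hx h0 => hx (hq.2 x fun i => congrFun h0 i)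
  have hκ0 : κ ≠ 0 := by
    rintro rfl
    exact hgrad _ hp (by rw [hκ, zero_smul])
  -- tangency: the gradient at `p = v 1` is proportional to the line
  have hcol : ∀ j, polar q v j 1 = if j = 0 then κ else 0 := fun j => by
    rw [polar_eq, hκ, dotProduct_smul, dotProduct_comm, ← eval_linearForm, ← hl, h.eval_eq]
    simp [eq_comm]
  have h01 : polar q v 0 1 = κ := hcol 0
  have h11 : polar q v 1 1 = 0 := hcol 1
  have h21 : polar q v 2 1 = 0 := hcol 2
  -- otherwise the symmetric matrix of the conic kills the vector with coordinates
  -- `0, polar q v 2 0, -κ`, and the conic is singular there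
  have hc : polar q v 2 2 ≠ 0 := fun h22 => by
    have hx := h.eval_add_smul (polar q v 2 0) (-κ)
    have hx0 : polar q v 2 0 • v 1 + (-κ) • v 2 = 0 := by
      by_contra hne
      refine hgrad _ hne (h.eq_zero_of_dotProduct fun j => ?_)
      rw [h.dotProduct_grad hq.1]
      simp only [hx, hcol, Fin.sum_univ_three]
      fin_cases j
      · simp [polar_comm hq.1 v 0 2]
        ring
      · simp [polar_comm hq.1 v 1 2, h21]
      · simp [h22]
    have h2 := hx 2
    rw [hx0, h.eval_zero] at h2
    simp at h2
    exact hκ0 h2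
  have hqe : q = l 0 * (C (polar q v 0 0 / 2) * l 0 + C κ * l 1 + C (polar q v 0 2) * l 2) +
      C (polar q v 2 2 / 2) * l 2 ^ 2 := by
    have h2 := h.two_mul_eq hq.1
    rw [Fin.sum_univ_three, Fin.sum_univ_three, Fin.sum_univ_three, Fin.sum_univ_three,
      polar_comm hq.1 v 1 0, polar_comm hq.1 v 1 2, polar_comm hq.1 v 2 0, h01, h11, h21,
      C_0] at h2
    have half : ∀ t : ℂ, (C t : S) = 2 * C (t / 2) := fun t => by
      rw [← map_ofNat C 2, ← C_mul, mul_div_cancel₀ t two_ne_zero]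
    refine mul_left_cancel₀ (two_ne_zero (α := S)) ?_
    rw [h2, half (polar q v 0 0), half (polar q v 2 2)]
    ring
  intro hnf
  refine (Submodule.Quotient.nontrivial_iff.1 hnf.nontrivial) ?_
  rw [Submodule.eq_top_iff']
  exact fun F => saturatedJacobianIdeal_tangent_le h hqe hκ0 (div_ne_zero hc two_ne_zero) F.2

/-! ### A smooth conic and a secant line -/

/-- A line and a smooth conic without common tangent meet in two nodes. -/
theorem hasWeakCombinatorics_of_transversal {a : Fin 3 → ℂ} {q : S} (ha : a ≠ 0)
    (hq : IsSmoothConic q) (ht : ∀ p, p ≠ 0 → a ⬝ᵥ p = 0 → eval p q = 0 →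
      AreTransversal (linearForm a) q p) :
    HasWeakCombinatorics (linearForm a * q) 1 1 2 0 0 := by
  obtain ⟨p, hp, hap, hqp⟩ : ∃ p : Fin 3 → ℂ, p ≠ 0 ∧ a ⬝ᵥ p = 0 ∧ eval p q = 0 := by
    obtain ⟨y, hy, hay, -⟩ := exists_common_zero (isHomogeneous_linearForm a)
      (isHomogeneous_linearForm a)
    rw [eval_linearForm] at hay
    obtain ⟨l, v, h, hl, -⟩ := exists_isDualBasis ha hy hay
    obtain ⟨p, hp, h0, h1⟩ := h.exists_eval_eq_zero hq.1
    exact ⟨p, hp, by rw [← eval_linearForm, ← hl, h0], h1⟩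
  obtain ⟨l, v, h, hl, rfl⟩ := exists_isDualBasis ha hp hap
  have hline : ∀ x, a ⬝ᵥ x = eval x (l 0) := fun x => by rw [hl, eval_linearForm]
  have hv1 : eval (v 1) (l 1) = 1 := by simp [h.eval_eq]
  have h11 : polar q v 1 1 = 0 := by
    have := h.eval_eq_of_eval_zero hq.1 ((hline _).symm.trans hap)
    simpa [hqp, h.eval_eq] using this.symm
  -- otherwise the line is the tangent of the conic at `v 1`
  have h12 : polar q v 1 2 ≠ 0 := fun h12 => by
    refine ht _ hp hap hqp ?_
    have hg : grad q (v 1) - polar q v 0 1 • a = 0 := h.eq_zero_of_dotProduct fun j => by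
      rw [dotProduct_sub, dotProduct_smul, ← polar_eq, dotProduct_comm (v j) a, hline, h.eval_eq]
      fin_cases j
      · simp
      · simp [h11]
      · simp [polar_comm hq.1 v 2 1, h12]
    rw [grad_linearForm, sub_eq_zero.1 hg, map_smul, cross_self, smul_zero]
  -- on the line the conic is `l 2 * (2 * polar 1 2 * l 1 + polar 2 2 * l 2)` up to a factor: its
  -- first zero is `v 1`, and `x` is the other one
  have hx := h.eval_add_smul (-(polar q v 2 2 / 2)) (polar q v 1 2)
  obtain ⟨x, hxdef⟩ : ∃ x, x = -(polar q v 2 2 / 2) • v 1 + polar q v 1 2 • v 2 := ⟨_, rfl⟩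
  rw [← hxdef] at hx
  have hx0 : x ≠ 0 := fun h0 => by
    have := hx 2
    rw [h0, h.eval_zero] at this
    simp at this
    exact h12 this.symm
  have hax : a ⬝ᵥ x = 0 := by rw [hline, hx]; simp
  have hqx : eval x q = 0 := by
    have := h.eval_eq_of_eval_zero hq.1 ((hline _).symm.trans hax)
    rw [h11, hx 1, hx 2] at this
    simp at this
    have h2 : 2 * eval x q = 0 := by rw [this]; ring
    exact (mul_eq_zero.1 h2).resolve_left two_ne_zero
  have hcover : ∀ y, a ⬝ᵥ y = 0 → eval y q = 0 → (∃ c : ℂ, y = c • v 1) ∨ ∃ c : ℂ, y = c • x := by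
    intro y hay hqy
    have hy0 := (hline _).symm.trans hay
    have e := h.eq_add_of_eval_zero hy0
    have e1 := h.eval_eq_of_eval_zero hq.1 hy0
    rw [hqy, h11] at e1
    by_cases ht0 : eval y (l 2) = 0
    · exact Or.inl ⟨eval y (l 1), by rw [ht0, zero_smul, add_zero] at e; exact e⟩
    · have e2 : polar q v 1 2 * eval y (l 1) = -(polar q v 2 2 / 2) * eval y (l 2) := by
        refine mul_left_cancel₀ (mul_ne_zero two_ne_zero ht0) ?_
        linear_combination -e1
      refine Or.inr ⟨eval y (l 2) / polar q v 1 2, ?_⟩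
      have e3 : eval y (l 1) = eval y (l 2) / polar q v 1 2 * -(polar q v 2 2 / 2) := by
        rw [div_mul_eq_mul_div, eq_div_iff h12]
        linear_combination e2
      rw [hxdef, smul_add, smul_smul, smul_smul, div_mul_cancel₀ _ h12, ← e3]
      exact e
  have hcross : crossProduct (v 1) x ≠ 0 := fun h0 => by
    obtain ⟨c, hc⟩ := exists_smul_eq_of_crossProduct_eq_zero hp h0
    have h2 := hx 2
    rw [hc, eval_smul_of_isHomogeneous (h.homogeneous 2), h.eval_eq] at h2
    simp at h2
    exact h12 h2.symm
  have hG : ∀ i, IsSmoothForm (![linearForm a, q] i) := fun i => by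
    fin_cases i
    · exact (isLine_linearForm ha).isSmoothForm
    · exact hq.isSmoothForm
  have hprod : linearForm a * q = ∏ i, ![linearForm a, q] i := by simp
  have hN0 : ∀ i, ![v 1, x] i ≠ 0 := by
    simp [Fin.forall_fin_succ, hx0, hp]
  have harr : IsConicLineArrangement 1 1 (linearForm a * q) :=
    ⟨fun _ => linearForm a, fun _ => q, fun _ => isLine_linearForm ha, fun _ => hq,
      fun i j hij => absurd (Subsingleton.elim i j) hij,
      fun i j hij => absurd (Subsingleton.elim i j) hij, by simp⟩
  have hnode : ∀ (y : Fin 3 → ℂ) (hy : y ≠ 0), a ⬝ᵥ y = 0 → eval y q = 0 →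
      IsNode (linearForm a * q) (Projectivization.mk ℂ y hy) := fun y hy hay hqy => by
    rw [hprod]
    refine isNode_of_incidence hG hy (zero_ne_one : (0 : Fin 2) ≠ 1) (fun k => ?_)
      (ht y hy hay hqy)
    fin_cases k
    · simpa [eval_linearForm] using hay
    · simpa using hqy
  refine (hasWeakCombinatorics_of_points (N := fun i => Projectivization.mk ℂ (![v 1, x] i) (hN0 i))
    (T := Fin.elim0) (R := Fin.elim0) ((isHomogeneous_linearForm a).mul hq.1) harr
    (mk_injective hN0 ?_) (fun i => i.elim0) (fun i => i.elim0) (fun i => ?_) (fun i => i.elim0)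
    (fun i => i.elim0) fun P hP => Or.inl (mem_range_mk hN0 ?_)).1
  · simp [Fin.forall_fin_succ, hcross]
  · fin_cases i
    · exact hnode _ hp hap hqp
    · exact hnode _ hx0 hax hqx
  · rw [hprod] at hP
    obtain ⟨i, j, hij, hi, hj⟩ := exists_ne_of_isSingularPoint hG hP
    have hboth : a ⬝ᵥ P.rep = 0 ∧ eval P.rep q = 0 := by
      rw [← eval_linearForm]
      fin_cases i <;> fin_cases j
      · exact absurd rfl hij
      · exact ⟨hi, hj⟩
      · exact ⟨hj, hi⟩
      · exact absurd rfl hij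
    rcases hcover _ hboth.1 hboth.2 with ⟨c, hc⟩ | ⟨c, hc⟩
    · exact ⟨0, c, hc⟩
    · exact ⟨1, c, hc⟩

/-- A nearly free union of a line and a smooth conic has exactly two nodes. -/
theorem eq_two_of_isNearlyFree {f : S} {n t r : ℕ} (hf : HasWeakCombinatorics f 1 1 n t r)
    (hnf : IsNearlyFree f) : n = 2 ∧ t = 0 ∧ r = 0 := by
  obtain ⟨l, q, hl, hq, -, -, hprod⟩ := hf.arrangement
  rw [Fin.prod_univ_one, Fin.prod_univ_one] at hprod
  obtain ⟨a, ha, hla⟩ := (hl 0).exists_eq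
  rw [hla] at hprod
  subst hprod
  have h := hasWeakCombinatorics_of_transversal ha (hq 0) fun p hp hap _ => by
    by_contra ht
    exact not_isNearlyFree_of_tangent ha (hq 0) hp hap ht hnf
  exact ⟨by exact_mod_cast hf.nodes.symm.trans h.nodes,
    by exact_mod_cast hf.tacnodes.symm.trans h.tacnodes,
    by exact_mod_cast hf.triples.symm.trans h.triples⟩

/-! ### The explicit arrangements are nearly free -/

/-- The conclusions for an explicit arrangement, read off from the two certificates. The local
Tjurina numbers of a node, a tacnode and an ordinary triple point are `1`, `3` and `4`. -/
theorem nearlyFree_of_certificates {f w : S} {m e r σ d n t k : ℕ} {l : Fin 3 → S}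
    {v : Fin 3 → Fin 3 → ℂ} {A : Matrix (Fin 3) (Fin 3) S} {κ ρ : ℂ} {a : Fin d → Fin 3 → ℂ}
    {N : Fin n → Fin 3 → ℂ} {T : Fin t → Fin 3 → ℂ} {R : Fin k → Fin 3 → ℂ}
    (hf : f = ∏ i, component ρ a i) (hc : CombinatoricsCertificate ρ a N T R)
    (hp : JacobianPresentation f w m e r σ l v A κ)
    (heq : ((r : ℤ) + 1) ^ 2 - (r + 1) * (d + 2 - 1) + (d + 2 - 1) ^ 2 = n + 3 * t + 4 * k + 1) :
    HasWeakCombinatorics f d 1 n t k ∧ totalTjurina f = n + 3 * t + 4 * k ∧ mdr f = r + 1 ∧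
      SatisfiesDimcaEquation f ∧ IsNearlyFree f := by
  have h1 := hc.hasWeakCombinatorics
  have h2 := hc.totalDegree_eq
  rw [← hf] at h1 h2
  refine ⟨h1.1, h1.2, hp.mdr_eq, ?_, hp.isNearlyFree⟩
  rw [SatisfiesDimcaEquation, h1.2, h2, hp.mdr_eq]
  push_cast
  exact heq

end ConicLine

end

open ConicLine in
theorem mainTheorem5 :
    -- the explicit examples: lines, conics, nodes, tacnodes, ordinary triple points
    (HasWeakCombinatorics curve3 1 1 2 0 0 ∧ totalTjurina curve3 = 2 ∧ mdr curve3 = 1 ∧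
      SatisfiesDimcaEquation curve3 ∧ IsNearlyFree curve3) ∧
    (HasWeakCombinatorics curve4 2 1 2 0 1 ∧ totalTjurina curve4 = 6 ∧ mdr curve4 = 2 ∧
      SatisfiesDimcaEquation curve4 ∧ IsNearlyFree curve4) ∧
    (HasWeakCombinatorics curve4' 2 1 3 1 0 ∧ totalTjurina curve4' = 6 ∧ mdr curve4' = 2 ∧
      SatisfiesDimcaEquation curve4' ∧ IsNearlyFree curve4') ∧
    (HasWeakCombinatorics curve5 3 1 3 0 2 ∧ totalTjurina curve5 = 11 ∧ mdr curve5 = 2 ∧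
      SatisfiesDimcaEquation curve5 ∧ IsNearlyFree curve5) ∧
    (HasWeakCombinatorics curve6 4 1 2 0 4 ∧ totalTjurina curve6 = 18 ∧ mdr curve6 = 2 ∧
      SatisfiesDimcaEquation curve6 ∧ IsNearlyFree curve6) ∧
    (HasWeakCombinatorics curve7 5 1 6 4 2 ∧ totalTjurina curve7 = 26 ∧ mdr curve7 = 3 ∧
      SatisfiesDimcaEquation curve7 ∧ IsNearlyFree curve7) ∧
    -- existence in the degrees 3, 4, 5, 6, 7
    (∀ m : ℕ, 3 ≤ m → m ≤ 7 → ∃ (d k n₂ t n₃ : ℕ) (f : S), 1 ≤ d ∧ 1 ≤ k ∧ 2 * k + d = m ∧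
      HasWeakCombinatorics f d k n₂ t n₃ ∧ IsNearlyFree f) ∧
    -- uniqueness of the weak combinatorics in degree 3
    (∀ (d k n₂ t n₃ : ℕ) (f : S), 1 ≤ d → 1 ≤ k → 2 * k + d = 3 →
      HasWeakCombinatorics f d k n₂ t n₃ → IsNearlyFree f →
      d = 1 ∧ k = 1 ∧ n₂ = 2 ∧ t = 0 ∧ n₃ = 0) := by
  have h3 := nearlyFree_of_certificates curve3_eq certificate3 presentation3 (by norm_num)
  have h4 := nearlyFree_of_certificates curve4_eq certificate4 presentation4 (by norm_num)
  have h4' := nearlyFree_of_certificates curve4'_eq (certificate4' sqrt_two_sq) presentation4'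
    (by norm_num)
  have h5 := nearlyFree_of_certificates curve5_eq certificate5 presentation5 (by norm_num)
  have h6 := nearlyFree_of_certificates curve6_eq certificate6 presentation6 (by norm_num)
  have h7 := nearlyFree_of_certificates curve7_eq (certificate7 sqrt_two_sq) presentation7
    (by norm_num)
  refine ⟨h3, h4, h4', h5, h6, h7, fun m hm hm' => ?_, ?_⟩
  · interval_cases m
    · exact ⟨1, 1, 2, 0, 0, curve3, le_rfl, le_rfl, rfl, h3.1, h3.2.2.2.2⟩
    · exact ⟨2, 1, 2, 0, 1, curve4, by norm_num, le_rfl, rfl, h4.1, h4.2.2.2.2⟩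
    · exact ⟨3, 1, 3, 0, 2, curve5, by norm_num, le_rfl, rfl, h5.1, h5.2.2.2.2⟩
    · exact ⟨4, 1, 2, 0, 4, curve6, by norm_num, le_rfl, rfl, h6.1, h6.2.2.2.2⟩
    · exact ⟨5, 1, 6, 4, 2, curve7, by norm_num, le_rfl, rfl, h7.1, h7.2.2.2.2⟩
  · intro d k n₂ t n₃ f hd hk hm hf hnf
    obtain ⟨rfl, rfl⟩ : d = 1 ∧ k = 1 := by omega
    exact ⟨rfl, rfl, eq_two_of_isNearlyFree hf hnf⟩
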